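/- Conventions. $\mathbb H^2$ is the upper half-plane with its hyperbolic metric $\sigma$ of curvature $-1$. $\mathbb{A}\mathrm{d}\mathbb{S}^3$ is $\mathrm{PSL}(2,\mathbb R)$ with the bi-invariant Lorentzian metric induced by $-\det$, and $\mathrm{Isom}_0(\mathbb{A}\mathrm{d}\mathbb{S}^3)=\mathrm{PSL}(2,\mathbb R)^2$ acts by $(A,B)\cdot X=AXB^{-1}$. An anti-de Sitter (AdS) manifold is a manifold with an $(\mathrm{Isom}_0(\mathbb{A}\mathrm{d}\mathbb{S}^3),\mathbb{A}\mathrm{d}\mathbb{S}^3)$-structure. Branched AdS manifolds. Let $M$ be an orientable $3$-manifold and let $L\subset M$ be a closed subset that is a disjoint union of embedded circles $K_i$ with disjoint open tubular neighbourhoods $T_i\cong D^2\times S^1$, $K_i=\{0\}\times S^1$, where $D^2\subset\mathbb C$ is the open unit disc. An AdS structure on $M\setminus L$ is branched with singular locus $L$ if these neighbourhoods can be chosen so that the following holds for each $i$. Let $(r,x,y)\in(0,1)\times\mathbb R^2$ be the coordinates on the universal cover of $T_i\setminus K_i$ given by $(r,x,y)\mapsto(re^{ix},e^{iy})$. (i)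 The developing map on this cover extends continuously to $r=0$, with a value there that is independent of $x$. (ii) The values at $r=0$ form a complete timelike geodesic $\ell_i$. (iii) The developing map lifts to the universal cover of $\mathbb{A}\mathrm{d}\mathbb{S}^3\setminus\ell_i$. After an isometry that moves $\ell_i$ to the stabilizer of $\sqrt{-1}\in\mathbb H^2$, this universal cover is $(0,\infty)\times\mathbb R^2\ni(r,\theta,\eta)\mapsto R^\theta A(r)R^{-\eta}$, where $A(r)=\mathrm{diag}(e^{r/2},e^{-r/2})$ and $R^\theta=\begin{pmatrix}\cos(\theta/2)&\sin(\theta/2)\\-\sin(\theta/2)&\cos(\theta/2)\end{pmatrix}$. The lifted holonomy of the meridian $x\mapsto x+2\pi$ is the translation by $(0,\theta_i,\eta_i)$ with $\theta_i,\eta_i\in2\pi\mathbb Z$, and the lifted holonomy of the longitude $y\mapsto y+2\pi$ is the translation by $(0,0,2\pi)$. Theorem. Let $\Sigma=\Gamma\backslash\mathbb H^2$ be a hyperbolic surface, not necessarily closed, where $\Gamma=\pi_1(\Sigma)\subset\mathrm{PSL}(2,\mathbb R)$ acts freely and properly discontinuously on $\widetilde\Sigma=\mathbb H^2$. Let $\rho,j:\Gamma\to\mathrm{PSL}(2,\mathbb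 R)$ be representations. Let $f:\widetilde\Sigma\to\mathbb H^2$ be a $\rho$-equivariant $C^1$ map, and let $h:\widetilde\Sigma\to\mathbb H^2$ be a $j$-equivariant $C^1$ branched immersion; that is, $h$ is an immersion except at a discrete set $C$ of points at which, in suitable local $C^1$ coordinates, it has the form $z\mapsto z^n$, $n\ge2$. Assume $f^*\sigma<h^*\sigma$: for all tangent vectors $v$, $f^*\sigma(v,v)\le h^*\sigma(v,v)$, with strict inequality for $v\neq0$ at the points where $h^*\sigma$ is positive definite. Put $C_0=C/\Gamma$, and let $$\mathbb{A}\mathrm{d}\mathbb{S}^{f,h}=\{(A,p)\in\mathrm{PSL}(2,\mathbb R)\times\widetilde\Sigma: A(f(p))=h(p)\},\qquad \mathcal F(A,p)=p,\qquad \mathcal I(A,p)=A.$$ Then $\mathbb{A}\mathrm{d}\mathbb{S}^{f,h}$ is homeomorphic to the open solid torus, and the following hold. 1. $\Gamma$ acts on $\mathbb{A}\mathrm{d}\mathbb{S}^{f,h}$ freely, properly discontinuously and by homeomorphisms through $\gamma\cdot(A,p)=(j(\gamma)A\rho(\gamma)^{-1},\gamma p)$. (This is the action of $\Gamma_{j,\rho}=\{(j(\gamma),\rho(\gamma)):\gamma\in\Gamma\}$.)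 2. $\mathcal F:\mathbb{A}\mathrm{d}\mathbb{S}^{f,h}\to\widetilde\Sigma$ is continuous and $\Gamma$-equivariant, and its fibers are homeomorphic to the circle. 3. Let $L=\mathcal F^{-1}(C)$ and $\mathbb{A}\mathrm{d}\mathbb{S}^{f,h}_*=\mathbb{A}\mathrm{d}\mathbb{S}^{f,h}\setminus L$. Then $\mathbb{A}\mathrm{d}\mathbb{S}^{f,h}_*$ is an AdS manifold for which $\mathcal I$ is locally a chart. The restriction $\mathcal F:\mathbb{A}\mathrm{d}\mathbb{S}^{f,h}_*\to\widetilde\Sigma\setminus C$ is a principal $S^1$-bundle whose fibers are timelike geodesics. 4. The AdS structure descends to $\mathcal M^{f,h}_*=\mathbb{A}\mathrm{d}\mathbb{S}^{f,h}_*/\Gamma$, and makes it a branched AdS manifold with singular locus $L/\Gamma\subset\mathbb{A}\mathrm{d}\mathbb{S}^{f,h}/\Gamma$. The components of $L/\Gamma$ can be indexed by $C_0$, and they are finite in number if $\Sigma$ is closed. The holonomy representation of $\mathcal M^{f,h}_*$ (which is defined up to conjugation) is the composition $$\pi_1(\mathcal M^{f,h}_*)\to\pi_1(\Sigma\setminus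 C_0)\to\pi_1(\Sigma)\cong\Gamma\to\mathrm{Isom}_0(\mathbb{A}\mathrm{d}\mathbb{S}^3),$$ where the first map is induced by $\mathcal F$, the second by the inclusion, and the third is $(j,\rho)$. -/

import Mathlib

open Set Filter Topology
open scoped UpperHalfPlane Manifold

noncomputable section

/-! ## The group `PSL(2, ℝ)` and its action on the hyperbolic plane -/

/-- The group `PSL(2, ℝ)`, with its quotient topology. It is also the underlying space of the
three-dimensional anti-de Sitter space. -/
abbrev PSL2R : Type := Matrix.ProjectiveSpecialLinearGroup (Fin 2) ℝ

theorem center_smul_upperHalfPlane (g : Matrix.SpecialLinearGroup (Fin 2) ℝ)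
    (hg : g ∈ Subgroup.center (Matrix.SpecialLinearGroup (Fin 2) ℝ)) (z : ℍ) : g • z = z := by
  obtain ⟨r, hr, hs⟩ := Matrix.SpecialLinearGroup.mem_center_iff.mp hg
  have h00 : g 0 0 = r := by
    have := congrFun (congrFun hs 0) 0
    simpa [Matrix.scalar_apply] using this.symm
  have h11 : g 1 1 = r := by
    have := congrFun (congrFun hs 1) 1
    simpa [Matrix.scalar_apply] using this.symm
  have h01 : g 0 1 = 0 := by
    have := congrFun (congrFun hs 0) 1
    simpa [Matrix.scalar_apply] using this.symm
  have h10 : g 1 0 = 0 := by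
    have := congrFun (congrFun hs 1) 0
    simpa [Matrix.scalar_apply] using this.symm
  have hr0 : r ≠ 0 := by
    rintro rfl
    simp at hr
  ext
  rw [UpperHalfPlane.coe_specialLinearGroup_apply]
  simp only [h00, h11, h01, h10]
  have : (r : ℂ) ≠ 0 := by exact_mod_cast hr0
  simp [this]

/-- The Möbius action of `PSL(2, ℝ)` on the upper half-plane, as a homomorphism. -/
def PSL2R.toPerm : PSL2R →* Equiv.Perm ℍ :=
  QuotientGroup.lift _ (MulAction.toPermHom (Matrix.SpecialLinearGroup (Fin 2) ℝ) ℍ)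
    (fun g hg => MonoidHom.mem_ker.mpr
      (Equiv.ext fun z => center_smul_upperHalfPlane g hg z))

/-- The Möbius action of `PSL(2, ℝ)` on the upper half-plane. -/
instance PSL2R.mulAction : MulAction PSL2R ℍ := MulAction.compHom ℍ PSL2R.toPerm

theorem PSL2R.mk_smul (g : Matrix.SpecialLinearGroup (Fin 2) ℝ) (z : ℍ) :
    (QuotientGroup.mk g : PSL2R) • z = g • z := rfl

instance PSL2R.continuousConstSMul : ContinuousConstSMul PSL2R ℍ where
  continuous_const_smul g := by
    induction g using QuotientGroup.induction_on with
    | H g => exact continuous_const_smul g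

instance PSL2R.subgroup_continuousConstSMul (Γ : Subgroup PSL2R) : ContinuousConstSMul Γ ℍ where
  continuous_const_smul γ := continuous_const_smul (γ : PSL2R)

/-! ## Maps of the hyperbolic plane to itself, in the coordinate `ℍ ⊆ ℂ` -/

/-- A map `φ : ℍ → ℍ` as a map between planes (only its values on the open upper half-plane
matter). -/
def toPlane (φ : ℍ → ℍ) : ℂ → ℂ := fun z => (φ (UpperHalfPlane.ofComplex z) : ℂ)

/-- The real differential of `φ : ℍ → ℍ` at `p`. -/
def hDeriv (φ : ℍ → ℍ) (p : ℍ) : ℂ →L[ℝ] ℂ := fderiv ℝ (toPlane φ) (p : ℂ)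

/-- `φ : ℍ → ℍ` is of class `C¹` (in the real sense). -/
def IsC1 (φ : ℍ → ℍ) : Prop := ContDiffOn ℝ 1 (toPlane φ) {z : ℂ | 0 < z.im}

/-- `pullbackMetric φ p v = (φ^* σ)_p (v, v)`, where `σ = |dz|² / (Im z)²` is the hyperbolic metric
of curvature `-1` on the upper half-plane. -/
def pullbackMetric (φ : ℍ → ℍ) (p : ℍ) (v : ℂ) : ℝ := ‖hDeriv φ p v‖ ^ 2 / (φ p).im ^ 2

/-- `f^* σ < h^* σ`: the inequality `≤` holds on every tangent vector, and it is strict (on nonzero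
vectors) at every point where `h^* σ` is positive definite. -/
def PullbackLT (f h : ℍ → ℍ) : Prop :=
  ∀ p : ℍ, (∀ v : ℂ, pullbackMetric f p v ≤ pullbackMetric h p v) ∧
    ((∀ v : ℂ, v ≠ 0 → 0 < pullbackMetric h p v) →
      ∀ v : ℂ, v ≠ 0 → pullbackMetric f p v < pullbackMetric h p v)

/-- The singular set of `h`: the points where `h` is not an immersion. -/
def singularSet (h : ℍ → ℍ) : Set ℍ := {p | ¬ Function.Injective (hDeriv h p)}

/-- `h` has a branch point at `p`: in suitable local complex coordinates centred at `p` and at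
`h p` it takes the form `z ↦ z ^ n` with `n ≥ 2`. -/
def IsBranchPoint (h : ℍ → ℍ) (p : ℍ) : Prop :=
  ∃ n : ℕ, 2 ≤ n ∧ ∃ e e' : OpenPartialHomeomorph ℂ ℂ,
    (p : ℂ) ∈ e.source ∧ e p = 0 ∧ ((h p : ℍ) : ℂ) ∈ e'.source ∧ e' (h p) = 0 ∧
    ContDiffOn ℝ 1 e e.source ∧ ContDiffOn ℝ 1 e.symm e.target ∧
    ContDiffOn ℝ 1 e' e'.source ∧ ContDiffOn ℝ 1 e'.symm e'.target ∧
    ∀ᶠ z in 𝓝 (p : ℂ), e' (toPlane h z) = e z ^ n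

/-- A branched immersion: an immersion apart from a discrete set of branch points. -/
def IsBranchedImmersion (h : ℍ → ℍ) : Prop :=
  IsC1 h ∧ IsDiscrete (singularSet h) ∧ ∀ p ∈ singularSet h, IsBranchPoint h p

/-! ## Anti-de Sitter space: isometries, timelike geodesics -/

/-- The action of `Isom₀(AdS³) = PSL(2, ℝ) × PSL(2, ℝ)` on `AdS³ = PSL(2, ℝ)`,
`(A, B) · X = A X B⁻¹`. -/
def adsIsom (g : PSL2R × PSL2R) (X : PSL2R) : PSL2R := g.1 * X * g.2⁻¹

theorem continuous_adsIsom (g : PSL2R × PSL2R) : Continuous (adsIsom g) := by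
  unfold adsIsom
  fun_prop

/-- `c` is, near the time `t₀`, an affinely parametrized timelike geodesic of `AdS³`.

The metric of `AdS³` is induced by the flat metric `-det` on the space of `2 × 2` matrices on the
hypersurface `SL(2, ℝ) = {det = 1}`. A curve in this hypersurface is a geodesic if and only if its
acceleration in the ambient space is normal to the hypersurface, that is, a multiple of the position
vector; and it is timelike if and only if `-det` of its velocity is negative. -/
def IsTimelikeGeodesicAt (c : ℝ → PSL2R) (t₀ : ℝ) : Prop :=
  ∃ (A : ℝ → Matrix.SpecialLinearGroup (Fin 2) ℝ) (V : ℝ → Matrix (Fin 2) (Fin 2) ℝ) (k : ℝ → ℝ),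
    ∀ᶠ t in 𝓝 t₀, c t = QuotientGroup.mk (A t) ∧
      (∀ a b, HasDerivAt (fun s => (A s).1 a b) (V t a b) t) ∧
      (∀ a b, HasDerivAt (fun s => V s a b) (k t * (A t).1 a b) t) ∧
      -(V t).det < 0

/-- A complete timelike geodesic of `AdS³`, as a subset. -/
def IsCompleteTimelikeGeodesic (s : Set PSL2R) : Prop :=
  ∃ c : ℝ → PSL2R, (∀ t, IsTimelikeGeodesicAt c t) ∧ range c = s

/-- The timelike geodesic `ℓ_{i,i}` of elements of `PSL(2, ℝ)` that fix the point `i` of `ℍ`. -/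
def axisGeodesic : Set PSL2R := {A | A • UpperHalfPlane.I = UpperHalfPlane.I}

/-- The hyperbolic translation `A(r) = diag(e^{r/2}, e^{-r/2})`. -/
def hypTrans (r : ℝ) : PSL2R :=
  QuotientGroup.mk
    (⟨!![Real.exp (r / 2), 0; 0, Real.exp (-(r / 2))], by
      rw [Matrix.det_fin_two_of, ← Real.exp_add]; simp⟩ : Matrix.SpecialLinearGroup (Fin 2) ℝ)

/-- The rotation `R^θ` of angle `θ` that fixes the point `i`. -/
def rot (θ : ℝ) : PSL2R :=
  QuotientGroup.mk
    (⟨!![Real.cos (θ / 2), Real.sin (θ / 2); -Real.sin (θ / 2), Real.cos (θ / 2)], by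
      rw [Matrix.det_fin_two_of]
      nlinarith [Real.sin_sq_add_cos_sq (θ / 2)]⟩ : Matrix.SpecialLinearGroup (Fin 2) ℝ)

/-- The universal covering map `T : (0, ∞) × ℝ × ℝ → AdS³ \ ℓ_{i,i}`,
`(r, θ, η) ↦ R^θ A(r) R^{-η}`. -/
def adsCover (u : ℝ × ℝ × ℝ) : PSL2R := rot u.2.1 * hypTrans u.1 * rot (-u.2.2)

/-! ## Anti-de Sitter structures, developing maps, holonomy -/

/-- The pregroupoid of maps that locally agree with elements of `Isom₀(AdS³)`. -/
def adsPregroupoid : Pregroupoid PSL2R where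
  property φ s := ∀ x ∈ s, ∃ g : PSL2R × PSL2R, ∀ᶠ y in 𝓝 x, φ y = adsIsom g y
  comp := by
    intro φ ψ u v hφ hψ _ _ _ x hx
    obtain ⟨g, hg⟩ := hφ x hx.1
    obtain ⟨k, hk⟩ := hψ (φ x) hx.2
    refine ⟨k * g, ?_⟩
    have hc : Tendsto φ (𝓝 x) (𝓝 (φ x)) := by
      have h1 : Tendsto (adsIsom g) (𝓝 x) (𝓝 (adsIsom g x)) := (continuous_adsIsom g).tendsto x
      rw [hg.self_of_nhds]
      exact h1.congr' (hg.mono fun y hy => hy.symm)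
    filter_upwards [hg, hc.eventually hk] with y h1 h2
    simp only [Function.comp_apply]
    rw [h2, h1]
    simp [adsIsom, mul_assoc]
  id_mem := fun x _ => ⟨1, Eventually.of_forall fun y => by simp [adsIsom]⟩
  locality := by
    intro φ u _ h x hx
    obtain ⟨v, _, hxv, hv⟩ := h x hx
    exact hv x ⟨hx, hxv⟩
  congr := by
    intro φ ψ u hu hψ hφ x hx
    obtain ⟨g, hg⟩ := hφ x hx
    refine ⟨g, ?_⟩
    filter_upwards [hg, hu.mem_nhds hx] with y h1 h2
    rw [hψ y h2, h1]

/-- The structure groupoid of an anti-de Sitter structure: local homeomorphisms of `AdS³` that are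
locally given by elements of `Isom₀(AdS³)`. -/
def adsGroupoid : StructureGroupoid PSL2R := adsPregroupoid.groupoid

/-- An anti-de Sitter structure on `N`, i.e. an `(Isom₀(AdS³), AdS³)`-structure: an atlas of charts
with values in `AdS³` whose transition maps are given by elements of `Isom₀(AdS³)`. -/
structure AdSStructure (N : Type) [TopologicalSpace N] where
  /-- The atlas. -/
  charted : ChartedSpace PSL2R N
  /-- The transition maps. -/
  compatible : HasGroupoid N adsGroupoid

/-- All charts of an anti-de Sitter structure (the maximal atlas). -/
def AdSStructure.charts {N : Type} [TopologicalSpace N] (S : AdSStructure N) :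
    Set (OpenPartialHomeomorph N PSL2R) :=
  letI := S.charted
  adsGroupoid.maximalAtlas N

/-- Let `q : E → N` be a local homeomorphism (such as a covering map). The map `dev : E → AdS³` is
a developing map of the structure `S` of `N`, pulled back to `E`, if it is locally of the form
`φ ∘ q` with a chart `φ` of `N`. -/
def IsDevelopingMap {E N : Type} [TopologicalSpace E] [TopologicalSpace N] (S : AdSStructure N)
    (q : E → N) (dev : E → PSL2R) : Prop :=
  ∀ e : E, ∃ φ ∈ S.charts, q e ∈ φ.source ∧ dev =ᶠ[𝓝 e] φ ∘ q

/-- Let `q : E → N` be the universal covering. The homomorphism `hol` is the holonomy representation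
of the developing map `dev : E → AdS³`: a loop class `c` at the base point `m` acts on `E` by the
deck transformation `τ` that sends the base point `e₀` of `E` to the end point of the lift of `c`
that starts at `e₀`, and `dev ∘ τ = hol(c) ∘ dev`.

The product of `FundamentalGroup N m` is `c * c' = ` (first `c'`, then `c`), so that homomorphisms to
a group for the usual concatenation of loops are homomorphisms to the opposite group here. -/
def IsHolonomy {E N : Type} [TopologicalSpace E] [TopologicalSpace N] {q : E → N}
    (hq : IsCoveringMap q) {m : N} (e₀ : q ⁻¹' {m}) (dev : E → PSL2R)
    (hol : FundamentalGroup N m →* (PSL2R × PSL2R)ᵐᵒᵖ) : Prop :=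
  ∀ c : FundamentalGroup N m, ∃ τ : E ≃ₜ E, q ∘ τ = q ∧
    τ e₀ = hq.monodromy (FundamentalGroup.toPath c) e₀ ∧
    ∀ y : E, dev (τ y) = adsIsom (hol c).unop (dev y)

/-- A subset `s` of an anti-de Sitter manifold is a timelike geodesic: it is the image of a curve,
defined on all of `ℝ`, that is an affinely parametrized timelike geodesic in every chart. -/
def IsTimelikeGeodesicSubset {N : Type} [TopologicalSpace N] (S : AdSStructure N) (s : Set N) :
    Prop :=
  ∃ c : ℝ → N, Continuous c ∧ range c = s ∧
    ∀ φ ∈ S.charts, ∀ t : ℝ, c t ∈ φ.source → IsTimelikeGeodesicAt (φ ∘ c) t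

/-! ## Principal circle bundles, orientable three-manifolds, branched anti-de Sitter manifolds -/

/-- `proj : P → B` is a principal `S¹`-bundle for some continuous action of the circle on `P`: it is
locally isomorphic, equivariantly, to the product `U × S¹`. -/
def IsPrincipalCircleBundle {P B : Type} [TopologicalSpace P] [TopologicalSpace B] (proj : P → B) :
    Prop :=
  ∃ _ : MulAction Circle P, ContinuousSMul Circle P ∧ (∀ (s : Circle) (x : P), proj (s • x) = proj x) ∧
    ∀ b : B, ∃ e : Bundle.Trivialization Circle proj, b ∈ e.baseSet ∧
      ∀ x ∈ e.source, ∀ s : Circle, e (s • x) = ((e x).1, s * (e x).2)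

/-- An orientable three-manifold: a second countable Hausdorff space with an atlas of charts with
values in `ℝ³` whose transition maps are orientation-preserving local diffeomorphisms. -/
def IsOrientableThreeManifold (M : Type) [TopologicalSpace M] : Prop :=
  T2Space M ∧ SecondCountableTopology M ∧
    ∃ cs : ChartedSpace (EuclideanSpace ℝ (Fin 3)) M, ∀ e ∈ cs.atlas, ∀ e' ∈ cs.atlas,
      ContDiffOn ℝ 1 (e.symm ≫ₕ e') (e.symm ≫ₕ e').source ∧
      ∀ x ∈ (e.symm ≫ₕ e').source, 0 < (fderiv ℝ (e.symm ≫ₕ e') x).det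

/-- Let `L` be a subset of `M` and let `S` be an anti-de Sitter structure on `M \ L`. This is the
data of a component `K` of `L`, a tubular neighbourhood `T` of `K` that meets `L` only in `K`, and a
spin-cone singularity of the structure along `K`. -/
structure SpinConeTube {M : Type} [TopologicalSpace M] {L : Set M} (S : AdSStructure ↥Lᶜ) where
  /-- A homeomorphism of the open solid torus `D² × S¹` with the tube `T ⊆ M`. -/
  tube : OpenPartialHomeomorph (ℂ × Circle) M
  tube_source : tube.source = Metric.ball (0 : ℂ) 1 ×ˢ univ
  /-- The circle `K = {0} × S¹` is the part of `L` in the tube. -/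
  core : L ∩ tube.target = tube '' ({0} ×ˢ univ)
  /-- The universal covering of `T \ K` in cylindrical coordinates:
  `(r, x, y) ↦ (r e^{ix}, e^{iy})`. -/
  cover : {u : ℝ × ℝ × ℝ // 0 < u.1 ∧ u.1 < 1} → ↥Lᶜ
  cover_eq : ∀ u, (cover u : M) =
    tube ((u.1.1 : ℂ) * Complex.exp (u.1.2.1 * Complex.I), Circle.exp u.1.2.2)
  /-- The developing map on the universal cover of `T \ K` extends continuously to the universal
  branched cover: it is continuous up to `r = 0`, where it is independent of `x`. -/
  dev : ℝ × ℝ × ℝ → PSL2R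
  dev_developing : IsDevelopingMap S cover (fun u => dev u.1)
  dev_continuous : ContinuousOn dev {u | 0 ≤ u.1 ∧ u.1 < 1}
  dev_core : ∀ x x' y : ℝ, dev (0, x, y) = dev (0, x', y)
  /-- The extension maps the universal cover of `K` onto a complete timelike geodesic `ℓ`. -/
  geodesic : IsCompleteTimelikeGeodesic (range fun y : ℝ => dev (0, 0, y))
  /-- An isometry that sends `ℓ` to `ℓ_{i,i}`; it identifies the universal covers of `AdS³ \ ℓ` and
  of `AdS³ \ ℓ_{i,i}`. -/
  isom : PSL2R × PSL2R
  isom_axis : adsIsom isom '' (range fun y : ℝ => dev (0, 0, y)) = axisGeodesic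
  /-- The lift of the developing map to the universal cover `(0, ∞) × ℝ × ℝ` of `AdS³ \ ℓ`. -/
  lift : ℝ × ℝ × ℝ → ℝ × ℝ × ℝ
  lift_continuous : ContinuousOn lift {u | 0 < u.1 ∧ u.1 < 1}
  lift_pos : ∀ u : ℝ × ℝ × ℝ, 0 < u.1 → u.1 < 1 → 0 < (lift u).1
  lift_eq : ∀ u : ℝ × ℝ × ℝ, 0 < u.1 → u.1 < 1 → adsCover (lift u) = adsIsom isom (dev u)
  /-- The parameters of the lifted holonomy of the meridian. -/
  θ : ℝ
  /-- The parameters of the lifted holonomy of the meridian. -/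
  η : ℝ
  /-- The lifted holonomy of the meridian is the translation by `(0, θ, η)`. -/
  meridian : ∀ r x y : ℝ, 0 < r → r < 1 →
    lift (r, x + 2 * Real.pi, y) = lift (r, x, y) + (0, θ, η)
  /-- The lifted holonomy of the longitude is the translation by `(0, 0, 2π)`. -/
  longitude : ∀ r x y : ℝ, 0 < r → r < 1 →
    lift (r, x, y + 2 * Real.pi) = lift (r, x, y) + (0, 0, 2 * Real.pi)

/-- The anti-de Sitter structure `S` on `M \ L` makes the orientable three-manifold `M` a branched
anti-de Sitter manifold with singular locus `L`: `L` is a closed subset which is a disjoint union of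
embedded circles, indexed by `ι`, with disjoint tubular neighbourhoods, and along each circle the
structure has a spin-cone singularity with parameters in `2πℤ`. -/
def IsBranchedAdS (ι : Type) {M : Type} [TopologicalSpace M] {L : Set M} (S : AdSStructure ↥Lᶜ) :
    Prop :=
  IsOrientableThreeManifold M ∧ IsClosed L ∧
    ∃ t : ι → SpinConeTube S,
      (∀ a b : ι, a ≠ b → Disjoint (t a).tube.target (t b).tube.target) ∧
      (L ⊆ ⋃ a, (t a).tube.target) ∧
      ∀ a : ι, ∃ k l : ℤ, (t a).θ = 2 * Real.pi * k ∧ (t a).η = 2 * Real.pi * l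

/-! ## Equivariant maps and the space `AdS^{f,h}` -/

/-- The hyperbolic surface `Σ = Γ \ ℍ`. -/
abbrev HypSurface (Γ : Subgroup PSL2R) : Type := Quotient (MulAction.orbitRel Γ ℍ)

/-- Representations `j, ρ : Γ → PSL(2, ℝ)` and `C¹` maps `h, f : ℍ → ℍ` that are respectively `j`-
and `ρ`-equivariant. -/
structure EquivariantPair (Γ : Subgroup PSL2R) where
  j : Γ →* PSL2R
  ρ : Γ →* PSL2R
  h : ℍ → ℍ
  f : ℍ → ℍ
  h_c1 : IsC1 h
  f_c1 : IsC1 f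
  h_equiv : ∀ (γ : Γ) (p : ℍ), h (γ • p) = j γ • h p
  f_equiv : ∀ (γ : Γ) (p : ℍ), f (γ • p) = ρ γ • f p

/-! The singular set is invariant. -/

theorem differentiableAt_toPlane_smul (g : PSL2R) (p : ℍ) :
    DifferentiableAt ℝ (toPlane fun z => g • z) (p : ℂ) := by
  induction g using QuotientGroup.induction_on with
  | H g =>
    have h1 := UpperHalfPlane.mdifferentiable_smul
      (g := (Matrix.SpecialLinearGroup.mapGL ℝ g)) (by simp)
    have h2 := UpperHalfPlane.mdifferentiableAt_iff.mp
      ((UpperHalfPlane.mdifferentiable_coe _).comp p (h1 p))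
    exact h2.restrictScalars ℝ

theorem hDeriv_comp {φ ψ : ℍ → ℍ} {p : ℍ} (hφ : DifferentiableAt ℝ (toPlane φ) (ψ p : ℂ))
    (hψ : DifferentiableAt ℝ (toPlane ψ) (p : ℂ)) :
    hDeriv (fun z => φ (ψ z)) p = (hDeriv φ (ψ p)).comp (hDeriv ψ p) := by
  have h1 : toPlane (fun z => φ (ψ z)) = toPlane φ ∘ toPlane ψ := by
    funext z
    simp [toPlane, UpperHalfPlane.ofComplex_apply]
  have h2 : toPlane ψ (p : ℂ) = (ψ p : ℂ) := by simp [toPlane, UpperHalfPlane.ofComplex_apply]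
  unfold hDeriv
  rw [h1, fderiv_comp (p : ℂ) (by rw [h2]; exact hφ) hψ, h2]

theorem hDeriv_smul_injective (g : PSL2R) (p : ℍ) :
    Function.Injective (hDeriv (fun z => g • z) p) := by
  have h1 := hDeriv_comp (φ := fun z => g⁻¹ • z) (ψ := fun z => g • z) (p := p)
    (differentiableAt_toPlane_smul g⁻¹ (g • p)) (differentiableAt_toPlane_smul g p)
  have h2 : hDeriv (fun z : ℍ => g⁻¹ • g • z) p = ContinuousLinearMap.id ℝ ℂ := by
    have h3 : toPlane (fun z : ℍ => g⁻¹ • g • z) =ᶠ[𝓝 (p : ℂ)] id := by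
      filter_upwards [UpperHalfPlane.eventuallyEq_coe_comp_ofComplex p.im_pos] with z hz
      simpa [toPlane] using hz
    unfold hDeriv
    rw [h3.fderiv_eq, fderiv_id]
  rw [h2] at h1
  intro v w hvw
  have := DFunLike.congr_fun h1 v
  have h4 := DFunLike.congr_fun h1 w
  simp only [ContinuousLinearMap.id_apply, ContinuousLinearMap.comp_apply] at this h4
  rw [this, h4, hvw]

namespace EquivariantPair

variable {Γ : Subgroup PSL2R} (D : EquivariantPair Γ)

/-- The singular set `C ⊆ ℍ` of `h`. -/
def C : Set ℍ := singularSet D.h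

/-- `C₀ = C / Γ`. -/
def C₀ : Set (HypSurface Γ) := (fun p : ℍ => (⟦p⟧ : HypSurface Γ)) '' D.C

theorem C_of_smul {γ : Γ} {p : ℍ} (hp : γ • p ∈ D.C) : p ∈ D.C := by
  intro hinj
  apply hp
  have hd : ∀ q : ℍ, DifferentiableAt ℝ (toPlane D.h) (q : ℂ) := fun q =>
    (D.h_c1.differentiableOn one_ne_zero).differentiableAt
      (UpperHalfPlane.isOpen_upperHalfPlaneSet.mem_nhds q.im_pos)
  have h1 := hDeriv_comp (φ := D.h) (ψ := fun z => (γ : PSL2R) • z) (p := p) (hd _)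
    (differentiableAt_toPlane_smul γ p)
  have h2 := hDeriv_comp (φ := fun z => D.j γ • z) (ψ := D.h) (p := p)
    (differentiableAt_toPlane_smul _ _) (hd p)
  have h3 : (fun z => D.h ((γ : PSL2R) • z)) = fun z => D.j γ • D.h z :=
    funext fun z => D.h_equiv γ z
  rw [h3, h2] at h1
  have h5 := hDeriv_comp (φ := fun z => (γ : PSL2R) • z) (ψ := fun z => (γ : PSL2R)⁻¹ • z)
    (p := (γ : PSL2R) • p) (differentiableAt_toPlane_smul _ _) (differentiableAt_toPlane_smul _ _)
  have hs : Function.Surjective (hDeriv (fun z => (γ : PSL2R) • z) p) :=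
    LinearMap.surjective_of_injective
      (f := (hDeriv (fun z => (γ : PSL2R) • z) p).toLinearMap) (hDeriv_smul_injective γ p)
  intro v w hvw
  obtain ⟨v', rfl⟩ := hs v
  obtain ⟨w', rfl⟩ := hs w
  have hv := DFunLike.congr_fun h1 v'
  have hw := DFunLike.congr_fun h1 w'
  simp only [ContinuousLinearMap.comp_apply] at hv hw
  have : v' = w' := hinj (hDeriv_smul_injective (D.j γ) (D.h p) (by
    rw [hv, hw]; exact hvw))
  rw [this]

/-- The space `AdS^{f,h}`: the set of all pairs `(A, p)` with `A ∈ AdS³ = PSL(2, ℝ)`, `p ∈ ℍ` and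
`A (f p) = h p`, with the topology of a subspace of `AdS³ × ℍ`. -/
abbrev AdS : Type := {x : PSL2R × ℍ // x.1 • D.f x.2 = D.h x.2}

/-- The map `I : AdS^{f,h} → AdS³`, `(A, p) ↦ A`. -/
def incl (x : D.AdS) : PSL2R := x.1.1

/-- The map `F : AdS^{f,h} → ℍ`, `(A, p) ↦ p`. -/
def fib (x : D.AdS) : ℍ := x.1.2

/-- The action of `Γ` on `AdS^{f,h}`, which covers the action of the isometries
`(j(γ), ρ(γ))` on `AdS³` and the action of `Γ` on `ℍ`. -/
instance : MulAction Γ D.AdS where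
  smul γ x := ⟨(adsIsom (D.j γ, D.ρ γ) x.1.1, γ • x.1.2), by
    simp only [adsIsom]
    rw [D.f_equiv, D.h_equiv, ← x.2, smul_smul, smul_smul]
    simp⟩
  one_smul x := by
    apply Subtype.ext
    apply Prod.ext
    · change adsIsom (D.j 1, D.ρ 1) x.1.1 = x.1.1
      simp [adsIsom]
    · exact one_smul Γ x.1.2
  mul_smul a b x := by
    apply Subtype.ext
    apply Prod.ext
    · change adsIsom (D.j (a * b), D.ρ (a * b)) x.1.1 =
        adsIsom (D.j a, D.ρ a) (adsIsom (D.j b, D.ρ b) x.1.1)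
      simp [adsIsom, mul_assoc]
    · exact mul_smul a b x.1.2

/-- `L = F⁻¹(C)`. -/
def L : Set D.AdS := D.fib ⁻¹' D.C

/-- `AdS^{f,h}_* = AdS^{f,h} \ L`. -/
abbrev AdSStar : Type := ↥(D.L)ᶜ

/-- The restriction of `I` to `AdS^{f,h}_*`. -/
def inclStar (x : D.AdSStar) : PSL2R := D.incl x.1

/-- The restriction `F : AdS^{f,h}_* → ℍ \ C`. -/
def fibStar (x : D.AdSStar) : ↥(D.C)ᶜ := ⟨D.fib x.1, x.2⟩

/-- The quotient `M^{f,h}` of `AdS^{f,h}` by the action. -/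
abbrev M : Type := Quotient (MulAction.orbitRel Γ D.AdS)

/-- The image `L / Γ` of `L` in `M^{f,h}`. -/
def LQuot : Set D.M := (fun x : D.AdS => (⟦x⟧ : D.M)) '' D.L

/-- `M^{f,h}_*`, the quotient of `AdS^{f,h}_*`, as the complement of `L / Γ` in `M^{f,h}`. -/
abbrev MStar : Type := ↥(D.LQuot)ᶜ

/-- The projection `AdS^{f,h}_* → M^{f,h}_*`. -/
def projStar (x : D.AdSStar) : D.MStar :=
  ⟨⟦x.1⟧, by
    rintro ⟨y, hy, hyx⟩
    obtain ⟨γ, hγ⟩ := MulAction.orbitRel_apply.mp (Quotient.exact hyx)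
    apply x.2
    have : γ • D.fib x.1 ∈ D.C := by
      have h1 : D.fib (γ • x.1) = D.fib y := congrArg D.fib hγ
      have h2 : D.fib y ∈ D.C := hy
      rw [← h1] at h2
      exact h2
    exact D.C_of_smul this⟩

/-- The map `M^{f,h} → Σ` induced by `F`. -/
def base : D.M → HypSurface Γ :=
  Quotient.map D.fib (by
    intro x y hxy
    obtain ⟨γ, hγ⟩ := MulAction.orbitRel_apply.mp hxy
    exact MulAction.orbitRel_apply.mpr ⟨γ, congrArg D.fib hγ⟩)

theorem continuous_base : Continuous D.base := by
  apply Continuous.quotient_map'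
  exact continuous_snd.comp continuous_subtype_val

theorem base_notMem {m : D.M} (hm : m ∉ D.LQuot) : D.base m ∉ D.C₀ := by
  induction m using Quotient.inductionOn with
  | h x =>
    rintro ⟨c, hc, hcx⟩
    apply hm
    obtain ⟨γ, hγ⟩ := MulAction.orbitRel_apply.mp (Quotient.exact hcx)
    refine ⟨x, ?_, rfl⟩
    have : γ • D.fib x ∈ D.C := by
      have h1 : γ • D.fib x = c := hγ
      rw [h1]; exact hc
    exact D.C_of_smul this

/-- The map `F : M^{f,h}_* → Σ \ C₀`. -/
def baseStar : C(D.MStar, ↥(D.C₀)ᶜ) where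
  toFun m := ⟨D.base m.1, D.base_notMem m.2⟩
  continuous_toFun := (D.continuous_base.comp continuous_subtype_val).subtype_mk _

/-- The inclusion `Σ \ C₀ → Σ`. -/
def surfaceIncl : C(↥(D.C₀)ᶜ, HypSurface Γ) where
  toFun := Subtype.val
  continuous_toFun := continuous_subtype_val

end EquivariantPair

/-- The identification of `π₁(Σ)` with the group `Γ` of deck transformations of `ℍ → Σ`, for the
base point `p` of `ℍ`: the class of a loop goes to the `γ` such that the lift of the loop that starts
at `p` ends at `γ • p`. (The opposite group appears because of the order of composition in
`FundamentalGroup`.) -/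
def deckEquiv (Γ : Subgroup PSL2R) [ProperlyDiscontinuousSMul Γ ℍ] [IsCancelSMul Γ ℍ] (p : ℍ) :
    FundamentalGroup (HypSurface Γ) ⟦p⟧ ≃* (Γ)ᵐᵒᵖ :=
  (isQuotientCoveringMap_quotientMk_of_properlyDiscontinuousSMul
    (G := Γ) (E := ℍ)).fundamentalGroupEquiv ⟨p, rfl⟩

/-- The composite `π₁(M^{f,h}_*) → π₁(Σ \ C₀) → π₁(Σ) ≅ Γ → Isom₀(AdS³)`, where the first map is
induced by `F`, the second by the inclusion, and the third is `(j, ρ)`. The base point is the image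
of `x`. -/
def EquivariantPair.factoredHolonomy {Γ : Subgroup PSL2R} [ProperlyDiscontinuousSMul Γ ℍ]
    [IsCancelSMul Γ ℍ] (D : EquivariantPair Γ) (x : D.AdSStar) :
    FundamentalGroup D.MStar (D.projStar x) →* (PSL2R × PSL2R)ᵐᵒᵖ :=
  (MonoidHom.op (D.j.prod D.ρ)).comp
    ((deckEquiv Γ (D.fib x.1)).toMonoidHom.comp
      ((FundamentalGroup.map D.surfaceIncl (D.baseStar (D.projStar x))).comp
        (FundamentalGroup.map D.baseStar (D.projStar x))))

end

/-! Global structure. An element A of PSL(2, ℝ) is determined by its 1-jet at one point w: the image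
A w and the argument `ang A w` of the derivative there (`PSL2R.ext_of_smul_ang`). Both can be
prescribed freely (`isomOf`), so (A, p) ↦ (p, ang A (f p)) identifies AdS^{f,h} with ℍ × S¹. This
gives the solid torus, the circle fibers and the principal bundle. In these coordinates γ acts by γ
on ℍ and by rotations between fibers, so freeness and proper discontinuity are inherited from ℍ.
Over the base the action is holomorphic, whence the quotient is orientable.

Structure off C. There A f(z) = h(z) can be solved for z near p as a function of A. If d is the
denominator of A at f(p), the derivative of the defect in z is d·Dh - d⁻¹·Df; a vector in its kernel
would have equal lengths for f^*σ and h^*σ, against the strict inequality. The implicit function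
theorem (`exists_local_solution`) makes (A, p) ↦ A a local homeomorphism, and by equivariance it
develops a structure on the quotient too. Each fiber is a two-sided translate of the rotation group,
hence a timelike geodesic.

Branch points. Let F and H be f and h near p in disc coordinates centred at f(p) and h(p). The key
estimate is |F| < |H| away from p (`norm_discMap_lt_of_isolated`). It follows from a maximum
principle for the difference of the two hyperbolic distances: where this difference is nonnegative,
moving so that H goes radially inwards shortens the h-distance at full speed and the f-distance at a
strictly smaller one, so the difference grows and cannot be maximal.

In the SU(1,1) model the isometry of angle y that sends F to H has entries α, β, and with a positive
factor s², αβ = s² H (1 - H conj(F) e^{iy}) (1 - (F/H) e^{-iy}), conj(α)β = s² H e^{iy} (1 - conj(H)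
F e^{-iy}) (1 - (F/H) e^{-iy}). The arguments of these products are the cylindrical coordinates θ
and η. Every factor 1 - u has |u| < 1 and so a continuous principal argument; only arg H and y can
have periods. The meridian changes arg H by some 2πk, which translates θ and η equally; the
longitude changes y alone. This is the spin-cone condition (`IsAdaptedDisc.exists_spinConeTube`).

Holonomy. The universal covering of M^{f,h}_* lifts to a map Q into AdS^{f,h}, and A ∘ Q is a
developing map. For a deck transformation τ, both Q ∘ τ and γ·Q lift the same map, where γ is the
deck element of ℍ → Σ given by the projected loop; uniqueness of lifts identifies them, and γ acts
on A through (j(γ), ρ(γ)). -/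

noncomputable section

/-! ## Rotation numbers of Möbius transformations -/

/-- The special linear group covering `PSL(2, ℝ)`. -/
abbrev SL2R : Type := Matrix.SpecialLinearGroup (Fin 2) ℝ

namespace SL2R

/-- The denominator `c w + d` of the Möbius transformation `g` at `w`. -/
def den (g : SL2R) (w : ℂ) : ℂ := (g 1 0 : ℂ) * w + (g 1 1 : ℂ)

/-- The numerator `a w + b` of the Möbius transformation `g` at `w`. -/
def num (g : SL2R) (w : ℂ) : ℂ := (g 0 0 : ℂ) * w + (g 0 1 : ℂ)

theorem det_eq (g : SL2R) : g 0 0 * g 1 1 - g 0 1 * g 1 0 = 1 := by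
  have := g.det_coe
  rwa [Matrix.det_fin_two] at this

theorem coe_smul (g : SL2R) (w : ℍ) : ((g • w : ℍ) : ℂ) = num g w / den g w := by
  rw [UpperHalfPlane.coe_specialLinearGroup_apply]
  rfl

theorem den_ne_zero (g : SL2R) (w : ℍ) : den g w ≠ 0 := by
  intro h
  have h1 : g 1 0 * w.im = 0 := by simpa [den] using congrArg Complex.im h
  have hc : g 1 0 = 0 := (mul_eq_zero.mp h1).resolve_right w.im_pos.ne'
  have h2 : g 1 1 = 0 := by simpa [den, hc] using congrArg Complex.re h
  have := det_eq g
  simp [hc, h2] at this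

theorem den_mul (g k : SL2R) (w : ℍ) :
    den (g * k) w = den g (k • w : ℍ) * den k w := by
  have h := den_ne_zero k w
  rw [coe_smul]
  simp only [den, num] at h ⊢
  rw [Matrix.SpecialLinearGroup.coe_mul, Matrix.mul_apply, Matrix.mul_apply]
  rw [mul_div_assoc', div_add' _ _ _ h, div_mul_cancel₀ _ h]
  push_cast [Fin.sum_univ_two]
  ring

/-- The argument of the derivative of the Möbius transformation `g` at `w`. -/
def ang (g : SL2R) (w : ℍ) : Circle := Circle.ofConjDivSelf (den g w) (den_ne_zero g w)

theorem coe_ang (g : SL2R) (w : ℍ) :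
    (ang g w : ℂ) = (starRingEnd ℂ) (den g w) / den g w := rfl

/-- The chain rule for arguments of derivatives: g'(w) = 1 / (c w + d)², whose argument is that of
conj(c w + d) / (c w + d), and denominators are a multiplicative cocycle. -/
theorem ang_mul (g k : SL2R) (w : ℍ) : ang (g * k) w = ang g (k • w) * ang k w := by
  apply Circle.ext
  rw [Circle.coe_mul, coe_ang, coe_ang, coe_ang, den_mul, map_mul, mul_div_mul_comm]

theorem center_entries {g : SL2R} (hg : g ∈ Subgroup.center SL2R) :
    g 0 1 = 0 ∧ g 1 0 = 0 ∧ g 0 0 = g 1 1 := by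
  obtain ⟨r, hr, hs⟩ := Matrix.SpecialLinearGroup.mem_center_iff.mp hg
  refine ⟨?_, ?_, ?_⟩ <;> simp [← hs, Matrix.scalar_apply]

theorem mem_center_of_entries {g : SL2R} (h01 : g 0 1 = 0) (h10 : g 1 0 = 0)
    (h : g 0 0 = g 1 1) : g ∈ Subgroup.center SL2R := by
  refine Matrix.SpecialLinearGroup.mem_center_iff.mpr ⟨g 0 0, ?_, ?_⟩
  · have := det_eq g
    rw [h01, ← h] at this
    simp only [Fintype.card_fin]
    nlinarith
  · ext i j
    fin_cases i <;> fin_cases j <;> simp [Matrix.scalar_apply, h01, h10, h]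

theorem ang_center {g : SL2R} (hg : g ∈ Subgroup.center SL2R) (w : ℍ) : ang g w = 1 := by
  apply Circle.ext
  have h := den_ne_zero g w
  rw [coe_ang]
  simp only [den, (center_entries hg).2.1] at h ⊢
  simp at h ⊢
  exact h

/-- Trivial angle makes the denominator c w + d real, so c = 0; the fixed point equation a w + b = d
w then gives a = d and b = 0. -/
theorem mem_center_of_fix {g : SL2R} {w : ℍ} (hw : g • w = w) (ha : ang g w = 1) :
    g ∈ Subgroup.center SL2R := by
  have hd := den_ne_zero g w
  have h1 : (starRingEnd ℂ) (den g w) = den g w := by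
    have := congrArg (fun s : Circle => (s : ℂ)) ha
    simpa [coe_ang, div_eq_one_iff_eq hd] using this
  have h2 : g 1 0 = 0 := by
    have := Complex.conj_eq_iff_im.mp h1
    have h3 : g 1 0 * w.im = 0 := by simpa [den] using this
    exact (mul_eq_zero.mp h3).resolve_right w.im_pos.ne'
  have h3 : num g w = den g w * w := by
    have := congrArg (fun z : ℍ => (z : ℂ)) hw
    rw [coe_smul, div_eq_iff hd] at this
    rw [this, mul_comm]
  have h4 : g 0 0 = g 1 1 := by
    have h5 : g 0 0 * w.im = g 1 1 * w.im := by
      simpa [num, den, h2] using congrArg Complex.im h3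
    exact mul_right_cancel₀ w.im_pos.ne' h5
  have h5 : g 0 1 = 0 := by
    have h6 := congrArg Complex.re h3
    simpa [num, den, h2, h4] using h6
  exact mem_center_of_entries h5 h2 h4

theorem continuous_entry (i j : Fin 2) : Continuous fun g : SL2R => g i j :=
  (continuous_id.matrix_elem i j).comp continuous_subtype_val

theorem continuous_den : Continuous fun x : SL2R × ℍ => den x.1 x.2 := by
  unfold den
  have h1 := (continuous_entry 1 0).comp (continuous_fst (X := SL2R) (Y := ℍ))
  have h2 := (continuous_entry 1 1).comp (continuous_fst (X := SL2R) (Y := ℍ))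
  have h3 := UpperHalfPlane.continuous_coe.comp (continuous_snd (X := SL2R) (Y := ℍ))
  exact ((Complex.continuous_ofReal.comp h1).mul h3).add (Complex.continuous_ofReal.comp h2)

theorem continuous_ang : Continuous fun x : SL2R × ℍ => ang x.1 x.2 :=
  Continuous.subtype_mk ((Complex.continuous_conj.comp continuous_den).div continuous_den
    fun x => den_ne_zero x.1 x.2) _

end SL2R

theorem continuous_of_entries {X : Type*} [TopologicalSpace X] {φ : X → SL2R}
    (h : ∀ i j, Continuous fun x => (φ x) i j) : Continuous φ :=
  continuous_induced_rng.mpr (continuous_matrix h)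

namespace PSL2R

open SL2R

/-- The quotient map from `SL(2, ℝ)`. -/
abbrev mk (g : SL2R) : PSL2R := QuotientGroup.mk g

theorem isOpenQuotientMap_mk : IsOpenQuotientMap mk := QuotientGroup.isOpenQuotientMap_mk

theorem continuous_mk : Continuous mk := isOpenQuotientMap_mk.continuous

/-- The argument of the derivative of the Möbius transformation `A` at `w`. -/
def ang (A : PSL2R) (w : ℍ) : Circle :=
  Quotient.liftOn' A (fun g => SL2R.ang g w) (by
    intro g k hgk
    have h1 : g⁻¹ * k ∈ Subgroup.center SL2R := QuotientGroup.leftRel_apply.mp hgk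
    have h2 : k = g * (g⁻¹ * k) := by group
    rw [h2, SL2R.ang_mul, ang_center h1, center_smul_upperHalfPlane _ h1, mul_one])

theorem ang_mk (g : SL2R) (w : ℍ) : ang (mk g) w = SL2R.ang g w := rfl

theorem ang_mul (A B : PSL2R) (w : ℍ) : ang (A * B) w = ang A (B • w) * ang B w := by
  induction A using QuotientGroup.induction_on with
  | H g =>
    induction B using QuotientGroup.induction_on with
    | H k => exact SL2R.ang_mul g k w

theorem ang_one (w : ℍ) : ang 1 w = 1 := SL2R.ang_center (one_mem _) w

theorem ang_inv (A : PSL2R) (w : ℍ) : ang A⁻¹ (A • w) = (ang A w)⁻¹ := by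
  rw [eq_inv_iff_mul_eq_one, ← ang_mul, inv_mul_cancel, ang_one]

theorem eq_one_of_fix {A : PSL2R} {w : ℍ} (hw : A • w = w) (ha : ang A w = 1) : A = 1 := by
  induction A using QuotientGroup.induction_on with
  | H g => exact (QuotientGroup.eq_one_iff g).mpr (mem_center_of_fix hw ha)

/-- An orientation-preserving isometry is determined by its 1-jet at a point. This is the test by
which all later identities in PSL(2, ℝ) involving rotations are proved. -/
theorem ext_of_smul_ang {A B : PSL2R} {w : ℍ} (hw : A • w = B • w) (ha : ang A w = ang B w) :
    A = B := by
  have h1 : B⁻¹ * A = 1 := by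
    apply eq_one_of_fix (w := w)
    · rw [mul_smul, hw, inv_smul_smul]
    · rw [ang_mul, hw, ang_inv, ha, inv_mul_cancel]
  exact (inv_mul_eq_one.mp h1).symm

theorem continuous_ang : Continuous fun x : PSL2R × ℍ => ang x.1 x.2 :=
  ((isOpenQuotientMap_mk.prodMap (IsOpenQuotientMap.id (X := ℍ))).continuous_comp_iff).mp
    SL2R.continuous_ang

end PSL2R

/-! ## Sections and rotations -/

/-- The upper triangular matrix that sends `i` to `w`. -/
def secSL (w : ℍ) : SL2R :=
  ⟨!![√w.im, w.re / √w.im; 0, 1 / √w.im], by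
    have : √w.im ≠ 0 := (Real.sqrt_pos.mpr w.im_pos).ne'
    rw [Matrix.det_fin_two_of]
    field_simp
    simp⟩

/-- The upper triangular element of `PSL(2, ℝ)` that sends `i` to `w`. -/
def sec (w : ℍ) : PSL2R := PSL2R.mk (secSL w)

theorem sec_smul_I (w : ℍ) : sec w • UpperHalfPlane.I = w := by
  apply UpperHalfPlane.ext
  change ((secSL w • UpperHalfPlane.I : ℍ) : ℂ) = w
  have h1 : √w.im ≠ 0 := (Real.sqrt_pos.mpr w.im_pos).ne'
  have h2 : ((√w.im : ℝ) : ℂ) ≠ 0 := by exact_mod_cast h1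
  have h3 : ((√w.im : ℝ) : ℂ) * (√w.im : ℝ) = (w.im : ℝ) := by
    rw [← Complex.ofReal_mul, Real.mul_self_sqrt w.im_pos.le]
  rw [SL2R.coe_smul]
  simp only [SL2R.num, SL2R.den, secSL]
  simp
  field_simp
  rw [sq, h3]
  apply Complex.ext <;> simp

/-- The denominators of an upper triangular matrix are real, so the section `sec` contributes no
rotation. -/
theorem ang_sec (w z : ℍ) : PSL2R.ang (sec w) z = 1 := by
  have h1 : ((√w.im : ℝ) : ℂ) ≠ 0 := by exact_mod_cast (Real.sqrt_pos.mpr w.im_pos).ne'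
  apply Circle.ext
  rw [sec, PSL2R.ang_mk, SL2R.coe_ang]
  simp [SL2R.den, secSL, h1]

theorem continuous_sec : Continuous sec := by
  refine PSL2R.continuous_mk.comp (continuous_of_entries ?_)
  have h1 : Continuous fun w : ℍ => √w.im := UpperHalfPlane.continuous_im.sqrt
  have h2 : ∀ w : ℍ, √w.im ≠ 0 := fun w => (Real.sqrt_pos.mpr w.im_pos).ne'
  intro i j
  fin_cases i <;> fin_cases j <;> simp [secSL]
  · exact h1
  · exact UpperHalfPlane.continuous_re.div h1 h2
  · exact continuous_const
  · exact h1.inv₀ h2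

/-- A matrix representing the rotation `R^θ`. -/
def rotSL (θ : ℝ) : SL2R :=
  ⟨!![Real.cos (θ / 2), Real.sin (θ / 2); -Real.sin (θ / 2), Real.cos (θ / 2)], by
      rw [Matrix.det_fin_two_of]
      nlinarith [Real.sin_sq_add_cos_sq (θ / 2)]⟩

theorem rot_eq_mk (θ : ℝ) : rot θ = PSL2R.mk (rotSL θ) := rfl

theorem continuous_rot : Continuous rot := by
  refine PSL2R.continuous_mk.comp (continuous_of_entries (φ := rotSL) ?_)
  intro i j
  fin_cases i <;> fin_cases j <;> simp [rotSL] <;> fun_prop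

theorem den_rotSL (θ : ℝ) : SL2R.den (rotSL θ) Complex.I = Complex.exp (-(θ / 2) * Complex.I) := by
  rw [Complex.exp_mul_I]
  simp [SL2R.den, rotSL]
  ring

theorem rot_smul_I (θ : ℝ) : rot θ • UpperHalfPlane.I = UpperHalfPlane.I := by
  apply UpperHalfPlane.ext
  change ((rotSL θ • UpperHalfPlane.I : ℍ) : ℂ) = _
  rw [SL2R.coe_smul, div_eq_iff (SL2R.den_ne_zero _ _)]
  simp [SL2R.num, SL2R.den, rotSL]
  ring_nf
  simp

theorem ang_rot (θ : ℝ) : PSL2R.ang (rot θ) UpperHalfPlane.I = Circle.exp θ := by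
  apply Circle.ext
  rw [rot_eq_mk, PSL2R.ang_mk, SL2R.coe_ang, Circle.coe_exp]
  simp only [UpperHalfPlane.coe_I]
  rw [den_rotSL, ← Complex.exp_conj, ← Complex.exp_sub]
  congr 1
  simp only [map_mul, map_neg, map_div₀, Complex.conj_ofReal, Complex.conj_I, Complex.conj_ofNat]
  ring

/-- The matrices have period 4π in θ, but in PSL(2, ℝ) the sign disappears and the period is 2π; the
rotation therefore factors through the circle. -/
theorem rot_eq_of_exp_eq {θ θ' : ℝ} (h : Circle.exp θ = Circle.exp θ') : rot θ = rot θ' :=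
  PSL2R.ext_of_smul_ang (w := UpperHalfPlane.I) (by rw [rot_smul_I, rot_smul_I])
    (by rw [ang_rot, ang_rot, h])

theorem circle_isQuotientMap_exp : IsQuotientMap Circle.exp :=
  Circle.isCoveringMap_exp.isLocalHomeomorph.isOpenMap.isQuotientMap Circle.exp.continuous
    fun s => ⟨Complex.arg s, Circle.exp_arg s⟩

/-- The rotation around `i` as a function on the circle. -/
def rotC (s : Circle) : PSL2R := rot (Complex.arg s)

theorem rotC_exp (θ : ℝ) : rotC (Circle.exp θ) = rot θ :=
  rot_eq_of_exp_eq (Circle.exp_arg _)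

theorem continuous_rotC : Continuous rotC := by
  rw [circle_isQuotientMap_exp.continuous_iff]
  exact continuous_rot.congr fun θ => (rotC_exp θ).symm

theorem rotC_smul_I (s : Circle) : rotC s • UpperHalfPlane.I = UpperHalfPlane.I := rot_smul_I _

theorem ang_rotC (s : Circle) : PSL2R.ang (rotC s) UpperHalfPlane.I = s := by
  rw [rotC, ang_rot, Circle.exp_arg]

/-- The isometry of `ℍ` that sends `w` to `z` with rotation number `s`. -/
def isomOf (w z : ℍ) (s : Circle) : PSL2R := sec z * rotC s * (sec w)⁻¹

theorem isomOf_smul (w z : ℍ) (s : Circle) : isomOf w z s • w = z := by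
  nth_rw 2 [← sec_smul_I w]
  rw [isomOf, mul_smul, inv_smul_smul, mul_smul, rotC_smul_I, sec_smul_I]

theorem ang_isomOf (w z : ℍ) (s : Circle) : PSL2R.ang (isomOf w z s) w = s := by
  have h1 : (sec w)⁻¹ • w = UpperHalfPlane.I := by
    rw [inv_smul_eq_iff, sec_smul_I]
  have h2 : PSL2R.ang (sec w)⁻¹ w = 1 := by
    have := PSL2R.ang_inv (sec w) UpperHalfPlane.I
    rwa [sec_smul_I, ang_sec, inv_one] at this
  rw [isomOf, PSL2R.ang_mul, h1, h2, PSL2R.ang_mul, rotC_smul_I, ang_sec, ang_rotC]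
  simp

theorem eq_isomOf {A : PSL2R} {w z : ℍ} {s : Circle} (h1 : A • w = z)
    (h2 : PSL2R.ang A w = s) : A = isomOf w z s :=
  PSL2R.ext_of_smul_ang (w := w) (by rw [h1, isomOf_smul]) (by rw [h2, ang_isomOf])

theorem Continuous.isomOf {X : Type*} [TopologicalSpace X] {w z : X → ℍ} {s : X → Circle}
    (hw : Continuous w) (hz : Continuous z) (hs : Continuous s) :
    Continuous fun x => isomOf (w x) (z x) (s x) :=
  ((continuous_sec.comp hz).mul (continuous_rotC.comp hs)).mul (continuous_sec.comp hw).inv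

attribute [irreducible] isomOf

/-! ## The global structure of `AdS^{f,h}` -/

theorem IsC1.continuousOn {φ : ℍ → ℍ} (hφ : IsC1 φ) : ContinuousOn (toPlane φ) {z : ℂ | 0 < z.im} :=
  ContDiffOn.continuousOn hφ

theorem toPlane_coe (φ : ℍ → ℍ) (p : ℍ) : toPlane φ p = φ p := by
  simp [toPlane, UpperHalfPlane.ofComplex_apply]

theorem IsC1.continuous {φ : ℍ → ℍ} (hφ : IsC1 φ) : Continuous φ := by
  rw [UpperHalfPlane.isEmbedding_coe.continuous_iff]
  have h1 : Continuous fun p : ℍ => toPlane φ p :=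
    hφ.continuousOn.comp_continuous UpperHalfPlane.continuous_coe fun p => p.im_pos
  exact h1.congr fun p => toPlane_coe φ p

theorem IsC1.contDiffAt {φ : ℍ → ℍ} (hφ : IsC1 φ) (p : ℍ) : ContDiffAt ℝ 1 (toPlane φ) p :=
  ContDiffOn.contDiffAt hφ (UpperHalfPlane.isOpen_upperHalfPlaneSet.mem_nhds p.im_pos)

/-- The homeomorphism of the upper half-plane with the plane, `z ↦ (Re z, log (Im z))`. -/
def upperHalfPlaneHomeoComplex : ℍ ≃ₜ ℂ where
  toFun z := ⟨z.re, Real.log z.im⟩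
  invFun w := ⟨⟨w.re, Real.exp w.im⟩, Real.exp_pos _⟩
  left_inv z := by
    apply UpperHalfPlane.ext
    apply Complex.ext
    · simp
    · exact Real.exp_log z.im_pos
  right_inv w := by
    apply Complex.ext
    · rfl
    · exact Real.log_exp _
  continuous_toFun := by
    have h1 : Continuous fun z : ℍ => Real.log z.im :=
      UpperHalfPlane.continuous_im.log fun z => z.im_pos.ne'
    exact Complex.equivRealProdCLM.symm.continuous.comp
      (UpperHalfPlane.continuous_re.prodMk h1)
  continuous_invFun := by
    rw [UpperHalfPlane.isEmbedding_coe.continuous_iff]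
    exact Complex.equivRealProdCLM.symm.continuous.comp
      (Complex.continuous_re.prodMk (Real.continuous_exp.comp Complex.continuous_im))

instance PSL2R.isIsometricSMul : IsIsometricSMul PSL2R ℍ where
  isometry_smul A := by
    induction A using QuotientGroup.induction_on with
    | H g => exact isometry_smul ℍ g

namespace EquivariantPair

variable {Γ : Subgroup PSL2R} (D : EquivariantPair Γ)

theorem continuous_incl : Continuous D.incl := continuous_fst.comp continuous_subtype_val

theorem continuous_fib : Continuous D.fib := continuous_snd.comp continuous_subtype_val

theorem incl_smul_f (x : D.AdS) : D.incl x • D.f (D.fib x) = D.h (D.fib x) := x.2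

theorem incl_smul (γ : Γ) (x : D.AdS) :
    D.incl (γ • x) = adsIsom (D.j γ, D.ρ γ) (D.incl x) := rfl

theorem fib_smul (γ : Γ) (x : D.AdS) : D.fib (γ • x) = γ • D.fib x := rfl

theorem ext_incl_fib {x y : D.AdS} (h1 : D.incl x = D.incl y) (h2 : D.fib x = D.fib y) : x = y :=
  Subtype.ext (Prod.ext h1 h2)

/-- The point of `AdS^{f,h}` over `p` with rotation number `s`. -/
def ofAng (u : ℍ × Circle) : D.AdS :=
  ⟨(isomOf (D.f u.1) (D.h u.1) u.2, u.1), isomOf_smul (D.f u.1) (D.h u.1) u.2⟩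

theorem incl_ofAng (u : ℍ × Circle) : D.incl (D.ofAng u) = isomOf (D.f u.1) (D.h u.1) u.2 := rfl

theorem fib_ofAng (u : ℍ × Circle) : D.fib (D.ofAng u) = u.1 := rfl

theorem continuous_ofAng : Continuous D.ofAng := by
  have h1 := D.f_c1.continuous.comp (continuous_fst (X := ℍ) (Y := Circle))
  have h2 := D.h_c1.continuous.comp (continuous_fst (X := ℍ) (Y := Circle))
  have h3 : Continuous fun u : ℍ × Circle => isomOf (D.f u.1) (D.h u.1) u.2 :=
    h1.isomOf h2 continuous_snd
  exact Continuous.subtype_mk (h3.prodMk continuous_fst) _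

/-- The rotation number of a point of `AdS^{f,h}`. -/
def rotNum (x : D.AdS) : Circle := PSL2R.ang (D.incl x) (D.f (D.fib x))

theorem continuous_rotNum : Continuous D.rotNum :=
  PSL2R.continuous_ang.comp
    (D.continuous_incl.prodMk (D.f_c1.continuous.comp D.continuous_fib))

theorem ofAng_rotNum (x : D.AdS) : D.ofAng (D.fib x, D.rotNum x) = x :=
  D.ext_incl_fib (eq_isomOf (D.incl_smul_f x) rfl).symm rfl

theorem rotNum_ofAng (u : ℍ × Circle) : D.rotNum (D.ofAng u) = u.2 := by
  rw [rotNum, incl_ofAng, fib_ofAng, ang_isomOf]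

/-- The global trivialization of the circle fibration, by the rotation number. -/
def homeo : D.AdS ≃ₜ ℍ × Circle where
  toFun x := (D.fib x, D.rotNum x)
  invFun := D.ofAng
  left_inv := D.ofAng_rotNum
  right_inv u := Prod.ext (D.fib_ofAng u) (D.rotNum_ofAng u)
  continuous_toFun := D.continuous_fib.prodMk D.continuous_rotNum
  continuous_invFun := D.continuous_ofAng

/-- The cocycle rule shows that γ multiplies the rotation number by a factor that depends only on
the base point. -/
theorem rotNum_smul (γ : Γ) (x : D.AdS) : D.rotNum (γ • x) =
    PSL2R.ang (D.j γ) (D.h (D.fib x)) * (PSL2R.ang (D.ρ γ) (D.f (D.fib x)))⁻¹ * D.rotNum x := by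
  rw [rotNum, rotNum, incl_smul, fib_smul, D.f_equiv, adsIsom, PSL2R.ang_mul,
    PSL2R.ang_mul, PSL2R.ang_inv, inv_smul_smul, incl_smul_f, mul_right_comm]

instance : T2Space D.AdS := D.homeo.symm.t2Space

instance : SecondCountableTopology D.AdS := D.homeo.secondCountableTopology

instance : LocallyCompactSpace D.AdS := D.homeo.isClosedEmbedding.locallyCompactSpace

instance : ContinuousConstSMul Γ D.AdS where
  continuous_const_smul γ := by
    refine Continuous.subtype_mk (Continuous.prodMk ?_ ?_) _
    · exact (continuous_adsIsom _).comp D.continuous_incl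
    · exact (continuous_const_smul γ).comp D.continuous_fib

instance [IsCancelSMul Γ ℍ] : IsCancelSMul Γ D.AdS where
  right_cancel' a b x h := IsCancelSMul.right_cancel a b (D.fib x) (congrArg D.fib h)

/-- If γ moves a compact set so that it meets another one, the same holds for their compact
projections to ℍ. -/
instance [ProperlyDiscontinuousSMul Γ ℍ] : ProperlyDiscontinuousSMul Γ D.AdS where
  finite_disjoint_inter_image {K K'} hK hK' := by
    refine (ProperlyDiscontinuousSMul.finite_disjoint_inter_image (Γ := Γ)
      (hK.image D.continuous_fib) (hK'.image D.continuous_fib)).subset ?_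
    rintro γ ⟨_, ⟨x, hx, rfl⟩, hx'⟩
    exact ⟨_, ⟨_, ⟨x, hx, rfl⟩, rfl⟩, ⟨_, hx', rfl⟩⟩

theorem solidTorus : Nonempty (D.AdS ≃ₜ (Metric.ball (0 : ℂ) 1) × Circle) :=
  ⟨D.homeo.trans ((upperHalfPlaneHomeoComplex.trans Homeomorph.unitBall).prodCongr
    (Homeomorph.refl Circle))⟩

theorem fiber_homeo_circle (p : ℍ) : Nonempty (↥(D.fib ⁻¹' {p}) ≃ₜ Circle) :=
  ⟨{ toFun := fun x => D.rotNum x.1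
     invFun := fun s => ⟨D.ofAng (p, s), D.fib_ofAng (p, s)⟩
     left_inv := by
       rintro ⟨x, hx⟩
       apply Subtype.ext
       have hx : D.fib x = p := hx
       subst hx
       exact D.ofAng_rotNum x
     right_inv := fun s => D.rotNum_ofAng (p, s)
     continuous_toFun := D.continuous_rotNum.comp continuous_subtype_val
     continuous_invFun := Continuous.subtype_mk
       (D.continuous_ofAng.comp (continuous_const.prodMk continuous_id)) _ }⟩

/-- The global trivialization of the circle bundle `AdS^{f,h}_* → ℍ \ C`. -/
def starHomeo : D.AdSStar ≃ₜ ↥(D.C)ᶜ × Circle where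
  toFun x := (D.fibStar x, D.rotNum x.1)
  invFun u := ⟨D.ofAng (u.1, u.2), u.1.2⟩
  left_inv x := Subtype.ext (D.ofAng_rotNum x.1)
  right_inv u := Prod.ext rfl (D.rotNum_ofAng (u.1.1, u.2))
  continuous_toFun := (Continuous.subtype_mk
    (D.continuous_fib.comp continuous_subtype_val) _).prodMk
    (D.continuous_rotNum.comp continuous_subtype_val)
  continuous_invFun := Continuous.subtype_mk (D.continuous_ofAng.comp
    ((continuous_subtype_val.comp continuous_fst).prodMk continuous_snd)) _

end EquivariantPair

theorem isPrincipalCircleBundle_of_homeomorph {P B : Type} [TopologicalSpace P]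
    [TopologicalSpace B] {proj : P → B} (e : P ≃ₜ B × Circle) (he : ∀ x, (e x).1 = proj x) :
    IsPrincipalCircleBundle proj := by
  let act : MulAction Circle P :=
    { smul := fun s x => e.symm ((e x).1, s * (e x).2)
      one_smul := fun x => by
        change e.symm ((e x).1, 1 * (e x).2) = x
        simp
      mul_smul := fun s t x => by
        change e.symm ((e x).1, s * t * (e x).2) =
          e.symm ((e (e.symm ((e x).1, t * (e x).2))).1,
            s * (e (e.symm ((e x).1, t * (e x).2))).2)
        simp [mul_assoc] }
  have hs : ∀ (s : Circle) (x : P), e (s • x) = ((e x).1, s * (e x).2) := fun s x =>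
    e.apply_symm_apply _
  refine ⟨act, ⟨?_⟩, fun s x => ?_, fun b => ?_⟩
  · have h2 := e.continuous.comp (continuous_snd (X := Circle) (Y := P))
    exact e.symm.continuous.comp ((continuous_fst.comp h2).prodMk
      (continuous_fst.mul (continuous_snd.comp h2)))
  · rw [← he, ← he, hs]
  · have hp : Continuous proj := (continuous_fst.comp e.continuous).congr he
    exact ⟨{ toOpenPartialHomeomorph := e.toOpenPartialHomeomorph
             baseSet := univ
             open_baseSet := isOpen_univ
             source_eq := by simp
             target_eq := by simp
             proj_toFun := fun p _ => he p }, mem_univ b, fun x _ s => hs s x⟩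

/-! ## Anti-de Sitter structures given by local homeomorphisms -/

theorem hasDerivAt_mul_mul_entry {M : ℝ → Matrix (Fin 2) (Fin 2) ℝ} {M' : Matrix (Fin 2) (Fin 2) ℝ}
    {t : ℝ} (G K : Matrix (Fin 2) (Fin 2) ℝ)
    (h : ∀ a b, HasDerivAt (fun s => M s a b) (M' a b) t) (a b : Fin 2) :
    HasDerivAt (fun s => (G * M s * K) a b) ((G * M' * K) a b) t := by
  simp only [Matrix.mul_apply]
  exact HasDerivAt.fun_sum fun j _ =>
    (HasDerivAt.fun_sum fun i _ => (h i j).const_mul (G a i)).mul_const (K j b)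

theorem IsTimelikeGeodesicAt.congr {c c' : ℝ → PSL2R} {t₀ : ℝ} (h : IsTimelikeGeodesicAt c t₀)
    (hc : c' =ᶠ[𝓝 t₀] c) : IsTimelikeGeodesicAt c' t₀ := by
  obtain ⟨A, V, k, hA⟩ := h
  refine ⟨A, V, k, ?_⟩
  filter_upwards [hA, hc] with t h1 h2
  exact ⟨h2.trans h1.1, h1.2⟩

/-- An isometry lifts to the linear map X ↦ G X K⁻¹ of matrices. It preserves the determinant and
keeps the acceleration the same multiple of the position. -/
theorem IsTimelikeGeodesicAt.adsIsom {c : ℝ → PSL2R} {t₀ : ℝ} (h : IsTimelikeGeodesicAt c t₀)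
    (g : PSL2R × PSL2R) : IsTimelikeGeodesicAt (fun t => adsIsom g (c t)) t₀ := by
  obtain ⟨A, V, k, hA⟩ := h
  obtain ⟨g₁, g₂⟩ := g
  induction g₁ using QuotientGroup.induction_on with
  | H G =>
  induction g₂ using QuotientGroup.induction_on with
  | H K =>
  refine ⟨fun t => G * A t * K⁻¹, fun t => G.1 * V t * (K⁻¹).1, k, ?_⟩
  filter_upwards [hA] with t ⟨h1, h2, h3, h4⟩
  refine ⟨?_, ?_, ?_, ?_⟩
  · rw [h1]
    rfl
  · exact hasDerivAt_mul_mul_entry G.1 (K⁻¹).1 h2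
  · have := hasDerivAt_mul_mul_entry (M' := k t • (A t).1) G.1 (K⁻¹).1 h3
    intro a b
    have h5 := this a b
    rw [Matrix.mul_smul, Matrix.smul_mul] at h5
    exact h5
  · rw [Matrix.det_mul, Matrix.det_mul, G.2, (K⁻¹).2]
    simpa using h4

/-- The entries are ± cos(t/2) and ± sin(t/2), whence acceleration -1/4 times the position; the
velocity has determinant 1/4. -/
theorem isTimelikeGeodesicAt_rot (t₀ : ℝ) : IsTimelikeGeodesicAt rot t₀ := by
  refine ⟨rotSL, fun t => !![-Real.sin (t / 2) / 2, Real.cos (t / 2) / 2;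
    -Real.cos (t / 2) / 2, -Real.sin (t / 2) / 2], fun _ => -1 / 4, Eventually.of_forall fun t => ?_⟩
  have h0 : HasDerivAt (fun s : ℝ => s / 2) (1 / 2) t := (hasDerivAt_id t).div_const 2
  have hs : HasDerivAt (fun s : ℝ => Real.sin (s / 2)) (Real.cos (t / 2) * (1 / 2)) t := h0.sin
  have hc : HasDerivAt (fun s : ℝ => Real.cos (s / 2)) (-Real.sin (t / 2) * (1 / 2)) t := h0.cos
  refine ⟨rfl, ?_, ?_, ?_⟩
  · intro a b
    fin_cases a <;> fin_cases b
    · exact hc.congr_deriv (by simp; ring)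
    · exact hs.congr_deriv (by simp; ring)
    · exact hs.neg.congr_deriv (by simp; ring)
    · exact hc.congr_deriv (by simp; ring)
  · intro a b
    fin_cases a <;> fin_cases b
    · exact (hs.neg.div_const 2).congr_deriv (by simp [rotSL]; ring)
    · exact (hc.div_const 2).congr_deriv (by simp [rotSL]; ring)
    · exact (hc.neg.div_const 2).congr_deriv (by simp [rotSL]; ring)
    · exact (hs.neg.div_const 2).congr_deriv (by simp [rotSL]; ring)
  · rw [Matrix.det_fin_two_of]
    nlinarith [Real.sin_sq_add_cos_sq (t / 2)]

section Structures

variable {E N : Type} [TopologicalSpace E] [TopologicalSpace N]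

/-- Two charts differ locally by one isometry, so any chart, and not only the one supplied by the
definition, agrees with the developing map up to an isometry. A geodesic thus has to be checked only
through the developing map. -/
theorem IsDevelopingMap.chart_eq {S : AdSStructure N} {q : E → N} {dev : E → PSL2R}
    (h : IsDevelopingMap S q dev) {φ : OpenPartialHomeomorph N PSL2R} (hφ : φ ∈ S.charts) {x : E}
    (hq : ContinuousAt q x) (hx : q x ∈ φ.source) :
    ∃ g : PSL2R × PSL2R, ∀ᶠ y in 𝓝 x, φ (q y) = adsIsom g (dev y) := by
  obtain ⟨ψ, hψ, hxψ, hdev⟩ := h x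
  let := S.charted
  have := S.compatible
  have h1 : ψ.symm ≫ₕ φ ∈ adsGroupoid := StructureGroupoid.compatible_of_mem_maximalAtlas hψ hφ
  have h2 : ψ (q x) ∈ (ψ.symm ≫ₕ φ).source := by
    simp [hxψ, hx]
  obtain ⟨g, hg⟩ := (mem_groupoid_of_pregroupoid.mp h1).1 (ψ (q x)) h2
  refine ⟨g, ?_⟩
  have h3 : Tendsto (ψ ∘ q) (𝓝 x) (𝓝 (ψ (q x))) :=
    ((ψ.continuousAt hxψ).comp (f := q) hq)
  filter_upwards [h3.eventually hg, hdev, hq.eventually (ψ.open_source.mem_nhds hxψ)] with y h4 h5 h6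
  simp only [Function.comp_apply, OpenPartialHomeomorph.coe_trans] at h4
  rw [ψ.left_inv h6] at h4
  rw [h4, h5]
  rfl

theorem IsDevelopingMap.comp {S : AdSStructure N} {q : E → N} {dev : E → PSL2R}
    (h : IsDevelopingMap S q dev) {X : Type} [TopologicalSpace X] {c : X → E} (hc : Continuous c) :
    IsDevelopingMap S (q ∘ c) (dev ∘ c) := by
  intro x
  obtain ⟨φ, hφ, h1, h2⟩ := h (c x)
  exact ⟨φ, hφ, h1, (hc.tendsto x).eventually h2⟩

theorem IsDevelopingMap.isTimelikeGeodesicSubset {S : AdSStructure N} {dev : N → PSL2R}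
    (h : IsDevelopingMap S id dev) {c : ℝ → N} (hc : Continuous c)
    (hg : ∀ t, IsTimelikeGeodesicAt (dev ∘ c) t) : IsTimelikeGeodesicSubset S (range c) := by
  refine ⟨c, hc, rfl, fun φ hφ t ht => ?_⟩
  obtain ⟨g, hg'⟩ := h.chart_eq hφ (x := c t) continuousAt_id ht
  exact ((hg t).adsIsom g).congr ((hc.tendsto t).eventually hg')

/-- The data that make a quotient of a space with a local homeomorphism to `AdS³` an anti-de Sitter
manifold: locally defined deck transformations act by isometries. -/
structure IsAdSUniformization (q : E → N) (dev : E → PSL2R) : Prop where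
  isLocalHomeomorph_proj : IsLocalHomeomorph q
  surjective : Function.Surjective q
  isLocalHomeomorph_dev : IsLocalHomeomorph dev
  deck : ∀ x y : E, q x = q y → ∃ (g : PSL2R × PSL2R) (τ : E → E), ContinuousAt τ x ∧ τ x = y ∧
    (∀ᶠ z in 𝓝 x, q (τ z) = q z) ∧ ∀ᶠ z in 𝓝 x, dev (τ z) = adsIsom g (dev z)

namespace IsAdSUniformization

variable {q : E → N} {dev : E → PSL2R} (U : IsAdSUniformization q dev)

/-- The chart of the quotient near the image of `x`. -/
def chart (x : E) : OpenPartialHomeomorph N PSL2R :=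
  (U.isLocalHomeomorph_proj.localInverseAt x) ≫ₕ (U.isLocalHomeomorph_dev.localInverseAt x).symm

theorem chart_apply (x : E) (n : N) :
    U.chart x n = dev (U.isLocalHomeomorph_proj.localInverseAt x n) := by
  simp [chart]

theorem mem_chart_source (x : E) : q x ∈ (U.chart x).source := by
  simp [chart]

theorem chart_eventuallyEq (x : E) : dev =ᶠ[𝓝 x] U.chart x ∘ q := by
  have h1 := U.isLocalHomeomorph_proj.self_mem_localInverseAt_target (x := x)
  filter_upwards [(U.isLocalHomeomorph_proj.localInverseAt x).open_target.mem_nhds h1] with y hy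
  rw [Function.comp_apply, chart_apply]
  have := (U.isLocalHomeomorph_proj.localInverseAt x).right_inv hy
  rw [IsLocalHomeomorph.localInverseAt_symm] at this
  rw [this]

/-- A transition map passes from one local sheet of `q` to another over the same points. The local
deck transformation provided by `deck` is this change of sheet, and the developing map turns it into
an isometry. -/
theorem property_chart (x x' : E) :
    adsPregroupoid.property ((U.chart x).symm ≫ₕ U.chart x')
      ((U.chart x).symm ≫ₕ U.chart x').source := by
  intro a ha
  rw [OpenPartialHomeomorph.trans_source] at ha
  set i := U.isLocalHomeomorph_proj.localInverseAt x with hi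
  set i' := U.isLocalHomeomorph_proj.localInverseAt x' with hi'
  have hat : a ∈ (U.chart x).target := ha.1
  have hn' : (U.chart x).symm a ∈ (U.chart x').source := ha.2
  have hn : (U.chart x).symm a ∈ (U.chart x).source := (U.chart x).map_target hat
  have hns : (U.chart x).symm a ∈ i.source := by
    rw [chart, OpenPartialHomeomorph.trans_source] at hn
    exact hn.1
  have hns' : (U.chart x).symm a ∈ i'.source := by
    rw [chart, OpenPartialHomeomorph.trans_source] at hn'
    exact hn'.1
  obtain ⟨g, τ, hτ, hτe, hτq, hτd⟩ := U.deck (i ((U.chart x).symm a)) (i' ((U.chart x).symm a))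
    (by rw [hi, hi', U.isLocalHomeomorph_proj.apply_localInverseAt_of_mem hns,
      U.isLocalHomeomorph_proj.apply_localInverseAt_of_mem hns'])
  refine ⟨g, ?_⟩
  have t1 : Tendsto (U.chart x).symm (𝓝 a) (𝓝 ((U.chart x).symm a)) :=
    (U.chart x).symm.continuousAt hat
  have t2 : Tendsto (fun b => i ((U.chart x).symm b)) (𝓝 a) (𝓝 (i ((U.chart x).symm a))) :=
    (i.continuousAt hns).tendsto.comp t1
  have t3 : Tendsto (fun b => τ (i ((U.chart x).symm b))) (𝓝 a)
      (𝓝 (i' ((U.chart x).symm a))) := by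
    rw [← hτe]
    exact hτ.tendsto.comp t2
  filter_upwards [t2.eventually hτq, t2.eventually hτd,
    t3.eventually (i'.open_target.mem_nhds (i'.map_source hns')),
    t1.eventually (i.open_source.mem_nhds hns), t1.eventually (i'.open_source.mem_nhds hns'),
    (U.chart x).open_target.mem_nhds hat] with b h1 h2 h3 h4 h5 h6
  -- Both points lie in the second sheet and have the same image, and `q` is injective on a sheet.
  have h7 : τ (i ((U.chart x).symm b)) = i' ((U.chart x).symm b) := by
    apply U.isLocalHomeomorph_proj.injOn_localInverseAt_target h3 (i'.map_source h5)
    rw [h1, hi, hi', U.isLocalHomeomorph_proj.apply_localInverseAt_of_mem h4,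
      U.isLocalHomeomorph_proj.apply_localInverseAt_of_mem h5]
  rw [OpenPartialHomeomorph.coe_trans, Function.comp_apply, chart_apply, ← hi', ← h7, h2]
  congr 1
  have h8 := (U.chart x).right_inv h6
  rwa [chart_apply] at h8

/-- The anti-de Sitter structure on the quotient. -/
def adsStructure : AdSStructure N where
  charted :=
    { atlas := range U.chart
      chartAt := fun n => U.chart (Function.surjInv U.surjective n)
      mem_chart_source := fun n => by
        have := U.mem_chart_source (Function.surjInv U.surjective n)
        rwa [Function.surjInv_eq U.surjective n] at this
      chart_mem_atlas := fun n => mem_range_self _ }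
  compatible := by
    let : ChartedSpace PSL2R N :=
      { atlas := range U.chart
        chartAt := fun n => U.chart (Function.surjInv U.surjective n)
        mem_chart_source := fun n => by
          have := U.mem_chart_source (Function.surjInv U.surjective n)
          rwa [Function.surjInv_eq U.surjective n] at this
        chart_mem_atlas := fun n => mem_range_self _ }
    apply hasGroupoid_of_pregroupoid
    rintro _ _ ⟨x, rfl⟩ ⟨x', rfl⟩
    exact U.property_chart x x'

theorem isDevelopingMap : IsDevelopingMap U.adsStructure q dev := by
  intro x
  refine ⟨U.chart x, ?_, U.mem_chart_source x, U.chart_eventuallyEq x⟩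
  let := U.adsStructure.charted
  have := U.adsStructure.compatible
  exact StructureGroupoid.subset_maximalAtlas adsGroupoid ⟨x, rfl⟩

end IsAdSUniformization

end Structures

/-! ## The map `AdS^{f,h}_* → AdS³` is a local homeomorphism -/

theorem isLocalHomeomorph_of_isOpenMap {X Y : Type*} [TopologicalSpace X] [TopologicalSpace Y]
    {φ : X → Y} (hc : Continuous φ) (ho : IsOpenMap φ) (hi : ∀ x, ∃ U ∈ 𝓝 x, InjOn φ U) :
    IsLocalHomeomorph φ := by
  refine isLocalHomeomorph_iff_isOpenEmbedding_restrict.mpr fun x => ?_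
  obtain ⟨U, hU, hinj⟩ := hi x
  refine ⟨interior U, interior_mem_nhds.mpr hU, ?_⟩
  refine IsOpenEmbedding.of_continuous_injective_isOpenMap
    (hc.comp continuous_subtype_val) ?_ (ho.comp isOpen_interior.isOpenMap_subtype_val)
  intro a b hab
  exact Subtype.ext (hinj (interior_subset a.2) (interior_subset b.2) hab)

theorem ContinuousLinearMap.isInvertible_of_injective {T : ℂ →L[ℝ] ℂ}
    (h : ∀ v, T v = 0 → v = 0) : T.IsInvertible := by
  have hinj : Function.Injective (T : ℂ →ₗ[ℝ] ℂ) :=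
    (injective_iff_map_eq_zero (T : ℂ →ₗ[ℝ] ℂ)).mpr h
  refine ⟨(LinearEquiv.ofInjectiveEndo (T : ℂ →ₗ[ℝ] ℂ) hinj).toContinuousLinearEquiv, ?_⟩
  exact ContinuousLinearMap.ext fun v => rfl

namespace SL2R

theorem im_smul (g : SL2R) (w : ℍ) : (g • w).im = w.im / Complex.normSq (den g w) := by
  have h1 : ((g • w : ℍ) : ℂ).im = (num g w / den g w).im := by rw [coe_smul]
  have h2 := det_eq g
  have h3 : Complex.normSq (den g w) ≠ 0 := by simpa using den_ne_zero g w
  rw [UpperHalfPlane.coe_im] at h1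
  rw [h1, Complex.div_im]
  field_simp
  simp [num, den]
  linear_combination w.im * h2

/-- The entries of a matrix. -/
def entries (g : SL2R) : ℝ × ℝ × ℝ × ℝ := (g 0 0, g 0 1, g 1 0, g 1 1)

theorem continuous_entries : Continuous entries :=
  (continuous_entry 0 0).prodMk ((continuous_entry 0 1).prodMk
    ((continuous_entry 1 0).prodMk (continuous_entry 1 1)))

end SL2R

/-- The equation `(c f(z) + d) h(z) - (a f(z) + b) = 0` expresses that the matrix with entries
`a, b, c, d` sends `f(z)` to `h(z)`. -/
def smulDefect (f h : ℍ → ℍ) (u : (ℝ × ℝ × ℝ × ℝ) × ℂ) : ℂ :=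
  ((u.1.2.2.1 : ℂ) * toPlane f u.2 + (u.1.2.2.2 : ℂ)) * toPlane h u.2 -
    ((u.1.1 : ℂ) * toPlane f u.2 + (u.1.2.1 : ℂ))

theorem smulDefect_eq_zero_iff (f h : ℍ → ℍ) (g : SL2R) (z : ℍ) :
    smulDefect f h (g.entries, (z : ℂ)) = 0 ↔ g • f z = h z := by
  have h1 := SL2R.den_ne_zero g (f z)
  rw [UpperHalfPlane.ext_iff, SL2R.coe_smul, div_eq_iff h1, smulDefect, sub_eq_zero,
    toPlane_coe, toPlane_coe, eq_comm]
  simp only [SL2R.entries, SL2R.num, SL2R.den]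
  rw [mul_comm ((h z : ℍ) : ℂ)]

theorem contDiffAt_smulDefect {f h : ℍ → ℍ} (hf : IsC1 f) (hh : IsC1 h) (w : ℝ × ℝ × ℝ × ℝ)
    (p : ℍ) : ContDiffAt ℝ 1 (smulDefect f h) (w, (p : ℂ)) := by
  have h1 : ContDiffAt ℝ 1 (fun u : (ℝ × ℝ × ℝ × ℝ) × ℂ => toPlane f u.2) (w, (p : ℂ)) :=
    ContDiffAt.comp (g := toPlane f) (w, (p : ℂ)) (hf.contDiffAt p) contDiffAt_snd
  have h2 : ContDiffAt ℝ 1 (fun u : (ℝ × ℝ × ℝ × ℝ) × ℂ => toPlane h u.2) (w, (p : ℂ)) :=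
    ContDiffAt.comp (g := toPlane h) (w, (p : ℂ)) (hh.contDiffAt p) contDiffAt_snd
  have ho : ContDiff ℝ 1 (fun x : ℝ => (x : ℂ)) := Complex.ofRealCLM.contDiff
  have ha : ContDiffAt ℝ 1 (fun u : (ℝ × ℝ × ℝ × ℝ) × ℂ => (u.1.1 : ℂ)) (w, (p : ℂ)) :=
    (ho.comp (contDiff_fst.comp contDiff_fst)).contDiffAt
  have hb : ContDiffAt ℝ 1 (fun u : (ℝ × ℝ × ℝ × ℝ) × ℂ => (u.1.2.1 : ℂ)) (w, (p : ℂ)) :=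
    (ho.comp (contDiff_fst.comp (contDiff_snd.comp contDiff_fst))).contDiffAt
  have hc : ContDiffAt ℝ 1 (fun u : (ℝ × ℝ × ℝ × ℝ) × ℂ => (u.1.2.2.1 : ℂ)) (w, (p : ℂ)) :=
    (ho.comp (contDiff_fst.comp (contDiff_snd.comp (contDiff_snd.comp contDiff_fst)))).contDiffAt
  have hd : ContDiffAt ℝ 1 (fun u : (ℝ × ℝ × ℝ × ℝ) × ℂ => (u.1.2.2.2 : ℂ)) (w, (p : ℂ)) :=
    (ho.comp (contDiff_snd.comp (contDiff_snd.comp (contDiff_snd.comp contDiff_fst)))).contDiffAt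
  exact (((hc.mul h1).add hd).mul h2).sub ((ha.mul h1).add hb)

theorem hasFDerivAt_toPlane {f : ℍ → ℍ} (hf : IsC1 f) (p : ℍ) :
    HasFDerivAt (toPlane f) (hDeriv f p) (p : ℂ) :=
  ((hf.contDiffAt p).differentiableAt one_ne_zero).hasFDerivAt

/-- The coefficient of -Df comes out as a - h(p) c, which equals d⁻¹ for the denominator d because
the matrix has determinant one. -/
theorem hasFDerivAt_smulDefect_right {f h : ℍ → ℍ} (hf : IsC1 f) (hh : IsC1 h) {g : SL2R}
    {p : ℍ} (hg : g • f p = h p) :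
    HasFDerivAt (fun z => smulDefect f h (g.entries, z))
      (SL2R.den g (f p) • hDeriv h p - (SL2R.den g (f p))⁻¹ • hDeriv f p) (p : ℂ) := by
  have h1 := hasFDerivAt_toPlane hf p
  have h2 := hasFDerivAt_toPlane hh p
  have h3 := ((h1.const_mul (g 1 0 : ℂ)).add_const (g 1 1 : ℂ)).mul h2
  have h4 := (h1.const_mul (g 0 0 : ℂ)).add_const (g 0 1 : ℂ)
  refine (h3.sub h4).congr_fderiv ?_
  have hd := SL2R.den_ne_zero g (f p)
  have hdet : (g 0 0 : ℂ) * g 1 1 - g 0 1 * g 1 0 = 1 := by exact_mod_cast SL2R.det_eq g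
  have hz : ((h p : ℍ) : ℂ) = SL2R.num g (f p) / SL2R.den g (f p) := by
    rw [← hg, SL2R.coe_smul]
  have key : (g 0 0 : ℂ) - h p * g 1 0 = (SL2R.den g (f p))⁻¹ := by
    rw [hz]
    field_simp
    simp only [SL2R.num, SL2R.den]
    linear_combination hdet
  refine ContinuousLinearMap.ext fun v => ?_
  change ((g 1 0 : ℂ) * toPlane f p + (g 1 1 : ℂ)) * hDeriv h p v +
    toPlane h p * ((g 1 0 : ℂ) * hDeriv f p v) - (g 0 0 : ℂ) * hDeriv f p v =
    SL2R.den g (f p) * hDeriv h p v - (SL2R.den g (f p))⁻¹ * hDeriv f p v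
  rw [toPlane_coe, toPlane_coe, ← key, SL2R.den]
  ring

/-- The implicit function theorem with the four matrix entries as parameters, restricted afterwards
to determinant one. Existence of the solution will give openness of (A, z) ↦ A, and its local
uniqueness injectivity. -/
theorem exists_local_solution {f h : ℍ → ℍ} (hf : IsC1 f) (hh : IsC1 h) {g : SL2R} {p : ℍ}
    (hg : g • f p = h p) (hlt : ∀ v : ℂ, v ≠ 0 → pullbackMetric f p v < pullbackMetric h p v) :
    ∃ ψ : SL2R → ℍ, Tendsto ψ (𝓝 g) (𝓝 p) ∧ (∀ᶠ k in 𝓝 g, k • f (ψ k) = h (ψ k)) ∧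
      ∃ V ∈ 𝓝 g, ∃ W ∈ 𝓝 p, ∀ k ∈ V, ∀ z ∈ W, k • f z = h z → z = ψ k := by
  have hs := (contDiffAt_smulDefect hf hh g.entries p).hasStrictFDerivAt one_ne_zero
  have h1 : (fderiv ℝ (smulDefect f h) (g.entries, (p : ℂ))).comp
      (.inr ℝ (ℝ × ℝ × ℝ × ℝ) ℂ) =
      SL2R.den g (f p) • hDeriv h p - (SL2R.den g (f p))⁻¹ • hDeriv f p := by
    have h2 := hs.hasFDerivAt.comp (p : ℂ) (hasFDerivAt_prodMk_right g.entries (p : ℂ))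
    exact h2.unique (hasFDerivAt_smulDefect_right hf hh hg)
  have hinv : ((fderiv ℝ (smulDefect f h) (g.entries, (p : ℂ))).comp
      (.inr ℝ (ℝ × ℝ × ℝ × ℝ) ℂ)).IsInvertible := by
    rw [h1]
    apply ContinuousLinearMap.isInvertible_of_injective
    intro v hv
    by_contra hv0
    have h2 := hlt v hv0
    have hd := SL2R.den_ne_zero g (f p)
    -- A kernel vector satisfies Df v = d² Dh v. Since Im h(p) = Im f(p) / |d|², its two pullback
    -- lengths coincide, which the strict inequality forbids.
    have h3 : hDeriv f p v = SL2R.den g (f p) ^ 2 * hDeriv h p v := by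
      have h4 : SL2R.den g (f p) * hDeriv h p v - (SL2R.den g (f p))⁻¹ * hDeriv f p v = 0 := hv
      field_simp at h4
      linear_combination (-1 : ℂ) * h4
    have h5 := SL2R.im_smul g (f p)
    rw [hg] at h5
    have h6 : 0 < (f p).im := (f p).im_pos
    have h7 : 0 < ‖SL2R.den g (f p)‖ := norm_pos_iff.mpr hd
    rw [pullbackMetric, pullbackMetric, h5, h3, Complex.normSq_eq_norm_sq, norm_mul, norm_pow] at h2
    apply h2.ne
    field_simp
  have e1 := hs.eventually_apply_eq_iff_implicitFunctionOfProdDomain hinv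
  have e2 := hs.tendsto_implicitFunctionOfProdDomain hinv
  have e3 := hs.eventually_apply_implicitFunctionOfProdDomain hinv
  set χ := hs.implicitFunctionOfProdDomain hinv with hχ
  have h0 : smulDefect f h (g.entries, (p : ℂ)) = 0 := (smulDefect_eq_zero_iff f h g p).mpr hg
  rw [h0] at e1 e3
  simp only at e2 e3
  have hent : Tendsto SL2R.entries (𝓝 g) (𝓝 g.entries) := SL2R.continuous_entries.tendsto g
  have e4 : Tendsto (fun k : SL2R => χ k.entries) (𝓝 g) (𝓝 (p : ℂ)) := e2.comp hent
  have hof : Tendsto UpperHalfPlane.ofComplex (𝓝 (p : ℂ)) (𝓝 p) := by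
    have h5 : ContinuousAt UpperHalfPlane.ofComplex (p : ℂ) :=
      (UpperHalfPlane.mdifferentiableAt_ofComplex p.im_pos).continuousAt
    have := h5.tendsto
    rwa [UpperHalfPlane.ofComplex_apply] at this
  -- The implicit solution is a complex number; near p it stays in the upper half-plane.
  have e5 : ∀ᶠ k : SL2R in 𝓝 g, ((UpperHalfPlane.ofComplex (χ k.entries) : ℍ) : ℂ) = χ k.entries :=
    e4.eventually (UpperHalfPlane.eventuallyEq_coe_comp_ofComplex p.im_pos)
  refine ⟨fun k => UpperHalfPlane.ofComplex (χ k.entries), hof.comp e4, ?_, ?_⟩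
  · filter_upwards [e5, hent.eventually e3] with k h5 h6
    rw [← smulDefect_eq_zero_iff, h5, h6]
  · rw [nhds_prod_eq] at e1
    obtain ⟨pa, ha, pb, hb, hab⟩ := Filter.eventually_prod_iff.mp e1
    refine ⟨_, hent.eventually ha, _, UpperHalfPlane.continuous_coe.tendsto p |>.eventually hb, ?_⟩
    intro k hk z hz hkz
    have h5 := (hab hk hz).mp ((smulDefect_eq_zero_iff f h k z).mpr hkz)
    simp only at h5
    change z = UpperHalfPlane.ofComplex (χ k.entries)
    rw [h5, UpperHalfPlane.ofComplex_apply]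

namespace EquivariantPair

variable {Γ : Subgroup PSL2R} (D : EquivariantPair Γ)

theorem pullbackMetric_lt_of_notMem (hlt : PullbackLT D.f D.h) {p : ℍ} (hp : p ∉ D.C) {v : ℂ}
    (hv : v ≠ 0) : pullbackMetric D.f p v < pullbackMetric D.h p v := by
  refine (hlt p).2 (fun w hw => ?_) v hv
  have hinj : Function.Injective (hDeriv D.h p) := not_not.mp hp
  have h1 : hDeriv D.h p w ≠ 0 := fun h0 => hw (hinj (by rw [h0, map_zero]))
  have h2 := (D.h p).im_pos
  have h3 : 0 < ‖hDeriv D.h p w‖ := norm_pos_iff.mpr h1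
  unfold pullbackMetric
  positivity

/-- The differential of the C¹ map h is continuous, and invertible operators form an open set. -/
theorem isClosed_C : IsClosed D.C := by
  rw [← isOpen_compl_iff, isOpen_iff_mem_nhds]
  intro p hp
  have hinj : Function.Injective (hDeriv D.h p) := not_not.mp hp
  have h1 : ContinuousAt (fun q : ℍ => hDeriv D.h q) p := by
    have h2 : ContinuousAt (fderiv ℝ (toPlane D.h)) (p : ℂ) :=
      (D.h_c1.contDiffAt p).continuousAt_fderiv one_ne_zero
    exact h2.comp (f := fun q : ℍ => (q : ℂ)) UpperHalfPlane.continuous_coe.continuousAt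
  have h3 : (hDeriv D.h p).IsInvertible :=
    ContinuousLinearMap.isInvertible_of_injective fun v hv => hinj (by rw [hv, map_zero])
  obtain ⟨e, he⟩ := h3
  have h4 := ContinuousLinearEquiv.nhds e
  rw [he] at h4
  filter_upwards [h1.eventually h4] with q hq
  obtain ⟨e', he'⟩ := hq
  refine not_not.mpr ?_
  rw [← he']
  exact e'.injective

theorem isClosed_L : IsClosed D.L := D.isClosed_C.preimage D.continuous_fib

theorem continuous_inclStar : Continuous D.inclStar := D.continuous_incl.comp continuous_subtype_val

/-- The map k ↦ (k, ψ(k)) is a local section through the given point, which yields openness;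
uniqueness of ψ(k) yields local injectivity. The argument runs in SL(2, ℝ) and descends because the
quotient map is open. -/
theorem isLocalHomeomorph_inclStar (hlt : PullbackLT D.f D.h) : IsLocalHomeomorph D.inclStar := by
  refine isLocalHomeomorph_of_isOpenMap D.continuous_inclStar ?_ ?_
  · rw [isOpenMap_iff_nhds_le]
    rintro ⟨⟨⟨A, p⟩, hx⟩, hp⟩
    induction A using QuotientGroup.induction_on with
    | H g =>
    obtain ⟨ψ, h1, h2, -⟩ := exists_local_solution D.f_c1 D.h_c1 (g := g) (p := p) hx
      fun v hv => D.pullbackMetric_lt_of_notMem hlt hp hv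
    intro T hT
    have hT' : D.inclStar ⁻¹' T ∈ 𝓝 (⟨⟨(PSL2R.mk g, p), hx⟩, hp⟩ : D.AdSStar) := hT
    rw [nhds_subtype_eq_comap, nhds_subtype_eq_comap, Filter.comap_comap] at hT'
    obtain ⟨O, hO, hOT⟩ := Filter.mem_comap.mp hT'
    have h3 : Tendsto (fun k : SL2R => ((PSL2R.mk k, ψ k) : PSL2R × ℍ)) (𝓝 g)
        (𝓝 (PSL2R.mk g, p)) := by
      rw [nhds_prod_eq]
      exact (PSL2R.continuous_mk.tendsto g).prodMk h1
    have h4 : ∀ᶠ k in 𝓝 g, ψ k ∉ D.C := h1.eventually (D.isClosed_C.isOpen_compl.mem_nhds hp)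
    have h5 : ∀ᶠ k in 𝓝 g, PSL2R.mk k ∈ T := by
      filter_upwards [h3.eventually hO, h4, h2] with k h6 h7 h8
      have h9 : (⟨⟨(PSL2R.mk k, ψ k), h8⟩, h7⟩ : D.AdSStar) ∈ D.inclStar ⁻¹' T := hOT h6
      exact h9
    exact PSL2R.isOpenQuotientMap_mk.isOpenMap.image_mem_nhds h5 |> fun h6 =>
      Filter.mem_of_superset h6 (by rintro _ ⟨k, hk, rfl⟩; exact hk)
  · rintro ⟨⟨⟨A, p⟩, hx⟩, hp⟩
    induction A using QuotientGroup.induction_on with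
    | H g =>
    obtain ⟨ψ, -, -, V, hV, W, hW, h3⟩ := exists_local_solution D.f_c1 D.h_c1 (g := g) (p := p) hx
      fun v hv => D.pullbackMetric_lt_of_notMem hlt hp hv
    have h4 : (fun x : D.AdSStar => D.inclStar x) ⁻¹' (PSL2R.mk '' V) ∩
        (fun x : D.AdSStar => D.fib x.1) ⁻¹' W ∈
        𝓝 (⟨⟨(PSL2R.mk g, p), hx⟩, hp⟩ : D.AdSStar) := by
      refine Filter.inter_mem ?_ ?_
      · exact D.continuous_inclStar.continuousAt
          (PSL2R.isOpenQuotientMap_mk.isOpenMap.image_mem_nhds hV)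
      · exact (D.continuous_fib.comp continuous_subtype_val).continuousAt hW
    refine ⟨_, h4, ?_⟩
    rintro x ⟨⟨k, hk, hkx⟩, hx2⟩ y ⟨-, hy2⟩ hxy
    have h5 : k • D.f (D.fib x.1) = D.h (D.fib x.1) := by
      have := D.incl_smul_f x.1
      rwa [show D.incl x.1 = PSL2R.mk k from hkx.symm] at this
    have h6 : k • D.f (D.fib y.1) = D.h (D.fib y.1) := by
      have := D.incl_smul_f y.1
      rwa [show D.incl y.1 = PSL2R.mk k from (hkx.trans hxy).symm] at this
    exact Subtype.ext (D.ext_incl_fib hxy ((h3 k hk _ hx2 h5).trans (h3 k hk _ hy2 h6).symm))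

end EquivariantPair

/-! ## Orientable three-manifolds given by local homeomorphisms -/

section Orientable

variable {X M : Type} [TopologicalSpace X] [TopologicalSpace M]

/-- The chart of the quotient `M` of `X` near the image of `x`. -/
def euclideanChart {q : X → M} (hq : IsLocalHomeomorph q) {ι : X → EuclideanSpace ℝ (Fin 3)}
    (hι : IsOpenEmbedding ι) (x : X) : OpenPartialHomeomorph M (EuclideanSpace ℝ (Fin 3)) :=
  (hq.localInverseAt x) ≫ₕ (hι.isLocalHomeomorph.localInverseAt x).symm

theorem mem_euclideanChart_source {q : X → M} (hq : IsLocalHomeomorph q)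
    {ι : X → EuclideanSpace ℝ (Fin 3)} (hι : IsOpenEmbedding ι) (x : X) :
    q x ∈ (euclideanChart hq hι x).source := by
  simp [euclideanChart]

theorem euclideanChart_apply {q : X → M} (hq : IsLocalHomeomorph q)
    {ι : X → EuclideanSpace ℝ (Fin 3)} (hι : IsOpenEmbedding ι) (x : X) (m : M) :
    euclideanChart hq hι x m = ι (hq.localInverseAt x m) := by
  simp [euclideanChart]

/-- As for the anti-de Sitter charts, a transition map is a change of sheet, realized locally by τ
and read in `ι` as T. -/
theorem euclideanChart_transition {q : X → M} (hq : IsLocalHomeomorph q)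
    {ι : X → EuclideanSpace ℝ (Fin 3)} (hι : IsOpenEmbedding ι)
    (hT : ∀ x y : X, q x = q y → ∃ T : EuclideanSpace ℝ (Fin 3) → EuclideanSpace ℝ (Fin 3),
      ContDiffAt ℝ 1 T (ι x) ∧ 0 < (fderiv ℝ T (ι x)).det ∧ ∃ τ : X → X, ContinuousAt τ x ∧
        τ x = y ∧ ∀ᶠ z in 𝓝 x, ι (τ z) = T (ι z) ∧ q (τ z) = q z)
    (x x' : X) {a : EuclideanSpace ℝ (Fin 3)}
    (ha : a ∈ ((euclideanChart hq hι x).symm ≫ₕ euclideanChart hq hι x').source) :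
    ∃ T : EuclideanSpace ℝ (Fin 3) → EuclideanSpace ℝ (Fin 3),
      ContDiffAt ℝ 1 T a ∧ 0 < (fderiv ℝ T a).det ∧
      ((euclideanChart hq hι x).symm ≫ₕ euclideanChart hq hι x') =ᶠ[𝓝 a] T := by
  rw [OpenPartialHomeomorph.trans_source] at ha
  set i := hq.localInverseAt x with hi
  set i' := hq.localInverseAt x' with hi'
  set e := euclideanChart hq hι x with he
  set e' := euclideanChart hq hι x' with he'
  have hat : a ∈ e.target := ha.1
  have hn' : e.symm a ∈ e'.source := ha.2
  have hn : e.symm a ∈ e.source := e.map_target hat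
  have hns : e.symm a ∈ i.source := by
    rw [he, euclideanChart, OpenPartialHomeomorph.trans_source] at hn
    exact hn.1
  have hns' : e.symm a ∈ i'.source := by
    rw [he', euclideanChart, OpenPartialHomeomorph.trans_source] at hn'
    exact hn'.1
  obtain ⟨T, hT1, hT2, τ, hτ, hτe, hτq⟩ := hT (i (e.symm a)) (i' (e.symm a))
    (by rw [hi, hi', hq.apply_localInverseAt_of_mem hns, hq.apply_localInverseAt_of_mem hns'])
  have hia : ι (i (e.symm a)) = a := by
    rw [hi, ← euclideanChart_apply hq hι, ← he, e.right_inv hat]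
  rw [hia] at hT1 hT2
  refine ⟨T, hT1, hT2, ?_⟩
  have t1 : Tendsto e.symm (𝓝 a) (𝓝 (e.symm a)) := e.symm.continuousAt hat
  have t2 : Tendsto (fun b => i (e.symm b)) (𝓝 a) (𝓝 (i (e.symm a))) :=
    (i.continuousAt hns).tendsto.comp t1
  have t3 : Tendsto (fun b => τ (i (e.symm b))) (𝓝 a) (𝓝 (i' (e.symm a))) := by
    rw [← hτe]
    exact hτ.tendsto.comp t2
  filter_upwards [t2.eventually hτq, t3.eventually (i'.open_target.mem_nhds (i'.map_source hns')),
    t1.eventually (i.open_source.mem_nhds hns), t1.eventually (i'.open_source.mem_nhds hns'),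
    e.open_target.mem_nhds hat] with b h1 h3 h4 h5 h6
  have h7 : τ (i (e.symm b)) = i' (e.symm b) := by
    apply hq.injOn_localInverseAt_target h3 (i'.map_source h5)
    rw [h1.2, hi, hi', hq.apply_localInverseAt_of_mem h4, hq.apply_localInverseAt_of_mem h5]
  have h8 : ι (i (e.symm b)) = b := by
    rw [hi, ← euclideanChart_apply hq hι, ← he, e.right_inv h6]
  rw [OpenPartialHomeomorph.coe_trans, Function.comp_apply, he', euclideanChart_apply, ← hi', ← h7,
    h1.1, h8]

theorem isOrientableThreeManifold_of_isLocalHomeomorph [T2Space M] [SecondCountableTopology M]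
    {q : X → M} (hq : IsLocalHomeomorph q) (hs : Function.Surjective q)
    {ι : X → EuclideanSpace ℝ (Fin 3)} (hι : IsOpenEmbedding ι)
    (hT : ∀ x y : X, q x = q y → ∃ T : EuclideanSpace ℝ (Fin 3) → EuclideanSpace ℝ (Fin 3),
      ContDiffAt ℝ 1 T (ι x) ∧ 0 < (fderiv ℝ T (ι x)).det ∧ ∃ τ : X → X, ContinuousAt τ x ∧
        τ x = y ∧ ∀ᶠ z in 𝓝 x, ι (τ z) = T (ι z) ∧ q (τ z) = q z) :
    IsOrientableThreeManifold M := by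
  refine ⟨inferInstance, inferInstance,
    { atlas := range (euclideanChart hq hι)
      chartAt := fun n => euclideanChart hq hι (Function.surjInv hs n)
      mem_chart_source := fun n => by
        have := mem_euclideanChart_source hq hι (Function.surjInv hs n)
        rwa [Function.surjInv_eq hs n] at this
      chart_mem_atlas := fun n => mem_range_self _ }, ?_⟩
  rintro _ ⟨x, rfl⟩ _ ⟨x', rfl⟩
  constructor
  · intro a ha
    obtain ⟨T, hT1, -, hT3⟩ := euclideanChart_transition hq hι hT x x' ha
    exact (hT1.congr_of_eventuallyEq hT3).contDiffWithinAt
  · intro a ha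
    obtain ⟨T, -, hT2, hT3⟩ := euclideanChart_transition hq hι hT x x' ha
    rwa [hT3.fderiv_eq]

end Orientable

/-! ## The quotient manifold -/

/-- The matrix is block triangular, with blocks multiplication by c, of determinant |c|², and 1. The
shear l has no influence, so a holomorphic base map forces positive orientation. -/
theorem det_shear_pos {c : ℂ} (hc : c ≠ 0) (l : ℂ →ₗ[ℝ] ℝ) (L : (ℂ × ℝ) →ₗ[ℝ] (ℂ × ℝ))
    (hL : ∀ v : ℂ × ℝ, L v = (c * v.1, v.2 + l v.1)) : 0 < LinearMap.det L := by
  let b := Complex.basisOneI.prod (Module.Basis.singleton Unit ℝ)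
  have h : LinearMap.toMatrix b b L =
      Matrix.fromBlocks !![c.re, -c.im; c.im, c.re] 0
        (Matrix.of fun _ j => l (Complex.basisOneI j)) 1 := by
    ext i j
    rcases i with i | i <;> rcases j with j | j
    · fin_cases i <;> fin_cases j <;> simp [b, LinearMap.toMatrix_apply, hL]
    · fin_cases i <;> simp [b, LinearMap.toMatrix_apply, hL]
    · simp [b, LinearMap.toMatrix_apply, hL]
    · simp [b, LinearMap.toMatrix_apply, hL]
  rw [← LinearMap.det_toMatrix b, h, Matrix.det_fromBlocks_zero₁₂, Matrix.det_fin_two_of,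
    Matrix.det_one, mul_one]
  have := Complex.normSq_pos.mpr hc
  rw [Complex.normSq_apply] at this
  linarith

theorem contDiffAt_ang (A : PSL2R) {φ : ℍ → ℍ} (hφ : IsC1 φ) (p : ℍ) :
    ContDiffAt ℝ 1 (fun z : ℂ => (PSL2R.ang A (φ (UpperHalfPlane.ofComplex z)) : ℂ)) p := by
  induction A using QuotientGroup.induction_on with
  | H g =>
  have h1 : ContDiffAt ℝ 1 (fun z : ℂ => SL2R.den g (toPlane φ z)) p :=
    (contDiffAt_const.mul (hφ.contDiffAt p)).add contDiffAt_const
  have h2 : ContDiffAt ℝ 1 (fun z : ℂ => (starRingEnd ℂ) (SL2R.den g (toPlane φ z))) p :=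
    Complex.conjCLE.contDiff.contDiffAt.comp (p : ℂ) h1
  have h3 : SL2R.den g (toPlane φ p) ≠ 0 := by
    rw [toPlane_coe]
    exact SL2R.den_ne_zero g (φ p)
  exact (h2.mul (h1.inv h3)).congr_of_eventuallyEq
    (Eventually.of_forall fun z => div_eq_mul_inv _ _)

theorem exists_hasFDerivAt_smul (A : PSL2R) (p : ℍ) : ∃ c : ℂ, c ≠ 0 ∧
    HasFDerivAt (toPlane fun z => A • z) (c • (1 : ℂ →L[ℝ] ℂ)) (p : ℂ) := by
  have hd : DifferentiableAt ℂ (toPlane fun z => A • z) (p : ℂ) := by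
    induction A using QuotientGroup.induction_on with
    | H g =>
      exact UpperHalfPlane.mdifferentiableAt_iff.mp
        ((UpperHalfPlane.mdifferentiable_coe _).comp p (UpperHalfPlane.mdifferentiable_smul
          (g := (Matrix.SpecialLinearGroup.mapGL ℝ g)) (by simp) p))
  have h1 := hd.hasDerivAt.complexToReal_fderiv
  refine ⟨_, ?_, h1⟩
  intro h0
  have h2 := hDeriv_smul_injective A p
  refine one_ne_zero (h2 (a₁ := 1) (a₂ := 0) ?_)
  rw [hDeriv, h1.fderiv]
  change deriv _ _ * (1 : ℂ) = deriv _ _ * (0 : ℂ)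
  rw [h0, zero_mul, zero_mul]

theorem isC1_smul (A : PSL2R) : IsC1 fun z => A • z := by
  have hd : DifferentiableOn ℂ (toPlane fun z => A • z) {z : ℂ | 0 < z.im} := by
    intro z hz
    induction A using QuotientGroup.induction_on with
    | H g =>
      exact (UpperHalfPlane.mdifferentiableAt_iff.mp
        ((UpperHalfPlane.mdifferentiable_coe _).comp (⟨z, hz⟩ : ℍ)
          (UpperHalfPlane.mdifferentiable_smul
          (g := (Matrix.SpecialLinearGroup.mapGL ℝ g)) (by simp) _))).differentiableWithinAt
  exact (hd.contDiffOn UpperHalfPlane.isOpen_upperHalfPlaneSet).restrict_scalars ℝ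

/-- An identification of `ℂ × ℝ` with the Euclidean space of dimension three. -/
def complexProdRealEquiv : (ℂ × ℝ) ≃L[ℝ] EuclideanSpace ℝ (Fin 3) :=
  ContinuousLinearEquiv.ofFinrankEq (by simp [Complex.finrank_real_complex])

/-- The embedding of `ℍ × ℝ` in the Euclidean space of dimension three. -/
def cylinderEmb (u : ℍ × ℝ) : EuclideanSpace ℝ (Fin 3) := complexProdRealEquiv ((u.1 : ℂ), u.2)

theorem isOpenEmbedding_cylinderEmb : IsOpenEmbedding cylinderEmb :=
  complexProdRealEquiv.toHomeomorph.isOpenEmbedding.comp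
    (UpperHalfPlane.isOpenEmbedding_coe.prodMap IsOpenEmbedding.id)

namespace EquivariantPair

variable {Γ : Subgroup PSL2R} (D : EquivariantPair Γ)

/-- The change of the rotation number under the action of `γ` on the fiber over `z`. -/
def twist (γ : Γ) (z : ℍ) : Circle := PSL2R.ang (D.j γ) (D.h z) * (PSL2R.ang (D.ρ γ) (D.f z))⁻¹

theorem smul_ofAng (γ : Γ) (u : ℍ × Circle) :
    γ • D.ofAng u = D.ofAng (γ • u.1, D.twist γ u.1 * u.2) := by
  rw [← D.ofAng_rotNum (γ • D.ofAng u), rotNum_smul, rotNum_ofAng]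
  rfl

theorem contDiffAt_twist (γ : Γ) (p : ℍ) :
    ContDiffAt ℝ 1 (fun z : ℂ => (D.twist γ (UpperHalfPlane.ofComplex z) : ℂ)) p := by
  have h1 := contDiffAt_ang (D.j γ) D.h_c1 p
  have h2 := contDiffAt_ang (D.ρ γ) D.f_c1 p
  have h3 : ContDiffAt ℝ 1 (fun z : ℂ =>
      (PSL2R.ang (D.ρ γ) (D.f (UpperHalfPlane.ofComplex z)) : ℂ)⁻¹) p := h2.inv (Circle.coe_ne_zero _)
  refine (h1.mul h3).congr_of_eventuallyEq (Eventually.of_forall fun z => ?_)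
  simp [twist]

/-- The covering of `M^{f,h}` by `ℍ × ℝ`. -/
def cylinder (u : ℍ × ℝ) : D.M := ⟦D.ofAng (u.1, Circle.exp u.2)⟧

theorem surjective_cylinder : Function.Surjective D.cylinder := by
  intro m
  induction m using Quotient.inductionOn with
  | h x =>
    refine ⟨(D.fib x, Complex.arg (D.rotNum x)), ?_⟩
    rw [cylinder, Circle.exp_arg, ofAng_rotNum]

theorem mk_mem_LQuot_iff (x : D.AdS) : (⟦x⟧ : D.M) ∈ D.LQuot ↔ x ∈ D.L := by
  constructor
  · rintro ⟨y, hy, hyx⟩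
    obtain ⟨γ, hγ⟩ := MulAction.orbitRel_apply.mp (Quotient.exact hyx)
    refine D.C_of_smul (γ := γ) ?_
    have h1 : γ • D.fib x = D.fib y := congrArg D.fib hγ
    rw [h1]
    exact hy
  · exact fun hx => ⟨x, hx, rfl⟩

theorem isClosed_LQuot : IsClosed D.LQuot := by
  have h1 : IsQuotientMap (fun x : D.AdS => (⟦x⟧ : D.M)) := isQuotientMap_quot_mk
  rw [← h1.isClosed_preimage]
  have h2 : (fun x : D.AdS => (⟦x⟧ : D.M)) ⁻¹' D.LQuot = D.L :=
    Set.ext fun x => D.mk_mem_LQuot_iff x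
  rw [h2]
  exact D.isClosed_L

theorem surjective_projStar : Function.Surjective D.projStar := by
  rintro ⟨m, hm⟩
  induction m using Quotient.inductionOn with
  | h x => exact ⟨⟨x, fun hx => hm ((D.mk_mem_LQuot_iff x).mpr hx)⟩, rfl⟩

theorem isAdSUniformization_id (hlt : PullbackLT D.f D.h) :
    IsAdSUniformization (id : D.AdSStar → D.AdSStar) D.inclStar where
  isLocalHomeomorph_proj := (Homeomorph.refl _).isLocalHomeomorph
  surjective := Function.surjective_id
  isLocalHomeomorph_dev := D.isLocalHomeomorph_inclStar hlt
  deck x y hxy := ⟨1, id, continuousAt_id, hxy, Eventually.of_forall fun z => rfl,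
    Eventually.of_forall fun z => by simp [adsIsom]⟩

theorem incl_ofAng_exp (p : ℍ) (t : ℝ) : D.incl (D.ofAng (p, Circle.exp t)) =
    adsIsom (sec (D.h p), sec (D.f p)) (rot t) := by
  rw [incl_ofAng, adsIsom, ← rotC_exp]
  unfold isomOf
  rfl

theorem isTimelikeGeodesicSubset_fiber {S : AdSStructure D.AdSStar}
    (hS : IsDevelopingMap S id D.inclStar) (p : ↥(D.C)ᶜ) :
    IsTimelikeGeodesicSubset S (D.fibStar ⁻¹' {p}) := by
  let c : ℝ → D.AdSStar := fun t => ⟨D.ofAng (p.1, Circle.exp t), p.2⟩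
  have hc : Continuous c := Continuous.subtype_mk (D.continuous_ofAng.comp
    (continuous_const.prodMk Circle.exp.continuous)) _
  have hr : range c = D.fibStar ⁻¹' {p} := by
    ext x
    constructor
    · rintro ⟨t, rfl⟩
      rfl
    · intro hx
      have hx' : D.fib x.1 = p.1 := congrArg Subtype.val hx
      refine ⟨Complex.arg (D.rotNum x.1), Subtype.ext ?_⟩
      change D.ofAng (p.1, Circle.exp (Complex.arg (D.rotNum x.1))) = x.1
      rw [Circle.exp_arg, ← hx', ofAng_rotNum]
  rw [← hr]
  refine hS.isTimelikeGeodesicSubset hc fun t => ?_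
  have h1 : D.inclStar ∘ c = fun t => adsIsom (sec (D.h p), sec (D.f p)) (rot t) :=
    funext fun t => D.incl_ofAng_exp p.1 t
  rw [h1]
  exact (isTimelikeGeodesicAt_rot t).adsIsom _

/-- The identification of x with y comes from some γ. It lifts to ℍ × ℝ as γ on the base together
with a translation of the angle by a local logarithm of the twist, so the preceding determinant
computation applies. -/
theorem cylinder_transition (x y : ℍ × ℝ) (hxy : D.cylinder x = D.cylinder y) :
    ∃ T : EuclideanSpace ℝ (Fin 3) → EuclideanSpace ℝ (Fin 3),
      ContDiffAt ℝ 1 T (cylinderEmb x) ∧ 0 < (fderiv ℝ T (cylinderEmb x)).det ∧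
      ∃ τ : ℍ × ℝ → ℍ × ℝ, ContinuousAt τ x ∧ τ x = y ∧
        ∀ᶠ z in 𝓝 x, cylinderEmb (τ z) = T (cylinderEmb z) ∧ D.cylinder (τ z) = D.cylinder z := by
  obtain ⟨γ, hγ⟩ := MulAction.orbitRel_apply.mp (Quotient.exact hxy.symm)
  have hγ : γ • D.ofAng (x.1, Circle.exp x.2) = D.ofAng (y.1, Circle.exp y.2) := hγ
  rw [smul_ofAng] at hγ
  have hγ' := D.homeo.symm.injective hγ
  have hy1 : γ • x.1 = y.1 := congrArg Prod.fst hγ'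
  have hy2 : D.twist γ x.1 * Circle.exp x.2 = Circle.exp y.2 := congrArg Prod.snd hγ'
  -- Division by the twist at x makes the value there 1, away from the cut of the argument, so `a`
  -- is C¹ at x and vanishes there. The constant `y.2 - x.2` below then sends x to y.
  let a : ℂ → ℝ := fun z => Complex.arg ((D.twist γ (UpperHalfPlane.ofComplex z) : ℂ) *
    (D.twist γ x.1 : ℂ)⁻¹)
  let T₀ : ℂ × ℝ → ℂ × ℝ := fun u => (toPlane (fun z => (γ : PSL2R) • z) u.1,
    u.2 + (y.2 - x.2) + a u.1)
  have ha : ContDiffAt ℝ 1 a x.1 := by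
    have h1 : ContDiffAt ℝ 1 (fun z : ℂ => (D.twist γ (UpperHalfPlane.ofComplex z) : ℂ) *
      (D.twist γ x.1 : ℂ)⁻¹) x.1 := (D.contDiffAt_twist γ x.1).mul contDiffAt_const
    have h2 : (D.twist γ (UpperHalfPlane.ofComplex (x.1 : ℂ)) : ℂ) * (D.twist γ x.1 : ℂ)⁻¹ = 1 := by
      rw [UpperHalfPlane.ofComplex_apply, mul_inv_cancel₀ (Circle.coe_ne_zero _)]
    have h3 : ContDiffAt ℝ 1 Complex.log ((D.twist γ (UpperHalfPlane.ofComplex (x.1 : ℂ)) : ℂ) *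
        (D.twist γ x.1 : ℂ)⁻¹) := by
      rw [h2]
      exact (Complex.contDiffAt_log Complex.one_mem_slitPlane).restrict_scalars ℝ
    have h4 := h3.comp (x.1 : ℂ) h1
    refine (Complex.imCLM.contDiff.contDiffAt.comp (x.1 : ℂ) h4).congr_of_eventuallyEq
      (Eventually.of_forall fun z => ?_)
    exact (Complex.log_im _).symm
  have hT₀ : ContDiffAt ℝ 1 T₀ ((x.1 : ℂ), x.2) := by
    have h1 : ContDiffAt ℝ 1 (fun u : ℂ × ℝ => toPlane (fun z => (γ : PSL2R) • z) u.1)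
        ((x.1 : ℂ), x.2) := ContDiffAt.comp (g := toPlane (fun z => (γ : PSL2R) • z))
          ((x.1 : ℂ), x.2) ((isC1_smul γ).contDiffAt x.1) contDiffAt_fst
    have h2 : ContDiffAt ℝ 1 (fun u : ℂ × ℝ => a u.1) ((x.1 : ℂ), x.2) :=
      ContDiffAt.comp (g := a) ((x.1 : ℂ), x.2) ha contDiffAt_fst
    exact h1.prodMk ((contDiffAt_snd.add contDiffAt_const).add h2)
  have hx0 : complexProdRealEquiv.symm (cylinderEmb x) = ((x.1 : ℂ), x.2) :=
    complexProdRealEquiv.symm_apply_apply _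
  let T := fun v => complexProdRealEquiv (T₀ (complexProdRealEquiv.symm v))
  have hdet : 0 < (fderiv ℝ T (cylinderEmb x)).det := by
    obtain ⟨c, hc, hsm⟩ := exists_hasFDerivAt_smul (γ : PSL2R) x.1
    have had := (ha.differentiableAt one_ne_zero).hasFDerivAt
    have h1 : HasFDerivAt (fun u : ℂ × ℝ => toPlane (fun z => (γ : PSL2R) • z) u.1)
        ((c • (1 : ℂ →L[ℝ] ℂ)).comp (.fst ℝ ℂ ℝ)) ((x.1 : ℂ), x.2) :=
      HasFDerivAt.comp (g := toPlane (fun z => (γ : PSL2R) • z)) ((x.1 : ℂ), x.2) hsm hasFDerivAt_fst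
    have h2 : HasFDerivAt (fun u : ℂ × ℝ => a u.1)
        ((fderiv ℝ a x.1).comp (.fst ℝ ℂ ℝ)) ((x.1 : ℂ), x.2) :=
      HasFDerivAt.comp (g := a) ((x.1 : ℂ), x.2) had hasFDerivAt_fst
    have h3 := h1.prodMk (((hasFDerivAt_snd (𝕜 := ℝ) (E := ℂ) (F := ℝ)
      (p := ((x.1 : ℂ), x.2))).add_const (y.2 - x.2)).add h2)
    let L₀ : (ℂ × ℝ) →L[ℝ] (ℂ × ℝ) := ((c • (1 : ℂ →L[ℝ] ℂ)).comp (.fst ℝ ℂ ℝ)).prod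
      (ContinuousLinearMap.snd ℝ ℂ ℝ + (fderiv ℝ a x.1).comp (.fst ℝ ℂ ℝ))
    have h4 : HasFDerivAt T₀ L₀ (complexProdRealEquiv.symm (cylinderEmb x)) := by
      rw [hx0]; exact h3
    have h5 := (complexProdRealEquiv.hasFDerivAt
      (x := T₀ (complexProdRealEquiv.symm (cylinderEmb x)))).comp (cylinderEmb x)
      (h4.comp (cylinderEmb x) complexProdRealEquiv.symm.hasFDerivAt)
    have h6 : HasFDerivAt T _ (cylinderEmb x) := h5
    rw [h6.fderiv, ContinuousLinearMap.det]
    have h7 := det_shear_pos hc (fderiv ℝ a (x.1 : ℂ)).toLinearMap L₀.toLinearMap (fun v => rfl)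
    -- The determinant does not depend on the identification of ℂ × ℝ with Euclidean space.
    rw [← LinearMap.det_conj L₀.toLinearMap complexProdRealEquiv.toLinearEquiv] at h7
    exact h7
  refine ⟨T, ?_, hdet,
    fun u => (γ • u.1, u.2 + (y.2 - x.2) + a u.1), ?_, ?_, Eventually.of_forall fun u => ⟨?_, ?_⟩⟩
  · have h1 : ContDiffAt ℝ 1 T₀ (complexProdRealEquiv.symm (cylinderEmb x)) := by
      rw [hx0]; exact hT₀
    exact complexProdRealEquiv.contDiff.contDiffAt.comp (cylinderEmb x)
      (h1.comp (cylinderEmb x) complexProdRealEquiv.symm.contDiff.contDiffAt)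
  · have h1 : ContinuousAt (fun u : ℍ × ℝ => a u.1) x :=
      ContinuousAt.comp (g := a) (f := fun u : ℍ × ℝ => (u.1 : ℂ)) ha.continuousAt
        (UpperHalfPlane.continuous_coe.comp continuous_fst).continuousAt
    have h2 : ContinuousAt (fun u : ℍ × ℝ => γ • u.1) x :=
      ((continuous_const_smul γ).comp continuous_fst).continuousAt
    exact h2.prodMk ((continuousAt_snd.add continuousAt_const).add h1)
  · refine Prod.ext hy1 ?_
    simp only [a]
    rw [UpperHalfPlane.ofComplex_apply, mul_inv_cancel₀ (Circle.coe_ne_zero _), Complex.arg_one]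
    ring
  · change _ = complexProdRealEquiv (T₀ (complexProdRealEquiv.symm (complexProdRealEquiv _)))
    rw [ContinuousLinearEquiv.symm_apply_apply, cylinderEmb]
    congr 1
    refine Prod.ext ?_ rfl
    exact (toPlane_coe (fun z => (γ : PSL2R) • z) u.1).symm
  · have h1 : Circle.exp (u.2 + (y.2 - x.2) + a u.1) = D.twist γ u.1 * Circle.exp u.2 := by
      have h2 : Circle.exp (a u.1) = D.twist γ u.1 * (D.twist γ x.1)⁻¹ := by
        have h3 := Circle.exp_arg (D.twist γ u.1 * (D.twist γ x.1)⁻¹)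
        rw [← h3]
        simp only [a]
        rw [UpperHalfPlane.ofComplex_apply, Circle.coe_mul, Circle.coe_inv]
      rw [Circle.exp_add, Circle.exp_add, Circle.exp_sub, h2, ← hy2]
      rw [mul_div_assoc, div_self', mul_one]
      rw [mul_comm (Circle.exp u.2), mul_comm (D.twist γ u.1), mul_mul_mul_comm, mul_inv_cancel, one_mul]
      rw [mul_comm]
    rw [cylinder, cylinder, h1]
    refine Quotient.sound (MulAction.orbitRel_apply.mpr ⟨γ, ?_⟩)
    exact D.smul_ofAng γ (u.1, Circle.exp u.2)

variable [ProperlyDiscontinuousSMul Γ ℍ] [IsCancelSMul Γ ℍ]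

theorem isQuotientCoveringMap_mk :
    IsQuotientCoveringMap (fun x : D.AdS => (⟦x⟧ : D.M)) Γ :=
  isQuotientCoveringMap_quotientMk_of_properlyDiscontinuousSMul

theorem isLocalHomeomorph_cylinder : IsLocalHomeomorph D.cylinder := by
  have h1 : IsLocalHomeomorph fun u : ℍ × ℝ => (u.1, Circle.exp u.2) := by
    have h2 := isLocalHomeomorph_circleExp
    refine IsLocalHomeomorph.mk _ fun u => ?_
    refine ⟨(OpenPartialHomeomorph.refl ℍ).prod (h2.localInverseAt u.2).symm, ?_, ?_⟩
    · simp
    · rintro v -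
      simp
  exact D.isQuotientCoveringMap_mk.isCoveringMap.isLocalHomeomorph.comp
    (D.homeo.symm.isLocalHomeomorph.comp h1)

instance : T2Space D.M := t2Space_of_properlyDiscontinuousSMul_of_t2Space

theorem isOrientableThreeManifold : IsOrientableThreeManifold D.M := by
  have : SecondCountableTopology D.M := ContinuousConstSMul.secondCountableTopology
  exact isOrientableThreeManifold_of_isLocalHomeomorph D.isLocalHomeomorph_cylinder
    D.surjective_cylinder isOpenEmbedding_cylinderEmb D.cylinder_transition

instance : LocallyPathConnectedSpace D.M := by
  have : LocallyPathConnectedSpace (ℍ × ℝ) :=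
    (upperHalfPlaneHomeoComplex.prodCongr (Homeomorph.refl ℝ)).isOpenEmbedding.locallyPathConnectedSpace
  exact (D.isLocalHomeomorph_cylinder.isOpenMap.isQuotientMap
    D.isLocalHomeomorph_cylinder.continuous D.surjective_cylinder).locallyPathConnectedSpace

theorem isLocalHomeomorph_projStar : IsLocalHomeomorph D.projStar := by
  have h1 : IsLocalHomeomorph (fun x : D.AdSStar => (⟦x.1⟧ : D.M)) :=
    D.isQuotientCoveringMap_mk.isCoveringMap.isLocalHomeomorph.comp
      D.isClosed_L.isOpen_compl.isOpenEmbedding_subtypeVal.isLocalHomeomorph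
  have h2 : IsLocalHomeomorph (Subtype.val : D.MStar → D.M) :=
    D.isClosed_LQuot.isOpen_compl.isOpenEmbedding_subtypeVal.isLocalHomeomorph
  exact IsLocalHomeomorph.of_comp (g := Subtype.val) h1 h2 (Continuous.subtype_mk h1.continuous _)

theorem isAdSUniformization_projStar (hlt : PullbackLT D.f D.h) :
    IsAdSUniformization D.projStar D.inclStar where
  isLocalHomeomorph_proj := D.isLocalHomeomorph_projStar
  surjective := D.surjective_projStar
  isLocalHomeomorph_dev := D.isLocalHomeomorph_inclStar hlt
  deck x y hxy := by
    obtain ⟨γ, hγ⟩ := MulAction.orbitRel_apply.mp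
      (Quotient.exact (congrArg Subtype.val hxy).symm)
    refine ⟨(D.j γ, D.ρ γ), fun z => ⟨γ • z.1, fun hz => z.2 (D.C_of_smul (γ := γ) hz)⟩, ?_,
      Subtype.ext hγ, Eventually.of_forall fun z => ?_, Eventually.of_forall fun z => rfl⟩
    · exact (Continuous.subtype_mk
        ((continuous_const_smul γ).comp continuous_subtype_val) _).continuousAt
    · exact Subtype.ext (Quotient.sound (MulAction.orbitRel_apply.mpr ⟨γ, rfl⟩))

end EquivariantPair

/-! ## Contraction near a branch point -/

/-- The coordinate of the disc model centred at `q`. -/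
def discCoord (q w : ℂ) : ℂ := (w - q) / (w - (starRingEnd ℂ) q)

theorem sub_conj_ne_zero (q w : ℍ) : (w : ℂ) - (starRingEnd ℂ) (q : ℂ) ≠ 0 := by
  intro h
  have h1 := congrArg Complex.im h
  simp at h1
  linarith [q.im_pos, w.im_pos]

theorem discCoord_self (q : ℂ) : discCoord q q = 0 := by simp [discCoord]

theorem discCoord_eq_zero_iff {q w : ℍ} : discCoord q w = 0 ↔ w = q := by
  rw [discCoord, div_eq_zero_iff, or_iff_left (sub_conj_ne_zero q w), sub_eq_zero,
    ← UpperHalfPlane.ext_iff]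

theorem one_sub_norm_discCoord_sq (q w : ℍ) : 1 - ‖discCoord q w‖ ^ 2 =
    4 * q.im * w.im / ‖(w : ℂ) - (starRingEnd ℂ) (q : ℂ)‖ ^ 2 := by
  have h1 : ‖(w : ℂ) - (starRingEnd ℂ) (q : ℂ)‖ ^ 2 ≠ 0 :=
    pow_ne_zero _ (norm_ne_zero_iff.mpr (sub_conj_ne_zero q w))
  rw [discCoord, norm_div, div_pow, eq_div_iff h1, sub_mul, div_mul_cancel₀ _ h1]
  rw [← Complex.normSq_eq_norm_sq, ← Complex.normSq_eq_norm_sq, Complex.normSq_apply,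
    Complex.normSq_apply]
  simp
  ring

theorem norm_discCoord_lt_one (q w : ℍ) : ‖discCoord q w‖ < 1 := by
  have h1 := one_sub_norm_discCoord_sq q w
  have h2 : 0 < 4 * q.im * w.im / ‖(w : ℂ) - (starRingEnd ℂ) (q : ℂ)‖ ^ 2 := by
    have := q.im_pos
    have := w.im_pos
    have := norm_pos_iff.mpr (sub_conj_ne_zero q w)
    positivity
  have h3 := norm_nonneg (discCoord q w)
  nlinarith

theorem hasDerivAt_discCoord (q w : ℍ) : HasDerivAt (discCoord q)
    (((q : ℂ) - (starRingEnd ℂ) (q : ℂ)) / ((w : ℂ) - (starRingEnd ℂ) (q : ℂ)) ^ 2) w := by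
  have h1 := ((hasDerivAt_id (w : ℂ)).sub_const (q : ℂ)).div
    ((hasDerivAt_id (w : ℂ)).sub_const ((starRingEnd ℂ) (q : ℂ))) (sub_conj_ne_zero q w)
  refine h1.congr_deriv ?_
  simp

/-- The map `φ` in the disc coordinate centred at `q`. -/
def discMap (φ : ℍ → ℍ) (q : ℍ) (z : ℂ) : ℂ := discCoord q (toPlane φ z)

theorem discMap_coe (φ : ℍ → ℍ) (q z : ℍ) : discMap φ q z = discCoord q (φ z) := by
  rw [discMap, toPlane_coe]

theorem norm_discMap_lt_one (φ : ℍ → ℍ) (q : ℍ) (z : ℂ) : ‖discMap φ q z‖ < 1 :=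
  norm_discCoord_lt_one q (φ (UpperHalfPlane.ofComplex z))

/-- The last identity says that the disc coordinate is an isometry onto the disc with metric 4|dw|²
/ (1 - |w|²)². -/
theorem exists_hasFDerivAt_discMap {φ : ℍ → ℍ} (hφ : IsC1 φ) (q z : ℍ) :
    ∃ c : ℂ, c ≠ 0 ∧ HasFDerivAt (discMap φ q) (c • hDeriv φ z) (z : ℂ) ∧
      ‖c‖ * (2 * (φ z).im) = 1 - ‖discMap φ q z‖ ^ 2 := by
  refine ⟨((q : ℂ) - (starRingEnd ℂ) (q : ℂ)) / ((φ z : ℂ) - (starRingEnd ℂ) (q : ℂ)) ^ 2,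
    div_ne_zero (sub_conj_ne_zero q q) (pow_ne_zero _ (sub_conj_ne_zero q (φ z))), ?_, ?_⟩
  · have h1 := hasDerivAt_discCoord q (φ z)
    rw [← toPlane_coe φ z] at h1 ⊢
    exact h1.comp_hasFDerivAt (z : ℂ) (hasFDerivAt_toPlane hφ z)
  · rw [discMap_coe, one_sub_norm_discCoord_sq, norm_div, norm_pow]
    have h2 : ‖(q : ℂ) - (starRingEnd ℂ) (q : ℂ)‖ = 2 * q.im := by
      rw [Complex.sub_conj, norm_mul, Complex.norm_I, mul_one]
      rw [Complex.norm_real, Real.norm_eq_abs, abs_of_pos]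
      · simp
      · have := q.im_pos
        simpa
    rw [h2]
    ring

theorem continuousAt_discMap {φ : ℍ → ℍ} (hφ : IsC1 φ) (q z : ℍ) :
    ContinuousAt (discMap φ q) (z : ℂ) := by
  obtain ⟨c, -, h, -⟩ := exists_hasFDerivAt_discMap hφ q z
  exact h.continuousAt

/-- The hyperbolic distance to the origin in the disc model, as a function of the square of the
Euclidean distance. -/
def hypRadius (P : ℝ) : ℝ := Real.log (1 + √P) - Real.log (1 - √P)

/-- The radius 2 artanh x has x-derivative 2 / (1 - x²); division by 2x gives the derivative in x².
The squared norm is used because it is differentiable with an inner product as derivative. -/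
theorem hasDerivAt_hypRadius {x : ℝ} (h0 : 0 < x) (h1 : x < 1) :
    HasDerivAt hypRadius (1 / (x * (1 - x ^ 2))) (x ^ 2) := by
  have hx : √(x ^ 2) = x := Real.sqrt_sq h0.le
  have h2 : HasDerivAt (fun P : ℝ => √P) (1 / (2 * x)) (x ^ 2) := by
    have := Real.hasDerivAt_sqrt (pow_pos h0 2).ne'
    rwa [hx] at this
  have h3 := (h2.const_add 1).log (by rw [hx]; linarith)
  have h4 := (h2.const_sub 1).log (by rw [hx]; linarith)
  refine (h3.sub h4).congr_deriv ?_
  rw [hx]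
  have : 1 - x ≠ 0 := by linarith
  have : 1 + x ≠ 0 := by linarith
  have : 1 - x ^ 2 ≠ 0 := by
    have : 1 - x ^ 2 = (1 - x) * (1 + x) := by ring
    rw [this]
    positivity
  field_simp
  ring

theorem hypRadius_lt {x y : ℝ} (hx : 0 ≤ x) (hxy : x < y) (hy : y < 1) :
    hypRadius (x ^ 2) < hypRadius (y ^ 2) := by
  rw [hypRadius, hypRadius, Real.sqrt_sq hx, Real.sqrt_sq (hx.trans hxy.le)]
  have h1 : Real.log (1 + x) < Real.log (1 + y) := Real.log_lt_log (by linarith) (by linarith)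
  have h2 : Real.log (1 - y) < Real.log (1 - x) := Real.log_lt_log (by linarith) (by linarith)
  linarith

theorem hypRadius_le {x y : ℝ} (hx : 0 ≤ x) (hxy : x ≤ y) (hy : y < 1) :
    hypRadius (x ^ 2) ≤ hypRadius (y ^ 2) := by
  rcases hxy.eq_or_lt with rfl | h
  · exact le_rfl
  · exact (hypRadius_lt hx h hy).le

theorem eventually_lt_of_hasDerivAt_neg {g : ℝ → ℝ} {d : ℝ} (hg : HasDerivAt g d 0) (hd : d < 0) :
    ∀ᶠ s in 𝓝[>] (0 : ℝ), g s < g 0 := by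
  have h1 := (hasDerivAt_iff_tendsto_slope.mp hg).mono_left
    (nhdsWithin_mono 0 (fun s (hs : s ∈ Ioi (0 : ℝ)) => (ne_of_gt hs : s ∈ ({0}ᶜ : Set ℝ))))
  filter_upwards [h1.eventually (gt_mem_nhds hd), self_mem_nhdsWithin] with s hs hs0
  rw [slope_def_field, sub_zero, div_lt_iff₀ hs0, zero_mul] at hs
  linarith

/-- The difference of the hyperbolic distances of `f z` to `q` and of `h z` to `q'`. -/
def radiusDiff (f h : ℍ → ℍ) (q q' : ℍ) (z : ℂ) : ℝ :=
  hypRadius (‖discMap f q z‖ ^ 2) - hypRadius (‖discMap h q' z‖ ^ 2)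

/-- Move so that h(z) runs along the geodesic ray towards q'. The distance of h(z) to q' then
decreases at the full speed of h, whereas that of f(z) to q decreases at most at the speed of f,
which is strictly smaller. -/
theorem exists_direction {f h : ℍ → ℍ} (hf : IsC1 f) (hh : IsC1 h) {q q' z : ℍ}
    (hinj : Function.Injective (hDeriv h z))
    (hlt : ∀ v : ℂ, v ≠ 0 → pullbackMetric f z v < pullbackMetric h z v)
    (hne : h z ≠ q') (hr : 0 ≤ radiusDiff f h q q' z) :
    ∃ v : ℂ, ∀ᶠ s : ℝ in 𝓝[>] 0, ‖discMap h q' (z + s * v)‖ < ‖discMap h q' z‖ ∧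
      radiusDiff f h q q' z < radiusDiff f h q q' (z + s * v) := by
  obtain ⟨c, hc, hF, hcF⟩ := exists_hasFDerivAt_discMap hf q z
  obtain ⟨c', hc', hH, hcH⟩ := exists_hasFDerivAt_discMap hh q' z
  set F := discMap f q with hFdef
  set H := discMap h q' with hHdef
  have hH0 : H z ≠ 0 := by
    rw [hHdef, discMap_coe]
    exact fun h0 => hne (discCoord_eq_zero_iff.mp h0)
  obtain ⟨e, he⟩ := ContinuousLinearMap.isInvertible_of_injective (T := hDeriv h z)
    fun v hv => hinj (by rw [hv, map_zero])
  -- The vector v is chosen so that the derivative of H along v is -H(z); Dh is invertible here.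
  obtain ⟨v, hv⟩ := e.surjective (-(H z) / c')
  have hv' : hDeriv h z v = -(H z) / c' := by rw [← he]; exact hv
  have hv0 : v ≠ 0 := by
    rintro rfl
    rw [map_zero] at hv'
    exact div_ne_zero (neg_ne_zero.mpr hH0) hc' hv'.symm
  have hDH : c' * hDeriv h z v = -(H z) := by rw [hv']; field_simp
  have hline : HasDerivAt (fun s : ℝ => (z : ℂ) + s * v) v 0 := by
    have := ((Complex.ofRealCLM.hasDerivAt (x := (0 : ℝ))).mul_const v).const_add (z : ℂ)
    simpa using this
  have hz0 : (z : ℂ) + ((0 : ℝ) : ℂ) * v = z := by simp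
  have h1 : HasDerivAt (fun s : ℝ => F (z + s * v)) (c * hDeriv f z v) 0 := by
    have h2 : HasFDerivAt F (c • hDeriv f z) ((z : ℂ) + ((0 : ℝ) : ℂ) * v) := by rw [hz0]; exact hF
    exact h2.comp_hasDerivAt (0 : ℝ) hline
  have h2 : HasDerivAt (fun s : ℝ => H (z + s * v)) (-(H z)) 0 := by
    have h3 : HasFDerivAt H (c' • hDeriv h z) ((z : ℂ) + ((0 : ℝ) : ℂ) * v) := by rw [hz0]; exact hH
    have h4 := h3.comp_hasDerivAt (0 : ℝ) hline
    rw [← hDH]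
    exact h4
  have h3 := h1.norm_sq
  have h4 := h2.norm_sq
  rw [hz0] at h3 h4
  set x := ‖F z‖ with hx
  set y := ‖H z‖ with hy
  have hy0 : 0 < y := norm_pos_iff.mpr hH0
  have hy1 : y < 1 := norm_discMap_lt_one h q' z
  have hx1 : x < 1 := norm_discMap_lt_one f q z
  -- If F(z) were zero, the difference of the radii would be negative. The radius of F is thus
  -- differentiable at z.
  have hx0 : 0 < x := by
    by_contra hx0
    have hx0' : x = 0 := le_antisymm (not_lt.mp hx0) (norm_nonneg _)
    have h5 := hypRadius_lt le_rfl hy0 hy1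
    rw [radiusDiff, ← hFdef, ← hHdef, ← hx, ← hy, hx0'] at hr
    linarith
  have h5 : HasDerivAt (fun s : ℝ => hypRadius (‖F (z + s * v)‖ ^ 2)) _ 0 :=
    HasDerivAt.comp (h₂ := hypRadius) (0 : ℝ) (by rw [hz0]; exact hasDerivAt_hypRadius hx0 hx1) h3
  have h6 : HasDerivAt (fun s : ℝ => hypRadius (‖H (z + s * v)‖ ^ 2)) _ 0 :=
    HasDerivAt.comp (h₂ := hypRadius) (0 : ℝ) (by rw [hz0]; exact hasDerivAt_hypRadius hy0 hy1) h4
  have hx2 : 0 < 1 - x ^ 2 := by nlinarith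
  have hy2 : 0 < 1 - y ^ 2 := by nlinarith
  -- The inequality of pullback metrics on v in disc coordinates; the factor 1/2 common to both
  -- sides comes from the normalization of the disc metric.
  have hspeed : ‖c * hDeriv f z v‖ / (1 - x ^ 2) < y / (1 - y ^ 2) := by
    have h7 := hlt v hv0
    rw [pullbackMetric, pullbackMetric, ← div_pow, ← div_pow] at h7
    have hhim := (h z).im_pos
    have hfim := (f z).im_pos
    have h8 := lt_of_pow_lt_pow_left₀ 2 (by positivity) h7
    have h9 : y = ‖c'‖ * ‖hDeriv h z v‖ := by rw [← norm_mul, hDH, norm_neg]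
    have hcp := norm_pos_iff.mpr hc
    have hcp' := norm_pos_iff.mpr hc'
    rw [← hcF, ← hcH, norm_mul]
    nth_rw 1 [h9]
    have e1 : ‖c‖ * ‖hDeriv f z v‖ / (‖c‖ * (2 * (f z).im)) =
        ‖hDeriv f z v‖ / (f z).im / 2 := by field_simp
    have e2 : ‖c'‖ * ‖hDeriv h z v‖ / (‖c'‖ * (2 * (h z).im)) =
        ‖hDeriv h z v‖ / (h z).im / 2 := by field_simp
    rw [e1, e2]
    linarith
  have hin : inner ℝ (H z) (-(H z)) = -y ^ 2 := by
    rw [inner_neg_right, real_inner_self_eq_norm_sq]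
  -- By Cauchy–Schwarz the radius of F decreases no faster than F moves.
  have hin' : -(x * ‖c * hDeriv f z v‖) ≤ inner ℝ (F z) (c * hDeriv f z v) :=
    neg_le_of_abs_le (abs_real_inner_le_norm _ _)
  have hd1 : (2 * inner ℝ (H z) (-(H z)) : ℝ) < 0 := by
    rw [hin]
    nlinarith
  refine ⟨v, ?_⟩
  have e1 := eventually_lt_of_hasDerivAt_neg h4 hd1
  have e2 := eventually_lt_of_hasDerivAt_neg (h6.sub h5) (by
    rw [hin]
    have h7 : 1 / (x * (1 - x ^ 2)) * (2 * inner ℝ (F z) (c * hDeriv f z v)) ≥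
        -(2 * (‖c * hDeriv f z v‖ / (1 - x ^ 2))) := by
      have h8 : -(2 * (‖c * hDeriv f z v‖ / (1 - x ^ 2))) =
          1 / (x * (1 - x ^ 2)) * (2 * -(x * ‖c * hDeriv f z v‖)) := by
        field_simp
      rw [h8]
      have : 0 < 1 / (x * (1 - x ^ 2)) := by positivity
      exact mul_le_mul_of_nonneg_left (by linarith) this.le
    have h9 : 1 / (y * (1 - y ^ 2)) * (2 * -y ^ 2) = -(2 * (y / (1 - y ^ 2))) := by
      field_simp
    rw [h9]
    linarith)
  filter_upwards [e1, e2] with s hs1 hs2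
  constructor
  · simp only [hz0] at hs1
    exact lt_of_pow_lt_pow_left₀ 2 (norm_nonneg _) hs1
  · simp only [Pi.sub_apply, hz0] at hs2
    rw [radiusDiff, radiusDiff]
    linarith

/-- Infinitesimal contraction cannot simply be integrated along rays, since h is not invertible at
p. Instead the difference of the radii is maximized over a compact sublevel set of |H|: by
`exists_direction` a nonnegative maximum can only be at p, where the difference is zero. -/
theorem norm_discMap_lt_of_isolated {f h : ℍ → ℍ} (hf : IsC1 f) (hh : IsC1 h) {p : ℍ}
    (hp : ∀ᶠ z : ℍ in 𝓝 p, z ≠ p → h z ≠ h p ∧ Function.Injective (hDeriv h z) ∧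
      ∀ v : ℂ, v ≠ 0 → pullbackMetric f z v < pullbackMetric h z v) :
    ∀ᶠ z : ℂ in 𝓝 (p : ℂ), z ≠ p → ‖discMap f (f p) z‖ < ‖discMap h (h p) z‖ := by
  have hp' : ∀ᶠ z : ℂ in 𝓝 (p : ℂ), ∃ w : ℍ, (w : ℂ) = z ∧ (w ≠ p → h w ≠ h p ∧
      Function.Injective (hDeriv h w) ∧
      ∀ v : ℂ, v ≠ 0 → pullbackMetric f w v < pullbackMetric h w v) := by
    have h1 := UpperHalfPlane.isOpenEmbedding_coe.isOpenMap.image_mem_nhds hp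
    filter_upwards [h1] with z hz
    obtain ⟨w, hw, hwz⟩ := hz
    exact ⟨w, hwz, hw⟩
  obtain ⟨R, hR, hball⟩ := Metric.nhds_basis_closedBall.mem_iff.mp hp'
  set F := discMap f (f p) with hFdef
  set H := discMap h (h p) with hHdef
  have hcF : ContinuousOn F (Metric.closedBall (p : ℂ) R) := by
    intro z hz
    obtain ⟨w, rfl, -⟩ := hball hz
    exact (continuousAt_discMap hf _ w).continuousWithinAt
  have hcH : ContinuousOn H (Metric.closedBall (p : ℂ) R) := by
    intro z hz
    obtain ⟨w, rfl, -⟩ := hball hz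
    exact (continuousAt_discMap hh _ w).continuousWithinAt
  have hHne : ∀ z ∈ Metric.closedBall (p : ℂ) R, z ≠ p → H z ≠ 0 := by
    intro z hz hzp h0
    obtain ⟨w, rfl, hw⟩ := hball hz
    rw [hHdef, discMap_coe] at h0
    exact (hw (fun h => hzp (by rw [h]))).1 (discCoord_eq_zero_iff.mp h0)
  have hHp : H p = 0 := by rw [hHdef, discMap_coe, discCoord_self]
  have hFp : F p = 0 := by rw [hFdef, discMap_coe, discCoord_self]
  -- The minimum ε of |H| on the sphere is positive. Hence the set where |H| ≤ ε/2 avoids the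
  -- sphere, and a short step that decreases |H| stays in K.
  obtain ⟨z₂, hz₂, hmin⟩ := (isCompact_sphere (p : ℂ) R).exists_isMinOn
    (NormedSpace.sphere_nonempty.mpr hR.le) ((hcH.mono Metric.sphere_subset_closedBall).norm)
  have hz₂p : z₂ ≠ p := by
    rintro rfl
    rw [Metric.mem_sphere, dist_self] at hz₂
    exact hR.ne hz₂
  set ε := ‖H z₂‖ with hε
  have hε0 : 0 < ε := norm_pos_iff.mpr (hHne z₂ (Metric.sphere_subset_closedBall hz₂) hz₂p)
  set K := Metric.closedBall (p : ℂ) R ∩ (fun z => ‖H z‖) ⁻¹' Iic (ε / 2) with hK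
  have hKc : IsCompact K :=
    (isCompact_closedBall (p : ℂ) R).of_isClosed_subset
      (hcH.norm.preimage_isClosed_of_isClosed Metric.isClosed_closedBall isClosed_Iic)
      inter_subset_left
  have hcr : ∀ {φ : ℂ → ℂ}, (∀ z, ‖φ z‖ < 1) → ContinuousOn φ K →
      ContinuousOn (fun z => hypRadius (‖φ z‖ ^ 2)) K := by
    intro φ h1 h2
    have h3 : (fun z => hypRadius (‖φ z‖ ^ 2)) =
        fun z => Real.log (1 + ‖φ z‖) - Real.log (1 - ‖φ z‖) := by
      funext z
      rw [hypRadius, Real.sqrt_sq (norm_nonneg _)]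
    rw [h3]
    refine ((continuousOn_const.add h2.norm).log fun z _ => ?_).sub
      ((continuousOn_const.sub h2.norm).log fun z _ => ?_)
    · change 1 + ‖φ z‖ ≠ 0
      positivity
    · change 1 - ‖φ z‖ ≠ 0
      exact (sub_pos.mpr (h1 z)).ne'
  have hGc : ContinuousOn (radiusDiff f h (f p) (h p)) K :=
    (hcr (norm_discMap_lt_one f (f p)) (hcF.mono inter_subset_left)).sub
      (hcr (norm_discMap_lt_one h (h p)) (hcH.mono inter_subset_left))
  have hpK : (p : ℂ) ∈ K := by
    refine ⟨Metric.mem_closedBall_self hR.le, ?_⟩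
    simp only [mem_preimage, hHp, norm_zero, mem_Iic]
    positivity
  have hGp : radiusDiff f h (f p) (h p) p = 0 := by
    rw [radiusDiff, ← hFdef, ← hHdef, hFp, hHp, sub_self]
  have key : ∀ z ∈ K, z ≠ p → 0 ≤ radiusDiff f h (f p) (h p) z →
      ¬ IsMaxOn (radiusDiff f h (f p) (h p)) K z := by
    intro z hz hzp hr hmax
    obtain ⟨w, rfl, hw⟩ := hball hz.1
    obtain ⟨hw1, hw2, hw3⟩ := hw (fun h => hzp (by rw [h]))
    obtain ⟨v, hv⟩ := exists_direction hf hh (q := f p) hw2 hw3 hw1 hr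
    have hwb : (w : ℂ) ∈ Metric.ball (p : ℂ) R := by
      rcases (Metric.mem_closedBall.mp hz.1).lt_or_eq with h | h
      · exact h
      · have h1 : ε ≤ ‖H w‖ := hmin (Metric.mem_sphere.mpr h)
        have h2 : ‖H w‖ ≤ ε / 2 := hz.2
        linarith
    have ht : Tendsto (fun s : ℝ => (w : ℂ) + s * v) (𝓝[>] 0) (𝓝 w) := by
      have h1 : Continuous fun s : ℝ => (w : ℂ) + s * v := by fun_prop
      have h2 := (h1.tendsto 0).mono_left (nhdsWithin_le_nhds (s := Ioi 0))
      simpa using h2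
    obtain ⟨s, ⟨hs1, hs2⟩, hs3⟩ := (hv.and (ht.eventually (Metric.isOpen_ball.mem_nhds hwb))).exists
    have hsK : (w : ℂ) + s * v ∈ K :=
      ⟨Metric.ball_subset_closedBall hs3, hs1.le.trans hz.2⟩
    exact absurd (hmax hsK) (not_le.mpr hs2)
  have hneg : ∀ z ∈ K, z ≠ p → radiusDiff f h (f p) (h p) z < 0 := by
    intro z hz hzp
    by_contra hr
    rw [not_lt] at hr
    obtain ⟨z₁, hz₁, hmax⟩ := hKc.exists_isMaxOn ⟨p, hpK⟩ hGc
    -- If the maximum is at p, its value is zero, and the given z with nonnegative difference is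
    -- itself a maximum different from p.
    by_cases h1 : z₁ = p
    · rw [h1] at hmax
      exact key z hz hzp hr fun z' hz' => ((hmax hz').trans hGp.le).trans hr
    · exact key z₁ hz₁ h1 (hr.trans (hmax hz)) hmax
  have hHt : ∀ᶠ z in 𝓝 (p : ℂ), ‖H z‖ < ε / 2 := by
    have h1 : Tendsto (fun z => ‖H z‖) (𝓝 (p : ℂ)) (𝓝 ‖H p‖) :=
      (continuousAt_discMap hh (h p) p).norm
    rw [hHp, norm_zero] at h1
    exact h1.eventually (gt_mem_nhds (by positivity))
  filter_upwards [hHt, Metric.closedBall_mem_nhds (p : ℂ) hR] with z hz1 hz2 hzp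
  by_contra hle
  rw [not_lt] at hle
  have h1 := hneg z ⟨hz2, hz1.le⟩ hzp
  have h2 := hypRadius_le (norm_nonneg _) hle (norm_discMap_lt_one f (f p) z)
  rw [radiusDiff] at h1
  linarith

/-! ## Cylindrical coordinates of `AdS³` -/

namespace SL2R

open ComplexConjugate

/-- The diagonal entry of a matrix in the `SU(1, 1)` model. -/
def alpha (g : SL2R) : ℂ := ⟨(g 0 0 + g 1 1) / 2, (g 0 1 - g 1 0) / 2⟩

/-- The off-diagonal entry of a matrix in the `SU(1, 1)` model. -/
def beta (g : SL2R) : ℂ := ⟨(g 0 0 - g 1 1) / 2, -(g 0 1 + g 1 0) / 2⟩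

theorem normSq_alpha_sub_normSq_beta (g : SL2R) :
    Complex.normSq (alpha g) - Complex.normSq (beta g) = 1 := by
  have h := det_eq g
  simp only [alpha, beta, Complex.normSq_mk]
  linarith

theorem alpha_ne_zero (g : SL2R) : alpha g ≠ 0 := by
  intro h
  have h1 := normSq_alpha_sub_normSq_beta g
  rw [h, map_zero] at h1
  linarith [Complex.normSq_nonneg (beta g)]

/-- The Cayley transform turns g into the SU(1,1) matrix with rows (α, β) and (conj β, conj α); this
and `beta_mul` are its multiplication rules. -/
theorem alpha_mul (g k : SL2R) : alpha (g * k) = alpha g * alpha k + beta g * conj (beta k) := by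
  apply Complex.ext <;>
    simp [alpha, beta, Matrix.SpecialLinearGroup.coe_mul, Matrix.mul_apply, Fin.sum_univ_two] <;>
    ring

theorem beta_mul (g k : SL2R) : beta (g * k) = alpha g * beta k + beta g * conj (alpha k) := by
  apply Complex.ext <;>
    simp [alpha, beta, Matrix.SpecialLinearGroup.coe_mul, Matrix.mul_apply, Fin.sum_univ_two] <;>
    ring

/-- Together with `num_add_I_den`: on u = (w - i)/(w + i) the matrix acts by (α u + β) / (conj(β) u
+ conj(α)). -/
theorem num_sub_I_den (g : SL2R) (w : ℂ) : num g w - Complex.I * den g w =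
    alpha g * (w - Complex.I) + beta g * (w + Complex.I) := by
  apply Complex.ext <;> simp [alpha, beta, num, den] <;> ring

theorem num_add_I_den (g : SL2R) (w : ℂ) : num g w + Complex.I * den g w =
    conj (beta g) * (w - Complex.I) + conj (alpha g) * (w + Complex.I) := by
  apply Complex.ext <;> simp [alpha, beta, num, den] <;> ring

theorem entries_of_alpha_beta (g : SL2R) :
    g 0 0 = (alpha g).re + (beta g).re ∧ g 1 1 = (alpha g).re - (beta g).re ∧
    g 0 1 = (alpha g).im - (beta g).im ∧ g 1 0 = -(alpha g).im - (beta g).im := by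
  refine ⟨?_, ?_, ?_, ?_⟩ <;> simp only [alpha, beta] <;> ring

theorem mk_eq_mk_of_smul_entries {g k : SL2R} {s : ℝ} (hs : s ≠ 0)
    (h : ∀ i j, k i j = s * g i j) : PSL2R.mk g = PSL2R.mk k := by
  have hs' : (s : ℂ) ≠ 0 := by exact_mod_cast hs
  have hn : num k UpperHalfPlane.I = s * num g UpperHalfPlane.I := by
    simp only [num, h]; push_cast; ring
  have hd : den k UpperHalfPlane.I = s * den g UpperHalfPlane.I := by
    simp only [den, h]; push_cast; ring
  refine PSL2R.ext_of_smul_ang (w := UpperHalfPlane.I) ?_ ?_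
  · change g • UpperHalfPlane.I = k • UpperHalfPlane.I
    rw [UpperHalfPlane.ext_iff, coe_smul, coe_smul, hn, hd, mul_div_mul_left _ _ hs']
  · apply Circle.ext
    rw [PSL2R.ang_mk, PSL2R.ang_mk, coe_ang, coe_ang, hd, map_mul, Complex.conj_ofReal,
      mul_div_mul_left _ _ hs']

/-- The products αβ and conj(α)β are unchanged under g ↦ -g, and they determine g up to this sign:
they make the quotient of the two α a real number s, and the determinants force s² = 1. -/
theorem mk_eq_mk_of_alpha_beta {g k : SL2R} (hb : beta g ≠ 0)
    (h1 : alpha g * beta g = alpha k * beta k)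
    (h2 : conj (alpha g) * beta g = conj (alpha k) * beta k) : PSL2R.mk g = PSL2R.mk k := by
  have ha := alpha_ne_zero k
  have ha' : conj (alpha k) ≠ 0 := (map_ne_zero _).mpr ha
  have hs : conj (alpha g / alpha k) = alpha g / alpha k := by
    rw [map_div₀, div_eq_div_iff ha' ha]
    refine mul_right_cancel₀ hb (mul_right_cancel₀ (b := beta k) ?_ ?_)
    · intro h0
      rw [h0, mul_zero] at h1
      exact mul_ne_zero (alpha_ne_zero g) hb h1
    · linear_combination (alpha k * beta k) * h2 - (conj (alpha k) * beta k) * h1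
  obtain ⟨s, hs'⟩ := Complex.conj_eq_iff_real.mp hs
  have hag : alpha g = s * alpha k := by rw [← hs', div_mul_cancel₀ _ ha]
  have hbk : beta k = s * beta g := by
    refine mul_left_cancel₀ ha ?_
    rw [← h1, hag]; ring
  have e1 := normSq_alpha_sub_normSq_beta g
  have e2 := normSq_alpha_sub_normSq_beta k
  rw [hag, map_mul, Complex.normSq_ofReal] at e1
  rw [hbk, map_mul, Complex.normSq_ofReal] at e2
  have hB := Complex.normSq_nonneg (beta g)
  have hA := Complex.normSq_nonneg (alpha k)
  -- The two determinant equations read s²A - B = 1 and A - s²B = 1 with A = |α(k)|² and B =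
  -- |β(g)|²; their difference is (1 - s²)(A + B) = 0.
  have hss : s * s = 1 := by
    have h3 : (1 - s * s) * (Complex.normSq (beta g) + Complex.normSq (alpha k)) = 0 := by
      linear_combination e2 - e1
    rcases mul_eq_zero.mp h3 with h4 | h4
    · linarith
    · exfalso
      have h5 : Complex.normSq (beta g) = 0 := by linarith
      exact hb (Complex.normSq_eq_zero.mp h5)
  have hs0 : s ≠ 0 := by rintro rfl; simp at hss
  have hak : alpha k = s * alpha g := by
    have : ((s * s : ℝ) : ℂ) = 1 := by rw [hss]; simp
    push_cast at this
    rw [hag, ← mul_assoc, this, one_mul]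
  obtain ⟨a1, a2, a3, a4⟩ := entries_of_alpha_beta g
  obtain ⟨b1, b2, b3, b4⟩ := entries_of_alpha_beta k
  have r1 : (alpha k).re = s * (alpha g).re := by rw [hak, Complex.re_ofReal_mul]
  have r2 : (alpha k).im = s * (alpha g).im := by rw [hak, Complex.im_ofReal_mul]
  have r3 : (beta k).re = s * (beta g).re := by rw [hbk, Complex.re_ofReal_mul]
  have r4 : (beta k).im = s * (beta g).im := by rw [hbk, Complex.im_ofReal_mul]
  refine mk_eq_mk_of_smul_entries hs0 fun i j => ?_
  fin_cases i <;> fin_cases j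
  · change k 0 0 = s * g 0 0
    rw [b1, a1, r1, r3]; ring
  · change k 0 1 = s * g 0 1
    rw [b3, a3, r2, r4]; ring
  · change k 1 0 = s * g 1 0
    rw [b4, a4, r2, r4]; ring
  · change k 1 1 = s * g 1 1
    rw [b2, a2, r1, r3]; ring

/-- The matrix with given entries in the `SU(1, 1)` model. -/
def ofSU (a b : ℂ) (h : Complex.normSq a - Complex.normSq b = 1) : SL2R :=
  ⟨!![a.re + b.re, a.im - b.im; -a.im - b.im, a.re - b.re], by
    rw [Matrix.det_fin_two_of]
    rw [Complex.normSq_apply, Complex.normSq_apply] at h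
    linarith⟩

theorem alpha_ofSU (a b : ℂ) (h : Complex.normSq a - Complex.normSq b = 1) :
    alpha (ofSU a b h) = a := by
  apply Complex.ext <;> simp [alpha, ofSU]

theorem beta_ofSU (a b : ℂ) (h : Complex.normSq a - Complex.normSq b = 1) :
    beta (ofSU a b h) = b := by
  apply Complex.ext <;> simp [beta, ofSU]

end SL2R

/-- A matrix representing the hyperbolic translation `A(r)`. -/
def hypSL (r : ℝ) : SL2R :=
  ⟨!![Real.exp (r / 2), 0; 0, Real.exp (-(r / 2))], by
      rw [Matrix.det_fin_two_of, ← Real.exp_add]; simp⟩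

theorem adsCover_eq_mk (u : ℝ × ℝ × ℝ) :
    adsCover u = PSL2R.mk (rotSL u.2.1 * hypSL u.1 * rotSL (-u.2.2)) := rfl

theorem alpha_rotSL (θ : ℝ) : SL2R.alpha (rotSL θ) = Complex.exp ((θ / 2 : ℝ) * Complex.I) := by
  rw [Complex.exp_mul_I, ← Complex.ofReal_cos, ← Complex.ofReal_sin]
  apply Complex.ext <;> simp [SL2R.alpha, rotSL, -Complex.ofReal_cos, -Complex.ofReal_sin]

theorem beta_rotSL (θ : ℝ) : SL2R.beta (rotSL θ) = 0 := by
  apply Complex.ext <;> simp [SL2R.beta, rotSL]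

theorem alpha_hypSL (r : ℝ) : SL2R.alpha (hypSL r) = (Real.cosh (r / 2) : ℝ) := by
  apply Complex.ext <;> simp [SL2R.alpha, hypSL, Real.cosh_eq, -Complex.ofReal_cosh, -Complex.ofReal_exp,
      -Complex.ofReal_div, -Complex.ofReal_add, -Complex.ofReal_neg]

theorem beta_hypSL (r : ℝ) : SL2R.beta (hypSL r) = (Real.sinh (r / 2) : ℝ) := by
  apply Complex.ext <;> simp [SL2R.beta, hypSL, Real.sinh_eq, -Complex.ofReal_sinh, -Complex.ofReal_exp,
      -Complex.ofReal_div, -Complex.ofReal_sub, -Complex.ofReal_neg]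

theorem alpha_cover (r θ η : ℝ) : SL2R.alpha (rotSL θ * hypSL r * rotSL (-η)) =
    Complex.exp (((θ - η) / 2 : ℝ) * Complex.I) * (Real.cosh (r / 2) : ℝ) := by
  rw [SL2R.alpha_mul, SL2R.alpha_mul, beta_rotSL, beta_rotSL, alpha_rotSL, alpha_rotSL,
    alpha_hypSL]
  rw [map_zero, mul_zero, add_zero, zero_mul, add_zero, mul_right_comm, ← Complex.exp_add]
  congr 2
  push_cast
  ring

theorem beta_cover (r θ η : ℝ) : SL2R.beta (rotSL θ * hypSL r * rotSL (-η)) =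
    Complex.exp (((θ + η) / 2 : ℝ) * Complex.I) * (Real.sinh (r / 2) : ℝ) := by
  rw [SL2R.beta_mul, SL2R.beta_mul, beta_rotSL, beta_rotSL, alpha_rotSL, alpha_rotSL,
    beta_hypSL]
  rw [mul_zero, zero_add, zero_mul, add_zero, mul_right_comm, ← Complex.exp_conj, ← Complex.exp_add]
  congr 2
  simp only [map_mul, Complex.conj_ofReal, Complex.conj_I]
  push_cast
  ring

/-- With the next lemma, the angles θ and η are recovered as arguments of functions on PSL(2, ℝ),
and both products have norm (sinh r) / 2. This is what makes lifts to the universal cover explicit.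
-/
theorem alpha_mul_beta_cover (r θ η : ℝ) :
    SL2R.alpha (rotSL θ * hypSL r * rotSL (-η)) * SL2R.beta (rotSL θ * hypSL r * rotSL (-η)) =
      (Real.sinh r / 2 : ℝ) * Complex.exp (θ * Complex.I) := by
  have h : Real.sinh r = 2 * Real.sinh (r / 2) * Real.cosh (r / 2) := by
    rw [← Real.sinh_two_mul]; ring_nf
  rw [alpha_cover, beta_cover, mul_mul_mul_comm, ← Complex.exp_add, h, mul_comm]
  congr 1
  · push_cast; ring
  · congr 1; push_cast; ring

theorem conj_alpha_mul_beta_cover (r θ η : ℝ) :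
    (starRingEnd ℂ) (SL2R.alpha (rotSL θ * hypSL r * rotSL (-η))) *
      SL2R.beta (rotSL θ * hypSL r * rotSL (-η)) =
      (Real.sinh r / 2 : ℝ) * Complex.exp (η * Complex.I) := by
  have h : Real.sinh r = 2 * Real.sinh (r / 2) * Real.cosh (r / 2) := by
    rw [← Real.sinh_two_mul]; ring_nf
  rw [alpha_cover, beta_cover, map_mul, ← Complex.exp_conj, Complex.conj_ofReal,
    mul_mul_mul_comm, ← Complex.exp_add, h, mul_comm]
  congr 1
  · push_cast; ring
  · congr 1
    simp only [map_mul, Complex.conj_ofReal, Complex.conj_I]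
    push_cast; ring

/-- A point of `AdS³` in cylindrical coordinates, from its two entries in the `SU(1, 1)` model. -/
theorem adsCover_eq_mk_of_arg {g : SL2R} (hb : SL2R.beta g ≠ 0) {θ η : ℝ}
    (hθ : SL2R.alpha g * SL2R.beta g =
      ‖SL2R.alpha g * SL2R.beta g‖ * Complex.exp (θ * Complex.I))
    (hη : (starRingEnd ℂ) (SL2R.alpha g) * SL2R.beta g =
      ‖SL2R.alpha g * SL2R.beta g‖ * Complex.exp (η * Complex.I)) :
    adsCover (Real.arsinh (2 * ‖SL2R.alpha g * SL2R.beta g‖), θ, η) = PSL2R.mk g := by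
  rw [adsCover_eq_mk]
  symm
  apply SL2R.mk_eq_mk_of_alpha_beta hb
  · rw [alpha_mul_beta_cover, Real.sinh_arsinh, mul_div_cancel_left₀ _ two_ne_zero]
    exact hθ
  · rw [conj_alpha_mul_beta_cover, Real.sinh_arsinh, mul_div_cancel_left₀ _ two_ne_zero]
    exact hη

/-! ### The isometry of the disc with given value and angle, in cylindrical coordinates -/

section Cone

open ComplexConjugate

/-- The normalizing factor of `coneAlpha` and `coneBeta`. -/
def coneScale (H F : ℂ) : ℝ := (√((1 - ‖H‖ ^ 2) * (1 - ‖F‖ ^ 2)))⁻¹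

/-- The diagonal entry of the isometry of the disc that sends `F` to `H`, with angle `y`. -/
def coneAlpha (H F : ℂ) (y : ℝ) : ℂ := coneScale H F *
  (Complex.exp (-(y / 2 : ℝ) * Complex.I) - H * conj F * Complex.exp ((y / 2 : ℝ) * Complex.I))

/-- The off-diagonal entry of the isometry of the disc that sends `F` to `H`, with angle `y`. -/
def coneBeta (H F : ℂ) (y : ℝ) : ℂ := coneScale H F *
  (H * Complex.exp ((y / 2 : ℝ) * Complex.I) - F * Complex.exp (-(y / 2 : ℝ) * Complex.I))

theorem coneScale_pos {H F : ℂ} (hH : ‖H‖ < 1) (hF : ‖F‖ < 1) : 0 < coneScale H F := by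
  have h1 : 0 < 1 - ‖H‖ ^ 2 := by nlinarith [norm_nonneg H]
  have h2 : 0 < 1 - ‖F‖ ^ 2 := by nlinarith [norm_nonneg F]
  unfold coneScale
  positivity

theorem conj_exp_half (y : ℝ) : conj (Complex.exp ((y / 2 : ℝ) * Complex.I)) =
    Complex.exp (-(y / 2 : ℝ) * Complex.I) := by
  rw [← Complex.exp_conj, map_mul, Complex.conj_ofReal, Complex.conj_I]
  congr 1
  ring

theorem exp_half_mul (y : ℝ) : Complex.exp ((y / 2 : ℝ) * Complex.I) *
    Complex.exp (-(y / 2 : ℝ) * Complex.I) = 1 := by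
  rw [← Complex.exp_add]
  simp

theorem exp_half_sq (y : ℝ) : Complex.exp ((y / 2 : ℝ) * Complex.I) *
    Complex.exp ((y / 2 : ℝ) * Complex.I) = Complex.exp (y * Complex.I) := by
  rw [← Complex.exp_add]
  congr 1
  push_cast
  ring

theorem exp_neg_half_sq (y : ℝ) : Complex.exp (-(y / 2 : ℝ) * Complex.I) *
    Complex.exp (-(y / 2 : ℝ) * Complex.I) = Complex.exp (-y * Complex.I) := by
  rw [← Complex.exp_add]
  congr 1
  push_cast
  ring

/-- With E = e^{iy/2}, the numbers |conj(E) - H conj(F) E|² and |H E - F conj(E)|² differ by (1 -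
|H|²)(1 - |F|²), which `coneScale` normalizes to 1. -/
theorem cone_det {H F : ℂ} (hH : ‖H‖ < 1) (hF : ‖F‖ < 1) (y : ℝ) :
    Complex.normSq (coneAlpha H F y) - Complex.normSq (coneBeta H F y) = 1 := by
  have h1 : 0 < 1 - ‖H‖ ^ 2 := by nlinarith [norm_nonneg H]
  have h2 : 0 < 1 - ‖F‖ ^ 2 := by nlinarith [norm_nonneg F]
  have h3 : coneScale H F * coneScale H F * ((1 - ‖H‖ ^ 2) * (1 - ‖F‖ ^ 2)) = 1 := by
    have h4 : √((1 - ‖H‖ ^ 2) * (1 - ‖F‖ ^ 2)) ≠ 0 := (Real.sqrt_pos.mpr (mul_pos h1 h2)).ne'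
    rw [coneScale, ← mul_inv, Real.mul_self_sqrt (mul_pos h1 h2).le]
    exact inv_mul_cancel₀ (mul_pos h1 h2).ne'
  have hE := exp_half_mul y
  rw [← conj_exp_half, Complex.mul_conj] at hE
  have hE' : Complex.normSq (Complex.exp ((y / 2 : ℝ) * Complex.I)) = 1 := by exact_mod_cast hE
  rw [← Complex.normSq_eq_norm_sq, ← Complex.normSq_eq_norm_sq] at h3
  rw [coneAlpha, coneBeta, ← conj_exp_half, map_mul, map_mul, Complex.normSq_ofReal]
  generalize Complex.exp ((y / 2 : ℝ) * Complex.I) = E at hE'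
  rw [Complex.normSq_sub, Complex.normSq_sub]
  simp only [map_mul, Complex.normSq_conj, hE', Complex.conj_conj]
  -- The cross terms of the two expansions are equal and cancel.
  have h5 : (conj E * (conj H * F * conj E)).re = (H * E * (conj F * E)).re := by
    rw [← Complex.conj_re]
    congr 1
    simp only [map_mul, Complex.conj_conj]
    ring
  rw [h5]
  linear_combination h3

/-- The isometry of the disc that sends `F` to `H`, with angle `y`. -/
def coneSL {H F : ℂ} (hH : ‖H‖ < 1) (hF : ‖F‖ < 1) (y : ℝ) : SL2R :=
  SL2R.ofSU (coneAlpha H F y) (coneBeta H F y) (cone_det hH hF y)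

/-- Taking H out isolates the only factor of the product whose argument can wind; for |F| < |H| < 1
the other two lie in the disc of radius 1 about 1. In the conjugate version below, e^{iy} comes out
as well. -/
theorem coneAlpha_mul_coneBeta {H : ℂ} (F : ℂ) (hH : H ≠ 0) (y : ℝ) :
    coneAlpha H F y * coneBeta H F y = (coneScale H F * coneScale H F : ℝ) *
      (H * (1 - H * conj F * Complex.exp (y * Complex.I)) *
        (1 - F / H * Complex.exp (-y * Complex.I))) := by
  have h1 := exp_half_mul y
  have h2 := exp_half_sq y
  have h3 := exp_neg_half_sq y
  rw [coneAlpha, coneBeta, ← h2, ← h3]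
  clear h2 h3
  revert h1
  generalize Complex.exp ((y / 2 : ℝ) * Complex.I) = E
  generalize Complex.exp (-(y / 2 : ℝ) * Complex.I) = E'
  intro h1
  push_cast
  field_simp
  linear_combination (coneScale H F : ℂ) ^ 2 * (H - H * F * conj F * (E * E')) * h1

theorem conj_coneAlpha_mul_coneBeta {H : ℂ} (F : ℂ) (hH : H ≠ 0) (y : ℝ) :
    conj (coneAlpha H F y) * coneBeta H F y = (coneScale H F * coneScale H F : ℝ) *
      (H * Complex.exp (y * Complex.I) * (1 - conj H * F * Complex.exp (-y * Complex.I)) *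
        (1 - F / H * Complex.exp (-y * Complex.I))) := by
  have h1 := exp_half_mul y
  have h2 : conj (Complex.exp (-(y / 2 : ℝ) * Complex.I)) =
      Complex.exp ((y / 2 : ℝ) * Complex.I) := by
    rw [← conj_exp_half, Complex.conj_conj]
  have h3 := exp_half_sq y
  have h4 := exp_neg_half_sq y
  rw [coneAlpha, coneBeta, map_mul, map_sub, map_mul, map_mul, h2, conj_exp_half,
    Complex.conj_conj, Complex.conj_ofReal, ← h3, ← h4]
  clear h2 h3 h4
  revert h1
  generalize Complex.exp ((y / 2 : ℝ) * Complex.I) = E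
  generalize Complex.exp (-(y / 2 : ℝ) * Complex.I) = E'
  intro h1
  push_cast
  field_simp
  linear_combination (coneScale H F : ℂ) ^ 2 *
    (F * (E * E') * (1 + H * conj H) - conj H * F ^ 2 * E' ^ 2 * (E * E' + 1)) * h1

/-- The lift of the developing map to the universal cover of the complement of the axis. -/
def coneLift (H F l : ℂ) (y : ℝ) : ℝ × ℝ × ℝ :=
  (Real.arsinh (2 * ‖coneAlpha H F y * coneBeta H F y‖),
    l.im + Complex.arg (1 - H * conj F * Complex.exp (y * Complex.I)) +
      Complex.arg (1 - F / H * Complex.exp (-y * Complex.I)),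
    l.im + y + Complex.arg (1 - conj H * F * Complex.exp (-y * Complex.I)) +
      Complex.arg (1 - F / H * Complex.exp (-y * Complex.I)))

theorem norm_exp_neg_mul_I (y : ℝ) : ‖Complex.exp (-y * Complex.I)‖ = 1 := by
  have := Complex.norm_exp_ofReal_mul_I (-y)
  rwa [Complex.ofReal_neg] at this

theorem one_sub_mem_slitPlane {u : ℂ} (hu : ‖u‖ < 1) : 1 - u ∈ Complex.slitPlane := by
  left
  have := (Complex.re_le_norm u).trans_lt hu
  simp only [Complex.sub_re, Complex.one_re]
  linarith

theorem norm_cone_factors {H F : ℂ} (hFH : ‖F‖ < ‖H‖) (hH : ‖H‖ < 1) (y : ℝ) :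
    ‖H * conj F * Complex.exp (y * Complex.I)‖ < 1 ∧
    ‖F / H * Complex.exp (-y * Complex.I)‖ < 1 ∧
    ‖conj H * F * Complex.exp (-y * Complex.I)‖ < 1 := by
  have hH0 : 0 < ‖H‖ := (norm_nonneg F).trans_lt hFH
  rw [norm_mul, norm_mul, norm_mul, norm_mul, norm_mul, norm_div, norm_exp_neg_mul_I,
    Complex.norm_exp_ofReal_mul_I, RCLike.norm_conj, RCLike.norm_conj]
  refine ⟨?_, ?_, ?_⟩
  · nlinarith [norm_nonneg F]
  · rw [mul_one, div_lt_one hH0]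
    exact hFH
  · nlinarith [norm_nonneg F]

theorem coneAlpha_mul_coneBeta_ne_zero {H F : ℂ} (hFH : ‖F‖ < ‖H‖) (hH : ‖H‖ < 1) (y : ℝ) :
    coneAlpha H F y * coneBeta H F y ≠ 0 := by
  have hH0 : H ≠ 0 := norm_pos_iff.mp ((norm_nonneg F).trans_lt hFH)
  obtain ⟨h1, h2, -⟩ := norm_cone_factors hFH hH y
  have hs := (coneScale_pos hH (hFH.trans hH)).ne'
  rw [coneAlpha_mul_coneBeta F hH0]
  refine mul_ne_zero ?_ (mul_ne_zero (mul_ne_zero hH0 ?_) ?_)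
  · exact_mod_cast mul_ne_zero hs hs
  · exact Complex.slitPlane_ne_zero (one_sub_mem_slitPlane h1)
  · exact Complex.slitPlane_ne_zero (one_sub_mem_slitPlane h2)

theorem coneLift_fst_pos {H F : ℂ} (hFH : ‖F‖ < ‖H‖) (hH : ‖H‖ < 1) (l : ℂ) (y : ℝ) :
    0 < (coneLift H F l y).1 := by
  have := norm_pos_iff.mpr (coneAlpha_mul_coneBeta_ne_zero hFH hH y)
  exact Real.arsinh_pos_iff.mpr (by positivity)

theorem norm_mul_exp_im_of_exp_eq {H l : ℂ} (hl : Complex.exp l = H) :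
    (‖H‖ : ℂ) * Complex.exp (l.im * Complex.I) = H := by
  rw [← hl, Complex.norm_exp, Complex.ofReal_exp, ← Complex.exp_add, Complex.re_add_im]

/-- The logarithm l supplies a choice of arg H, and principal arguments serve for the remaining
factors, so the sums in `coneLift` are arguments of the two invariant products. -/
theorem adsCover_coneLift {H F l : ℂ} (hFH : ‖F‖ < ‖H‖) (hH : ‖H‖ < 1) (hl : Complex.exp l = H)
    (y : ℝ) : adsCover (coneLift H F l y) = PSL2R.mk (coneSL hH (hFH.trans hH) y) := by
  have hH0 : H ≠ 0 := norm_pos_iff.mp ((norm_nonneg F).trans_lt hFH)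
  have hne := coneAlpha_mul_coneBeta_ne_zero hFH hH y
  have hs := coneScale_pos hH (hFH.trans hH)
  have ea : SL2R.alpha (coneSL hH (hFH.trans hH) y) = coneAlpha H F y := SL2R.alpha_ofSU _ _ _
  have eb : SL2R.beta (coneSL hH (hFH.trans hH) y) = coneBeta H F y := SL2R.beta_ofSU _ _ _
  have hHl := norm_mul_exp_im_of_exp_eq hl
  have hnab : ‖coneAlpha H F y * coneBeta H F y‖ =
      ‖conj (coneAlpha H F y) * coneBeta H F y‖ := by
    rw [norm_mul, norm_mul, RCLike.norm_conj]
  have hss : ‖((coneScale H F * coneScale H F : ℝ) : ℂ)‖ = coneScale H F * coneScale H F := by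
    rw [Complex.norm_real, Real.norm_eq_abs, abs_of_pos (mul_pos hs hs)]
  rw [coneLift]
  have key := adsCover_eq_mk_of_arg (g := coneSL hH (hFH.trans hH) y)
    (θ := l.im + Complex.arg (1 - H * conj F * Complex.exp (y * Complex.I)) +
      Complex.arg (1 - F / H * Complex.exp (-y * Complex.I)))
    (η := l.im + y + Complex.arg (1 - conj H * F * Complex.exp (-y * Complex.I)) +
      Complex.arg (1 - F / H * Complex.exp (-y * Complex.I)))
    (by rw [eb]; exact right_ne_zero_of_mul hne)
    (by
      rw [ea, eb, coneAlpha_mul_coneBeta F hH0, norm_mul, norm_mul, norm_mul, hss]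
      have e1 := Complex.norm_mul_exp_arg_mul_I (1 - H * conj F * Complex.exp (y * Complex.I))
      have e2 := Complex.norm_mul_exp_arg_mul_I (1 - F / H * Complex.exp (-y * Complex.I))
      push_cast
      rw [add_mul, add_mul, Complex.exp_add, Complex.exp_add]
      have e3 := congrArg₂ (· * ·) (congrArg₂ (· * ·) hHl e1) e2
      rw [← e3]
      ring)
    (by
      rw [ea, eb, hnab, conj_coneAlpha_mul_coneBeta F hH0, norm_mul, norm_mul, norm_mul, norm_mul,
        hss, Complex.norm_exp_ofReal_mul_I]
      have e1 := Complex.norm_mul_exp_arg_mul_I (1 - conj H * F * Complex.exp (-y * Complex.I))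
      have e2 := Complex.norm_mul_exp_arg_mul_I (1 - F / H * Complex.exp (-y * Complex.I))
      push_cast
      rw [add_mul, add_mul, add_mul, Complex.exp_add, Complex.exp_add, Complex.exp_add]
      have e3 := congrArg₂ (· * ·) (congrArg₂ (· * ·) hHl e1) e2
      generalize Complex.exp ((y : ℂ) * Complex.I) = E
      linear_combination (-(coneScale H F : ℂ) ^ 2 * E) * e3)
  rw [ea, eb] at key
  exact key

end Cone

/-! ## The disc model of the hyperbolic plane -/

theorem add_I_ne_zero (w : ℍ) : (w : ℂ) + Complex.I ≠ 0 := by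
  have := sub_conj_ne_zero UpperHalfPlane.I w
  simpa using this

theorem discCoord_I_mul (w : ℍ) :
    discCoord UpperHalfPlane.I w * ((w : ℂ) + Complex.I) = w - Complex.I := by
  have := add_I_ne_zero w
  rw [discCoord]
  simp [this]

/-- The direction of `conj w - i` relative to `w + i`. -/
def cayleyAng (w : ℍ) : Circle := Circle.ofConjDivSelf ((w : ℂ) + Complex.I) (add_I_ne_zero w)

theorem coe_cayleyAng (w : ℍ) : (cayleyAng w : ℂ) =
    (starRingEnd ℂ) ((w : ℂ) + Complex.I) / ((w : ℂ) + Complex.I) := rfl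

theorem continuous_cayleyAng : Continuous cayleyAng := by
  have h : Continuous fun w : ℍ => (w : ℂ) + Complex.I :=
    UpperHalfPlane.continuous_coe.add continuous_const
  exact Continuous.subtype_mk ((Complex.continuous_conj.comp h).div h add_I_ne_zero) _

/-- The element `sec q` acts as the affine map v ↦ Im(q) v + Re(q), which carries the disc
coordinate centred at i to the one centred at q. -/
theorem discCoord_inv_sec_smul (q w : ℍ) :
    discCoord UpperHalfPlane.I ((sec q)⁻¹ • w : ℍ) = discCoord q w := by
  obtain ⟨v, rfl⟩ : ∃ v : ℍ, w = sec q • v := ⟨(sec q)⁻¹ • w, (smul_inv_smul _ _).symm⟩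
  rw [inv_smul_smul]
  have h1 : ((sec q • v : ℍ) : ℂ) = q.im * v + q.re := by
    change ((secSL q • v : ℍ) : ℂ) = _
    have h2 : ((√q.im : ℝ) : ℂ) ≠ 0 := by exact_mod_cast (Real.sqrt_pos.mpr q.im_pos).ne'
    have h3 : ((√q.im : ℝ) : ℂ) ^ 2 = q.im := by
      rw [← Complex.ofReal_pow, Real.sq_sqrt q.im_pos.le]
    rw [SL2R.coe_smul, ← h3]
    simp only [SL2R.num, SL2R.den, secSL]
    simp
    field_simp
  have h4 : ((q.im : ℝ) : ℂ) ≠ 0 := by exact_mod_cast q.im_pos.ne'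
  have h5 : (q : ℂ) = q.re + q.im * Complex.I := (Complex.re_add_im (q : ℂ)).symm
  have h6 := sub_conj_ne_zero UpperHalfPlane.I v
  rw [discCoord, discCoord, h1, div_eq_div_iff h6 (by rw [← h1]; exact sub_conj_ne_zero q _), h5]
  simp only [map_add, map_mul, Complex.conj_ofReal, Complex.conj_I, UpperHalfPlane.coe_I]
  ring

section Cone

open ComplexConjugate

/-- In the disc the map sends F to H with denominator s e^{iy/2} (1 - |F|²). The formulas translate
this back to the half-plane through the Cayley factors f' + i and h' + i. -/
theorem den_coneSL {f' h' : ℍ} {H F : ℂ} (hf : discCoord UpperHalfPlane.I f' = F)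
    (hh : discCoord UpperHalfPlane.I h' = H) (hH : ‖H‖ < 1) (hF : ‖F‖ < 1) (y : ℝ) :
    SL2R.den (coneSL hH hF y) f' * (h' + Complex.I) = (f' + Complex.I) * (coneScale H F *
      (Complex.exp ((y / 2 : ℝ) * Complex.I) * (1 - F * conj F))) ∧
    SL2R.num (coneSL hH hF y) f' = h' * SL2R.den (coneSL hH hF y) f' := by
  have e1 := SL2R.num_sub_I_den (coneSL hH hF y) f'
  have e2 := SL2R.num_add_I_den (coneSL hH hF y) f'
  have ea : SL2R.alpha (coneSL hH hF y) = coneAlpha H F y := SL2R.alpha_ofSU _ _ _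
  have eb : SL2R.beta (coneSL hH hF y) = coneBeta H F y := SL2R.beta_ofSU _ _ _
  have h2 : conj (Complex.exp (-(y / 2 : ℝ) * Complex.I)) =
      Complex.exp ((y / 2 : ℝ) * Complex.I) := by
    rw [← conj_exp_half, Complex.conj_conj]
  have hf1 := discCoord_I_mul f'
  have hh1 := discCoord_I_mul h'
  rw [hf] at hf1
  rw [hh] at hh1
  rw [ea, eb, ← hf1] at e1 e2
  simp only [coneAlpha, coneBeta, map_mul, map_sub, h2, conj_exp_half, Complex.conj_conj,
    Complex.conj_ofReal] at e1 e2
  generalize Complex.exp ((y / 2 : ℝ) * Complex.I) = E at *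
  generalize Complex.exp (-(y / 2 : ℝ) * Complex.I) = E' at *
  generalize SL2R.num (coneSL hH hF y) f' = N at *
  generalize SL2R.den (coneSL hH hF y) f' = d at *
  have hI : (2 : ℂ) * Complex.I ≠ 0 := mul_ne_zero two_ne_zero Complex.I_ne_zero
  -- The difference of the expressions num + i den and num - i den is 2i den; their sum, used below,
  -- is 2 num.
  have hd : d * (h' + Complex.I) = (f' + Complex.I) * (coneScale H F * (E * (1 - F * conj F))) := by
    apply mul_left_cancel₀ hI
    linear_combination (h' + Complex.I) * (e2 - e1) -
      (f' + Complex.I) * coneScale H F * E * (1 - F * conj F) * hh1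
  refine ⟨hd, ?_⟩
  apply mul_right_cancel₀ (add_I_ne_zero h')
  apply mul_left_cancel₀ (two_ne_zero (α := ℂ))
  linear_combination (h' + Complex.I) * (e2 + e1) - 2 * h' * hd +
      (f' + Complex.I) * coneScale H F * E * (1 - F * conj F) * hh1

theorem coneSL_smul {f' h' : ℍ} {H F : ℂ} (hf : discCoord UpperHalfPlane.I f' = F)
    (hh : discCoord UpperHalfPlane.I h' = H) (hH : ‖H‖ < 1) (hF : ‖F‖ < 1) (y : ℝ) :
    coneSL hH hF y • f' = h' := by
  rw [UpperHalfPlane.ext_iff, SL2R.coe_smul, (den_coneSL hf hh hH hF y).2,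
    mul_div_cancel_right₀ _ (SL2R.den_ne_zero _ _)]

/-- The isometry rotates the disc by -y; the two Cayley angles convert this into the rotation number
measured in the half-plane. -/
theorem ang_coneSL {f' h' : ℍ} {H F : ℂ} (hf : discCoord UpperHalfPlane.I f' = F)
    (hh : discCoord UpperHalfPlane.I h' = H) (hH : ‖H‖ < 1) (hF : ‖F‖ < 1) (y : ℝ) :
    SL2R.ang (coneSL hH hF y) f' =
      (Circle.exp y)⁻¹ * ((cayleyAng h')⁻¹ * cayleyAng f') := by
  have h1 := (den_coneSL hf hh hH hF y).1
  have hd := SL2R.den_ne_zero (coneSL hH hF y) f'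
  have h2 := congrArg conj h1
  have h3 := add_I_ne_zero h'
  have h4 := add_I_ne_zero f'
  have h5 : conj ((h' : ℂ) + Complex.I) ≠ 0 := (map_ne_zero _).mpr h3
  have h6 := exp_half_mul y
  rw [map_mul, map_mul (starRingEnd ℂ) ((f' : ℂ) + Complex.I), map_mul, map_mul, conj_exp_half,
    Complex.conj_ofReal, map_sub, map_mul, map_one, Complex.conj_conj] at h2
  apply Circle.ext
  rw [SL2R.coe_ang, Circle.coe_mul, Circle.coe_mul, Circle.coe_inv, Circle.coe_inv,
    coe_cayleyAng, coe_cayleyAng, Circle.coe_exp, ← exp_half_sq]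
  have h8 := Complex.exp_ne_zero ((y / 2 : ℝ) * Complex.I)
  generalize Complex.exp ((y / 2 : ℝ) * Complex.I) = E at *
  generalize Complex.exp (-(y / 2 : ℝ) * Complex.I) = E' at *
  generalize conj (SL2R.den (coneSL hH hF y) f') = d' at *
  generalize SL2R.den (coneSL hH hF y) f' = d at *
  generalize conj ((h' : ℂ) + Complex.I) = b' at *
  generalize conj ((f' : ℂ) + Complex.I) = a' at *
  field_simp
  linear_combination (E ^ 2 * (f' + Complex.I)) * h2 - a' * h1 +
    E * (f' + Complex.I) * a' * coneScale H F * (1 - F * conj F) * h6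

end Cone

/-! ### Logarithms in polar coordinates, continuity and periods of the lift -/

theorem Convex.isSimplyConnected {V : Type*} [NormedAddCommGroup V] [NormedSpace ℝ V] {s : Set V}
    (hs : Convex ℝ s) (hne : s.Nonempty) : IsSimplyConnected s := by
  have := hs.contractibleSpace hne
  exact inferInstanceAs (SimplyConnectedSpace s)

/-- A zero of `H` at most at the origin gives a continuous logarithm of `H` in polar coordinates. -/
theorem exists_continuousOn_log_polar {H : ℂ → ℂ} (hc : Continuous H)
    (h0 : ∀ w ∈ Metric.ball (0 : ℂ) 1, w ≠ 0 → H w ≠ 0) :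
    ∃ l : ℝ × ℝ → ℂ, ContinuousOn l (Ioo (0 : ℝ) 1 ×ˢ univ) ∧
      (∀ r x : ℝ, 0 < r → r < 1 → Complex.exp (l (r, x)) = H (r * Complex.exp (x * Complex.I))) ∧
      ∃ k : ℤ, ∀ r x : ℝ, 0 < r → r < 1 →
        (l (r, x + 2 * Real.pi)).im = (l (r, x)).im + 2 * Real.pi * k := by
  have hcv : Convex ℝ (Ioo (0 : ℝ) 1 ×ˢ (univ : Set ℝ)) := (convex_Ioo 0 1).prod convex_univ
  have hne : (Ioo (0 : ℝ) 1 ×ˢ (univ : Set ℝ)).Nonempty :=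
    ⟨(1 / 2, 0), ⟨by norm_num, by norm_num⟩, mem_univ _⟩
  have hg : Continuous fun u : ℝ × ℝ => H (u.1 * Complex.exp (u.2 * Complex.I)) := by fun_prop
  obtain ⟨l, hl, he⟩ := Complex.exists_continuousOn_eqOn_exp_comp (hcv.isSimplyConnected hne)
    (isOpen_Ioo.prod isOpen_univ) hg.continuousOn (by
      rintro ⟨⟨r, x⟩, ⟨⟨hr0, hr1⟩, -⟩, hu⟩
      refine h0 _ ?_ ?_ hu
      · simpa [Complex.norm_exp_ofReal_mul_I, abs_of_pos hr0] using hr1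
      · exact mul_ne_zero (by exact_mod_cast hr0.ne') (Complex.exp_ne_zero _))
  have he' : ∀ r x : ℝ, 0 < r → r < 1 →
      Complex.exp (l (r, x)) = H (r * Complex.exp (x * Complex.I)) :=
    fun r x h1 h2 => he (x := (r, x)) ⟨⟨h1, h2⟩, mem_univ _⟩
  refine ⟨l, hl, he', ?_⟩
  -- The change of the logarithm around the origin, in units of 2π. It is continuous with integer
  -- values on a connected strip, hence a constant winding number k.
  let m : ℝ × ℝ → ℝ := fun u => ((l (u.1, u.2 + 2 * Real.pi)).im - (l u).im) / (2 * Real.pi)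
  have hm : ContinuousOn m (Ioo (0 : ℝ) 1 ×ˢ univ) := by
    have h1 : ContinuousOn (fun u : ℝ × ℝ => l (u.1, u.2 + 2 * Real.pi))
        (Ioo (0 : ℝ) 1 ×ˢ univ) :=
      hl.comp (by fun_prop) fun u hu => ⟨hu.1, mem_univ _⟩
    exact ((Complex.continuous_im.comp_continuousOn h1).sub
      (Complex.continuous_im.comp_continuousOn hl)).div_const _
  have hmaps : MapsTo m (Ioo (0 : ℝ) 1 ×ˢ univ) (range ((↑) : ℤ → ℝ)) := by
    rintro ⟨r, x⟩ ⟨⟨h1, h2⟩, -⟩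
    have h3 : Complex.exp (l (r, x + 2 * Real.pi)) = Complex.exp (l (r, x)) := by
      rw [he' r _ h1 h2, he' r _ h1 h2]
      congr 2
      rw [Complex.exp_eq_exp_iff_exists_int]
      exact ⟨1, by push_cast; ring⟩
    obtain ⟨n, hn⟩ := Complex.exp_eq_exp_iff_exists_int.mp h3
    refine ⟨n, ?_⟩
    have h4 := congrArg Complex.im hn
    have h5 : (l (r, x + 2 * Real.pi)).im = (l (r, x)).im + n * (2 * Real.pi) := by
      simpa using h4
    change (n : ℝ) = ((l (r, x + 2 * Real.pi)).im - (l (r, x)).im) / (2 * Real.pi)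
    rw [h5, add_sub_cancel_left, mul_div_cancel_right₀ _ Real.two_pi_pos.ne']
  obtain ⟨_, ⟨k, rfl⟩, hk⟩ := hcv.isPreconnected.eqOn_const_of_mapsTo
    Int.isClosedEmbedding_coe_real.isEmbedding.isDiscrete_range hm hmaps ⟨_, ⟨0, rfl⟩⟩
  refine ⟨k, fun r x h1 h2 => ?_⟩
  have h3 : ((l (r, x + 2 * Real.pi)).im - (l (r, x)).im) / (2 * Real.pi) = k :=
    hk (x := (r, x)) ⟨⟨h1, h2⟩, mem_univ _⟩
  rw [div_eq_iff Real.two_pi_pos.ne'] at h3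
  linarith

theorem ContinuousOn.coneLift {X : Type*} [TopologicalSpace X] {s : Set X} {H F l : X → ℂ}
    {y : X → ℝ} (hH : ContinuousOn H s) (hF : ContinuousOn F s) (hl : ContinuousOn l s)
    (hy : ContinuousOn y s) (hFH : ∀ u ∈ s, ‖F u‖ < ‖H u‖) (hH1 : ∀ u ∈ s, ‖H u‖ < 1) :
    ContinuousOn (fun u => coneLift (H u) (F u) (l u) (y u)) s := by
  have hH0 : ∀ u ∈ s, H u ≠ 0 := fun u hu =>
    norm_pos_iff.mp ((norm_nonneg _).trans_lt (hFH u hu))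
  have hy' : ContinuousOn (fun u => (y u : ℂ)) s := Complex.continuous_ofReal.comp_continuousOn hy
  have hE : ContinuousOn (fun u => Complex.exp (y u * Complex.I)) s := by fun_prop
  have hE' : ContinuousOn (fun u => Complex.exp (-y u * Complex.I)) s := by fun_prop
  have hcH := Complex.continuous_conj.comp_continuousOn hH
  have hcF := Complex.continuous_conj.comp_continuousOn hF
  have h1 : ContinuousOn (fun u => Complex.arg (1 - H u * (starRingEnd ℂ) (F u) *
      Complex.exp (y u * Complex.I))) s := fun u hu =>
    (Complex.continuousAt_arg (one_sub_mem_slitPlane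
      (norm_cone_factors (hFH u hu) (hH1 u hu) (y u)).1)).comp_continuousWithinAt
      (f := fun u => 1 - H u * (starRingEnd ℂ) (F u) * Complex.exp (y u * Complex.I))
      ((continuousOn_const.sub ((hH.mul hcF).mul hE)) u hu)
  have h2 : ContinuousOn (fun u => Complex.arg (1 - F u / H u *
      Complex.exp (-y u * Complex.I))) s := fun u hu =>
    (Complex.continuousAt_arg (one_sub_mem_slitPlane
      (norm_cone_factors (hFH u hu) (hH1 u hu) (y u)).2.1)).comp_continuousWithinAt
      (f := fun u => 1 - F u / H u * Complex.exp (-y u * Complex.I))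
      ((continuousOn_const.sub ((hF.div hH hH0).mul hE')) u hu)
  have h3 : ContinuousOn (fun u => Complex.arg (1 - (starRingEnd ℂ) (H u) * F u *
      Complex.exp (-y u * Complex.I))) s := fun u hu =>
    (Complex.continuousAt_arg (one_sub_mem_slitPlane
      (norm_cone_factors (hFH u hu) (hH1 u hu) (y u)).2.2)).comp_continuousWithinAt
      (f := fun u => 1 - (starRingEnd ℂ) (H u) * F u * Complex.exp (-y u * Complex.I))
      ((continuousOn_const.sub ((hcH.mul hF).mul hE')) u hu)
  have hil : ContinuousOn (fun u => (l u).im) s := Complex.continuous_im.comp_continuousOn hl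
  have hk : ContinuousOn (fun u => (coneScale (H u) (F u) : ℂ)) s := by
    refine Complex.continuous_ofReal.comp_continuousOn (ContinuousOn.inv₀ ?_ ?_)
    · exact ((continuousOn_const.sub (hH.norm.pow 2)).mul
        (continuousOn_const.sub (hF.norm.pow 2))).sqrt
    · exact fun u hu h0 => (coneScale_pos (hH1 u hu) ((hFH u hu).trans (hH1 u hu))).ne'
        (by rw [coneScale, h0, inv_zero])
  have hab : ContinuousOn (fun u => coneAlpha (H u) (F u) (y u) * coneBeta (H u) (F u) (y u)) s := by
    have hy2 : ContinuousOn (fun u => ((y u / 2 : ℝ) : ℂ)) s :=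
      Complex.continuous_ofReal.comp_continuousOn (hy.div_const 2)
    have hE2 : ContinuousOn (fun u => Complex.exp ((y u / 2 : ℝ) * Complex.I)) s :=
      Complex.continuous_exp.comp_continuousOn (hy2.mul continuousOn_const)
    have hE2' : ContinuousOn (fun u => Complex.exp (-(y u / 2 : ℝ) * Complex.I)) s :=
      Complex.continuous_exp.comp_continuousOn (hy2.neg.mul continuousOn_const)
    exact (hk.mul (hE2'.sub ((hH.mul hcF).mul hE2))).mul
      (hk.mul ((hH.mul hE2).sub (hF.mul hE2')))
  exact (Real.continuous_arsinh.comp_continuousOn (continuousOn_const.mul hab.norm)).prodMk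
    (((hil.add h1).add h2).prodMk (((hil.add hy).add h3).add h2))

/-- The shift changes the sign of both α and β and keeps e^{iy}, so only the explicit summand y of η
moves. -/
theorem coneLift_add_two_pi (H F l : ℂ) (y : ℝ) :
    coneLift H F l (y + 2 * Real.pi) = coneLift H F l y + (0, 0, 2 * Real.pi) := by
  have h1 : Complex.exp (((y + 2 * Real.pi : ℝ) : ℂ) * Complex.I) = Complex.exp (y * Complex.I) := by
    rw [Complex.exp_eq_exp_iff_exists_int]
    exact ⟨1, by push_cast; ring⟩
  have h2 : Complex.exp (-((y + 2 * Real.pi : ℝ) : ℂ) * Complex.I) =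
      Complex.exp (-y * Complex.I) := by
    rw [Complex.exp_eq_exp_iff_exists_int]
    exact ⟨-1, by push_cast; ring⟩
  have h4 : Complex.exp (((y + 2 * Real.pi) / 2 : ℝ) * Complex.I) =
      -Complex.exp ((y / 2 : ℝ) * Complex.I) := by
    have : (((y + 2 * Real.pi) / 2 : ℝ) : ℂ) * Complex.I =
        (y / 2 : ℝ) * Complex.I + Real.pi * Complex.I := by
      push_cast; ring
    rw [this, Complex.exp_add, Complex.exp_pi_mul_I, mul_neg_one]
  have h5 : Complex.exp (-((y + 2 * Real.pi) / 2 : ℝ) * Complex.I) =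
      -Complex.exp (-(y / 2 : ℝ) * Complex.I) := by
    rw [← conj_exp_half, h4, map_neg, conj_exp_half]
  have h6 : coneAlpha H F (y + 2 * Real.pi) * coneBeta H F (y + 2 * Real.pi) =
      coneAlpha H F y * coneBeta H F y := by
    simp only [coneAlpha, coneBeta, h4, h5]
    ring
  rw [coneLift, coneLift, h1, h2, h6]
  refine Prod.ext ?_ (Prod.ext ?_ ?_)
  · simp
  · simp
  · simp only [Prod.mk_add_mk]
    ring

/-- The argument of H enters θ and η alike; the meridian therefore has equal parameters θ and η. -/
theorem coneLift_add_im {H F l l' : ℂ} {c : ℝ} (h : l'.im = l.im + c) (y : ℝ) :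
    coneLift H F l' y = coneLift H F l y + (0, c, c) := by
  rw [coneLift, coneLift, h]
  refine Prod.ext ?_ (Prod.ext ?_ ?_)
  · simp
  · simp only [Prod.mk_add_mk]
    ring
  · simp only [Prod.mk_add_mk]
    ring

/-! ## Tubular neighbourhoods of the singular fibers -/

/-- A small disc in the coordinates (Re, log Im), rescaled to radius one. The parametrization is
kept global so that it extends to coordinates on all of AdS^{f,h}. -/
theorem exists_homeomorph_ball_subset (p : ℍ) {U : Set ℍ} (hU : U ∈ 𝓝 p) :
    ∃ ψ : ℂ ≃ₜ ℍ, ψ 0 = p ∧ ∀ w ∈ Metric.ball (0 : ℂ) 1, ψ w ∈ U := by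
  let e := upperHalfPlaneHomeoComplex
  have h1 : e.symm ⁻¹' U ∈ 𝓝 (e p) :=
    e.symm.continuous.continuousAt (by rwa [e.symm_apply_apply])
  obtain ⟨ε, hε, hb⟩ := Metric.mem_nhds_iff.mp h1
  have hε' : (ε : ℂ) ≠ 0 := by exact_mod_cast hε.ne'
  refine ⟨(Homeomorph.mulLeft₀ (ε : ℂ) hε').trans ((Homeomorph.addLeft (e p)).trans e.symm),
    by simp, fun w hw => ?_⟩
  have hw' : ‖w‖ < 1 := by simpa using hw
  refine hb (a := e p + ε * w) ?_
  rw [Metric.mem_ball, dist_eq_norm, add_sub_cancel_left, norm_mul, Complex.norm_real,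
    Real.norm_of_nonneg hε.le]
  nlinarith

theorem exists_openPartialHomeomorph_of_injOn {X Y : Type*} [TopologicalSpace X] [TopologicalSpace Y]
    [Nonempty X] {φ : X → Y} (hc : Continuous φ) (ho : IsOpenMap φ) {s : Set X} (hs : IsOpen s)
    (hi : InjOn φ s) : ∃ e : OpenPartialHomeomorph X Y, ⇑e = φ ∧ e.source = s :=
  ⟨OpenPartialHomeomorph.ofContinuousOpen (hi.toPartialEquiv φ s) hc.continuousOn ho hs, rfl, rfl⟩

namespace EquivariantPair

variable {Γ : Subgroup PSL2R} (D : EquivariantPair Γ)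

theorem smul_mem_C {γ : Γ} {p : ℍ} (hp : p ∈ D.C) : γ • p ∈ D.C :=
  D.C_of_smul (γ := γ⁻¹) (by rwa [inv_smul_smul])

/-- The direction in the fiber over `z` that is the origin of the longitudes of the tube around the
fiber over `p`. -/
def longitudeOrigin (p z : ℍ) : Circle :=
  (cayleyAng ((sec (D.h p))⁻¹ • D.h z))⁻¹ * cayleyAng ((sec (D.f p))⁻¹ • D.f z)

theorem continuous_longitudeOrigin (p : ℍ) : Continuous (D.longitudeOrigin p) :=
  (continuous_cayleyAng.comp ((continuous_const_smul _).comp D.h_c1.continuous)).inv.mul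
    (continuous_cayleyAng.comp ((continuous_const_smul _).comp D.f_c1.continuous))

theorem longitudeOrigin_self (p : ℍ) : D.longitudeOrigin p p = 1 := by
  have h : ∀ q : ℍ, (sec q)⁻¹ • q = UpperHalfPlane.I := fun q => by
    rw [inv_smul_eq_iff, sec_smul_I]
  rw [longitudeOrigin, h, h, inv_mul_cancel]

/-- The coordinates of the tube around the fiber over `p`. -/
def tubeHomeo (p : ℍ) (ψ : ℂ ≃ₜ ℍ) : ℂ × Circle ≃ₜ D.AdS where
  toFun u := D.ofAng (ψ u.1, u.2⁻¹ * D.longitudeOrigin p (ψ u.1))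
  invFun x := (ψ.symm (D.fib x), (D.rotNum x)⁻¹ * D.longitudeOrigin p (D.fib x))
  left_inv u := by
    refine Prod.ext ?_ ?_
    · simp [fib_ofAng]
    · simp [fib_ofAng, rotNum_ofAng]
  right_inv x := by
    simp [ofAng_rotNum]
  continuous_toFun := D.continuous_ofAng.comp ((ψ.continuous.comp continuous_fst).prodMk
    (continuous_snd.inv.mul ((D.continuous_longitudeOrigin p).comp
      (ψ.continuous.comp continuous_fst))))
  continuous_invFun := (ψ.symm.continuous.comp D.continuous_fib).prodMk
    (D.continuous_rotNum.inv.mul ((D.continuous_longitudeOrigin p).comp D.continuous_fib))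

theorem tubeHomeo_apply (p : ℍ) (ψ : ℂ ≃ₜ ℍ) (u : ℂ × Circle) :
    D.tubeHomeo p ψ u = D.ofAng (ψ u.1, u.2⁻¹ * D.longitudeOrigin p (ψ u.1)) := rfl

/-- Both sides send f' to h' with the same rotation number. The inverse in the circle coordinate of
the tube matches the rotation by -y of the cone isometry, and `longitudeOrigin` matches its Cayley
angles. -/
theorem adsIsom_incl_tubeHomeo (p : ℍ) (ψ : ℂ ≃ₜ ℍ) (w : ℂ) (y : ℝ)
    (hH : ‖discMap D.h (D.h p) (ψ w)‖ < 1) (hF : ‖discMap D.f (D.f p) (ψ w)‖ < 1) :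
    adsIsom ((sec (D.h p))⁻¹, (sec (D.f p))⁻¹) (D.incl (D.tubeHomeo p ψ (w, Circle.exp y))) =
      PSL2R.mk (coneSL hH hF y) := by
  set f' : ℍ := (sec (D.f p))⁻¹ • D.f (ψ w) with hf'
  set h' : ℍ := (sec (D.h p))⁻¹ • D.h (ψ w) with hh'
  have e1 : discCoord UpperHalfPlane.I f' = discMap D.f (D.f p) (ψ w) := by
    rw [discMap_coe, hf', discCoord_inv_sec_smul]
  have e2 : discCoord UpperHalfPlane.I h' = discMap D.h (D.h p) (ψ w) := by
    rw [discMap_coe, hh', discCoord_inv_sec_smul]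
  have e3 : sec (D.f p) • f' = D.f (ψ w) := smul_inv_smul _ _
  have e4 : sec (D.h p) • h' = D.h (ψ w) := smul_inv_smul _ _
  have e5 : PSL2R.ang (sec (D.h p))⁻¹ (D.h (ψ w)) = 1 := by
    rw [← e4, PSL2R.ang_inv, ang_sec, inv_one]
  rw [tubeHomeo_apply, incl_ofAng, adsIsom, inv_inv]
  refine PSL2R.ext_of_smul_ang (w := f') ?_ ?_
  · rw [mul_smul, mul_smul, e3, isomOf_smul]
    exact (coneSL_smul e1 e2 hH hF y).symm
  · rw [PSL2R.ang_mul, PSL2R.ang_mul, e3, ang_sec, mul_one, ang_isomOf, isomOf_smul, e5,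
      one_mul, PSL2R.ang_mk, ang_coneSL e1 e2]
    rfl

/-- A parametrization `ψ` of `ℍ` by the plane whose restriction to the unit disc parametrizes a small
neighbourhood of the singular point `p`. -/
structure IsAdaptedDisc (p : ℍ) (ψ : ℂ ≃ₜ ℍ) : Prop where
  map_zero : ψ 0 = p
  norm_lt : ∀ w ∈ Metric.ball (0 : ℂ) 1, w ≠ 0 →
    ‖discMap D.f (D.f p) (ψ w)‖ < ‖discMap D.h (D.h p) (ψ w)‖
  dist_lt : ∀ w ∈ Metric.ball (0 : ℂ) 1, ∀ q ∈ D.C, q ≠ p → 2 * dist (ψ w) p < dist p q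

/-- In the local form zⁿ the value h(p) corresponds to 0, which is attained only at the centre. -/
theorem IsBranchPoint.eventually_ne {h : ℍ → ℍ} {p : ℍ} (hp : IsBranchPoint h p) :
    ∀ᶠ z in 𝓝 p, z ≠ p → h z ≠ h p := by
  obtain ⟨n, hn, e, e', hs, h0, -, h0', -, -, -, -, hev⟩ := hp
  have h1 := (UpperHalfPlane.continuous_coe.tendsto p).eventually hev
  have h2 := (UpperHalfPlane.continuous_coe.tendsto p).eventually (e.open_source.mem_nhds hs)
  filter_upwards [h1, h2] with z hz hzs hne heq
  rw [toPlane_coe, heq, h0'] at hz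
  have h3 : e z = 0 := pow_eq_zero_iff (by omega) |>.mp hz.symm
  exact hne (UpperHalfPlane.ext (e.injOn hzs hs (h3.trans h0.symm)))

theorem exists_isAdaptedDisc (hb : IsBranchedImmersion D.h) (hlt : PullbackLT D.f D.h) {p : ℍ}
    (hp : p ∈ D.C) : ∃ ψ, D.IsAdaptedDisc p ψ := by
  obtain ⟨ε, hε, hball⟩ : ∃ ε > 0, ∀ q ∈ D.C, q ≠ p → ε ≤ dist p q := by
    obtain ⟨V, hV, hVC⟩ := isDiscrete_iff_forall_mem_exists_isOpen.mp hb.2.1 p hp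
    have hpV : p ∈ V := (hVC.ge rfl).1
    obtain ⟨ε, hε, hεV⟩ := Metric.isOpen_iff.mp hV p hpV
    refine ⟨ε, hε, fun q hq hqp => not_lt.mp fun hlt => hqp ?_⟩
    exact hVC.le ⟨hεV (by rwa [Metric.mem_ball, dist_comm]), hq⟩
  have hev : ∀ᶠ z : ℍ in 𝓝 p, z ≠ p → D.h z ≠ D.h p ∧ Function.Injective (hDeriv D.h z) ∧
      ∀ v : ℂ, v ≠ 0 → pullbackMetric D.f z v < pullbackMetric D.h z v := by
    filter_upwards [IsBranchPoint.eventually_ne (hb.2.2 p hp),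
      Metric.ball_mem_nhds p hε] with z h1 h2 h3
    have h4 : z ∉ D.C := fun hz => by
      have h5 := hball z hz h3
      rw [Metric.mem_ball, dist_comm] at h2
      linarith
    exact ⟨h1 h3, not_not.mp h4, fun v hv => D.pullbackMetric_lt_of_notMem hlt h4 hv⟩
  have hkey := (UpperHalfPlane.continuous_coe.tendsto p).eventually
    (norm_discMap_lt_of_isolated D.f_c1 D.h_c1 hev)
  -- Half of a lower bound for the distance to the other singular points, so that tubes around
  -- different fibers will be disjoint.
  obtain ⟨ψ, h0, hψ⟩ := exists_homeomorph_ball_subset p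
    (hkey.and (Metric.ball_mem_nhds p (half_pos hε)))
  refine ⟨ψ, h0, fun w hw hw0 => (hψ w hw).1 fun h => hw0 ?_, fun w hw q hq hqp => ?_⟩
  · exact ψ.injective ((UpperHalfPlane.ext h).trans h0.symm)
  · have h1 := (hψ w hw).2
    have h2 := hball q hq hqp
    have h3 : dist (ψ w) p < ε / 2 := h1
    linarith

/-- C is closed, discrete and Γ-invariant and the projection is an open quotient map, so C₀ is
closed and discrete in a compact space. -/
theorem finite_C₀ (hb : IsBranchedImmersion D.h) [CompactSpace (HypSurface Γ)] : Finite ↥D.C₀ := by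
  have h1 : IsQuotientMap (fun p : ℍ => (⟦p⟧ : HypSurface Γ)) := isQuotientMap_quot_mk
  have ho : IsOpenMap (fun p : ℍ => (⟦p⟧ : HypSurface Γ)) := isOpenMap_quotient_mk'_mul
  have hpre : (fun p : ℍ => (⟦p⟧ : HypSurface Γ)) ⁻¹' D.C₀ = D.C := by
    apply Subset.antisymm
    · rintro q ⟨c, hc, hcq⟩
      obtain ⟨γ, hγ⟩ := MulAction.orbitRel_apply.mp (Quotient.exact hcq)
      have hγ : γ • q = c := hγ
      exact D.C_of_smul (γ := γ) (by rwa [hγ])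
    · exact fun q hq => ⟨q, hq, rfl⟩
  have hcl : IsClosed D.C₀ := by
    rw [← h1.isClosed_preimage, hpre]
    exact D.isClosed_C
  have hd : IsDiscrete D.C₀ := by
    rw [isDiscrete_iff_forall_mem_exists_isOpen]
    rintro _ ⟨c, hc, rfl⟩
    obtain ⟨V, hV, hVC⟩ := isDiscrete_iff_forall_mem_exists_isOpen.mp hb.2.1 c hc
    refine ⟨_, ho V hV, Subset.antisymm ?_ ?_⟩
    · rintro _ ⟨⟨v, hv, rfl⟩, hvC⟩
      have h2 : v ∈ D.C := hpre.le hvC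
      have h3 : v = c := hVC.le ⟨hv, h2⟩
      rw [h3]
      rfl
    · rintro _ rfl
      exact ⟨⟨c, (hVC.ge rfl).1, rfl⟩, c, hc, rfl⟩
  exact hcl.isCompact.finite hd

variable {D}

/-- If γp' ≠ p, the common point would be closer than half of d(p, γp') to each of them, against the
triangle inequality. This gives both injectivity and disjointness of the tubes. -/
theorem IsAdaptedDisc.smul_eq {p p' : ℍ} {ψ ψ' : ℂ ≃ₜ ℍ} (hψ : D.IsAdaptedDisc p ψ)
    (hψ' : D.IsAdaptedDisc p' ψ') (hp : p ∈ D.C) (hp' : p' ∈ D.C) {w w' : ℂ}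
    (hw : w ∈ Metric.ball (0 : ℂ) 1) (hw' : w' ∈ Metric.ball (0 : ℂ) 1) {γ : Γ}
    (h : γ • ψ' w' = ψ w) : γ • p' = p := by
  by_contra hne
  have h1 := hψ.dist_lt w hw (γ • p') (D.smul_mem_C hp') hne
  have h2 := hψ'.dist_lt w' hw' (γ⁻¹ • p) (D.smul_mem_C hp) fun h => hne (by
    rw [← h, smul_inv_smul])
  have hiso : ∀ a b : ℍ, dist (γ • a) (γ • b) = dist a b := fun a b =>
    dist_smul (γ : PSL2R) a b
  rw [← hiso (ψ' w'), ← hiso p', smul_inv_smul, h] at h2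
  have h3 := dist_triangle p (ψ w) (γ • p')
  rw [dist_comm p (ψ w)] at h3
  rw [dist_comm (γ • p') p] at h2
  linarith

theorem IsAdaptedDisc.injOn [IsCancelSMul Γ ℍ] {p : ℍ} {ψ : ℂ ≃ₜ ℍ} (hψ : D.IsAdaptedDisc p ψ)
    (hp : p ∈ D.C) : InjOn (fun u => (⟦D.tubeHomeo p ψ u⟧ : D.M))
      (Metric.ball (0 : ℂ) 1 ×ˢ univ) := by
  rintro u ⟨hu, -⟩ u' ⟨hu', -⟩ h
  obtain ⟨γ, hγ⟩ := MulAction.orbitRel_apply.mp (Quotient.exact h)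
  have h1 : γ • p = p := hψ.smul_eq hψ hp hp hu hu' (congrArg D.fib hγ)
  have h2 : γ = 1 := IsCancelSMul.right_cancel γ 1 p (by rw [h1, one_smul])
  have hγ' : γ • D.tubeHomeo p ψ u' = D.tubeHomeo p ψ u := hγ
  rw [h2, one_smul] at hγ'
  exact ((D.tubeHomeo p ψ).injective hγ').symm

theorem IsAdaptedDisc.eq_zero_of_mem {p : ℍ} {ψ : ℂ ≃ₜ ℍ} (hψ : D.IsAdaptedDisc p ψ) {w : ℂ}
    (hw : w ∈ Metric.ball (0 : ℂ) 1) (hC : ψ w ∈ D.C) : w = 0 := by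
  by_contra h0
  have h1 : ψ w ≠ p := fun h => h0 (ψ.injective (h.trans hψ.map_zero.symm))
  have h2 := hψ.dist_lt w hw _ hC h1
  rw [dist_comm p] at h2
  linarith [dist_nonneg (x := ψ w) (y := p)]

variable [ProperlyDiscontinuousSMul Γ ℍ] [IsCancelSMul Γ ℍ]

theorem IsAdaptedDisc.exists_tube {p : ℍ} {ψ : ℂ ≃ₜ ℍ} (hψ : D.IsAdaptedDisc p ψ) (hp : p ∈ D.C) :
    ∃ e : OpenPartialHomeomorph (ℂ × Circle) D.M,
      ⇑e = (fun u => (⟦D.tubeHomeo p ψ u⟧ : D.M)) ∧ e.source = Metric.ball (0 : ℂ) 1 ×ˢ univ := by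
  have h1 : IsLocalHomeomorph fun u => (⟦D.tubeHomeo p ψ u⟧ : D.M) :=
    D.isQuotientCoveringMap_mk.isCoveringMap.isLocalHomeomorph.comp
      (D.tubeHomeo p ψ).isLocalHomeomorph
  exact exists_openPartialHomeomorph_of_injOn h1.continuous h1.isOpenMap
    (Metric.isOpen_ball.prod isOpen_univ) (hψ.injOn hp)

theorem mem_ball_polar {r : ℝ} (h0 : 0 ≤ r) (h1 : r < 1) (x : ℝ) :
    (r : ℂ) * Complex.exp (x * Complex.I) ∈ Metric.ball (0 : ℂ) 1 := by
  simpa [Complex.norm_exp_ofReal_mul_I, abs_of_nonneg h0] using h1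

theorem polar_ne_zero {r : ℝ} (h0 : 0 < r) (x : ℝ) : (r : ℂ) * Complex.exp (x * Complex.I) ≠ 0 :=
  mul_ne_zero (by exact_mod_cast h0.ne') (Complex.exp_ne_zero _)

theorem range_rot_neg : (range fun y : ℝ => rot (-y)) = axisGeodesic := by
  ext A
  constructor
  · rintro ⟨y, rfl⟩
    exact rot_smul_I _
  · intro hA
    have hA : A • UpperHalfPlane.I = UpperHalfPlane.I := hA
    refine ⟨-Complex.arg (PSL2R.ang A UpperHalfPlane.I), ?_⟩
    refine PSL2R.ext_of_smul_ang (w := UpperHalfPlane.I) ?_ ?_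
    · rw [rot_smul_I, hA]
    · rw [ang_rot, neg_neg, Circle.exp_arg]

/-- The tube is a product neighbourhood in AdS^{f,h} projected to the quotient, and the developing
map is the inclusion along it. After the isometry taking the singular fiber to the axis it becomes
the cone isometry, lifted by `coneLift`; the winding number k of H is both parameters of the
meridian. -/
theorem IsAdaptedDisc.exists_spinConeTube {S : AdSStructure D.MStar}
    (hS : IsDevelopingMap S D.projStar D.inclStar) {p : ℍ} {ψ : ℂ ≃ₜ ℍ}
    (hψ : D.IsAdaptedDisc p ψ) (hp : p ∈ D.C) : ∃ t : SpinConeTube S,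
      t.tube.target = (fun u => (⟦D.tubeHomeo p ψ u⟧ : D.M)) '' (Metric.ball (0 : ℂ) 1 ×ˢ univ) ∧
      ∃ k l : ℤ, t.θ = 2 * Real.pi * k ∧ t.η = 2 * Real.pi * l := by
  obtain ⟨e, he, hes⟩ := hψ.exists_tube hp
  have het : e.target = (fun u => (⟦D.tubeHomeo p ψ u⟧ : D.M)) '' (Metric.ball (0 : ℂ) 1 ×ˢ univ) := by
    rw [← e.image_source_eq_target, hes, he]
  let P : ℝ × ℝ × ℝ → ℂ × Circle := fun u =>
    (u.1 * Complex.exp (u.2.1 * Complex.I), Circle.exp u.2.2)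
  have hP : Continuous P := by fun_prop
  let X : ℝ × ℝ × ℝ → D.AdS := fun u => D.tubeHomeo p ψ (P u)
  have hX : Continuous X := (D.tubeHomeo p ψ).continuous.comp hP
  let Y : {u : ℝ × ℝ × ℝ // 0 < u.1 ∧ u.1 < 1} → D.AdSStar := fun u => ⟨X u.1, fun hmem =>
    polar_ne_zero u.2.1 u.1.2.1
      (hψ.eq_zero_of_mem (mem_ball_polar u.2.1.le u.2.2 u.1.2.1) hmem)⟩
  have hY : Continuous Y := (hX.comp continuous_subtype_val).subtype_mk _
  let H : ℂ → ℂ := fun w => discMap D.h (D.h p) (ψ w)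
  let F : ℂ → ℂ := fun w => discMap D.f (D.f p) (ψ w)
  have hcoe : Continuous fun w : ℂ => ((ψ w : ℍ) : ℂ) := UpperHalfPlane.continuous_coe.comp ψ.continuous
  have hHc : Continuous H := continuous_iff_continuousAt.mpr fun w =>
    (continuousAt_discMap D.h_c1 (D.h p) (ψ w)).comp (f := fun w : ℂ => ((ψ w : ℍ) : ℂ))
      hcoe.continuousAt
  have hFc : Continuous F := continuous_iff_continuousAt.mpr fun w =>
    (continuousAt_discMap D.f_c1 (D.f p) (ψ w)).comp (f := fun w : ℂ => ((ψ w : ℍ) : ℂ))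
      hcoe.continuousAt
  have hH1 : ∀ w, ‖H w‖ < 1 := fun w => norm_discMap_lt_one _ _ _
  have hF1 : ∀ w, ‖F w‖ < 1 := fun w => norm_discMap_lt_one _ _ _
  obtain ⟨l, hl, hlH, k, hk⟩ := exists_continuousOn_log_polar hHc fun w hw hw0 =>
    norm_pos_iff.mp ((norm_nonneg _).trans_lt (hψ.norm_lt w hw hw0))
  -- At r = 0 the fiber is that over p, with longitude origin 1; the developing map traverses it as
  -- a rotation by -y, independently of x.
  have hcore : ∀ x y : ℝ, D.incl (X (0, x, y)) = adsIsom (sec (D.h p), sec (D.f p)) (rot (-y)) := by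
    intro x y
    have h1 : X (0, x, y) = D.ofAng (p, Circle.exp (-y)) := by
      change D.ofAng (ψ (((0 : ℝ) : ℂ) * Complex.exp (x * Complex.I)), (Circle.exp y)⁻¹ *
        D.longitudeOrigin p (ψ (((0 : ℝ) : ℂ) * Complex.exp (x * Complex.I)))) = _
      rw [Complex.ofReal_zero, zero_mul, hψ.map_zero, longitudeOrigin_self, mul_one,
        Circle.exp_neg]
    rw [h1, incl_ofAng_exp]
  have hinv : ∀ A : PSL2R, adsIsom ((sec (D.h p))⁻¹, (sec (D.f p))⁻¹)
      (adsIsom (sec (D.h p), sec (D.f p)) A) = A := fun A => by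
    simp [adsIsom, mul_assoc]
  refine ⟨{
    tube := e
    tube_source := hes
    core := ?_
    cover := D.projStar ∘ Y
    cover_eq := fun u => ?_
    dev := fun u => D.incl (X u)
    dev_developing := hS.comp hY
    dev_continuous := (D.continuous_incl.comp hX).continuousOn
    dev_core := fun x x' y => ?_
    geodesic := ?_
    isom := ((sec (D.h p))⁻¹, (sec (D.f p))⁻¹)
    isom_axis := ?_
    lift := fun u => coneLift (H (u.1 * Complex.exp (u.2.1 * Complex.I)))
      (F (u.1 * Complex.exp (u.2.1 * Complex.I))) (l (u.1, u.2.1)) u.2.2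
    lift_continuous := ?_
    lift_pos := fun u h0 h1 => ?_
    lift_eq := fun u h0 h1 => ?_
    θ := 2 * Real.pi * k
    η := 2 * Real.pi * k
    meridian := fun r x y h0 h1 => ?_
    longitude := fun r x y h0 h1 => ?_ }, het, k, k, rfl, rfl⟩
  · rw [het, he]
    apply Subset.antisymm
    · rintro _ ⟨hm, ⟨u, ⟨hu, -⟩, rfl⟩⟩
      have h1 : ψ u.1 ∈ D.C := (D.mk_mem_LQuot_iff _).mp hm
      exact ⟨u, ⟨hψ.eq_zero_of_mem hu h1, mem_univ _⟩, rfl⟩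
    · rintro _ ⟨u, ⟨hu, -⟩, rfl⟩
      have hu : u.1 = 0 := hu
      refine ⟨(D.mk_mem_LQuot_iff _).mpr ?_, u, ⟨by rw [hu]; simp, mem_univ _⟩, rfl⟩
      change ψ u.1 ∈ D.C
      rwa [hu, hψ.map_zero]
  · rw [he]
    rfl
  · rw [hcore, hcore]
  · refine ⟨fun t => adsIsom (sec (D.h p), sec (D.f p)) (rot t), fun t =>
      (isTimelikeGeodesicAt_rot t).adsIsom _, ?_⟩
    simp only [hcore]
    exact (neg_surjective.range_comp fun t => adsIsom (sec (D.h p), sec (D.f p)) (rot t)).symm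
  · simp only [hcore]
    rw [← range_rot_neg, ← range_comp]
    exact congrArg range (funext fun y => hinv _)
  · refine ContinuousOn.coneLift (hHc.comp (by fun_prop)).continuousOn
      (hFc.comp (by fun_prop)).continuousOn ?_ (by fun_prop) (fun u hu => ?_) fun u _ => hH1 _
    · exact hl.comp (by fun_prop) fun u hu => ⟨hu, mem_univ _⟩
    · exact hψ.norm_lt _ (mem_ball_polar hu.1.le hu.2 _) (polar_ne_zero hu.1 _)
  · exact coneLift_fst_pos (hψ.norm_lt _ (mem_ball_polar h0.le h1 _) (polar_ne_zero h0 _)) (hH1 _)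
      _ _
  · rw [adsCover_coneLift (hψ.norm_lt _ (mem_ball_polar h0.le h1 _) (polar_ne_zero h0 _)) (hH1 _)
      (hlH _ _ h0 h1)]
    exact (D.adsIsom_incl_tubeHomeo p ψ _ _ _ _).symm
  · have h2 : Complex.exp (((x + 2 * Real.pi : ℝ) : ℂ) * Complex.I) = Complex.exp (x * Complex.I) := by
      rw [Complex.exp_eq_exp_iff_exists_int]
      exact ⟨1, by push_cast; ring⟩
    simp only [h2]
    exact coneLift_add_im (hk r x h0 h1) y
  · exact coneLift_add_two_pi _ _ _ _

variable (D)

theorem isBranchedAdS (hb : IsBranchedImmersion D.h) (hlt : PullbackLT D.f D.h)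
    {S : AdSStructure D.MStar} (hS : IsDevelopingMap S D.projStar D.inclStar) :
    IsBranchedAdS ↥D.C₀ S := by
  refine ⟨D.isOrientableThreeManifold, D.isClosed_LQuot, ?_⟩
  -- One singular point for each orbit; tubes of different orbits are disjoint by
  -- `IsAdaptedDisc.smul_eq`.
  choose rep hrep hrepa using fun a : ↥D.C₀ => a.2
  choose ψ hψ using fun a : ↥D.C₀ => D.exists_isAdaptedDisc hb hlt (hrep a)
  choose t ht htk using fun a : ↥D.C₀ => (hψ a).exists_spinConeTube hS (hrep a)
  refine ⟨t, fun a b hab => ?_, ?_, htk⟩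
  · rw [ht, ht, Set.disjoint_left]
    rintro _ ⟨u, ⟨hu, -⟩, rfl⟩ ⟨u', ⟨hu', -⟩, h⟩
    obtain ⟨γ, hγ⟩ := MulAction.orbitRel_apply.mp (Quotient.exact h)
    have h1 := (hψ b).smul_eq (hψ a) (hrep b) (hrep a) hu' hu (congrArg D.fib hγ)
    apply hab
    apply Subtype.ext
    rw [← hrepa a, ← hrepa b]
    exact (Quotient.sound (MulAction.orbitRel_apply.mpr ⟨γ, h1⟩)).symm
  · rintro _ ⟨x, hx, rfl⟩
    let a : ↥D.C₀ := ⟨⟦D.fib x⟧, ⟨D.fib x, hx, rfl⟩⟩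
    refine mem_iUnion.mpr ⟨a, ?_⟩
    -- A point of L is moved by γ into the fiber over the chosen representative, which is the core
    -- of the tube.
    obtain ⟨γ, hγ⟩ := MulAction.orbitRel_apply.mp (Quotient.exact (hrepa a))
    have hγ : γ • D.fib x = rep a := hγ
    rw [ht]
    refine ⟨(D.tubeHomeo (rep a) (ψ a)).symm (γ • x), ⟨?_, mem_univ _⟩, ?_⟩
    · change (ψ a).symm (D.fib (γ • x)) ∈ _
      rw [fib_smul, hγ, ← (hψ a).map_zero, Homeomorph.symm_apply_apply]
      simp
    · simp only [Homeomorph.apply_symm_apply]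
      exact Quotient.sound (MulAction.orbitRel_apply.mpr ⟨γ, rfl⟩)

end EquivariantPair

/-! ## Holonomy -/

theorem IsLocalHomeomorph.locallyPathConnectedSpace {E X : Type*} [TopologicalSpace E]
    [TopologicalSpace X] [LocallyPathConnectedSpace X] {q : E → X} (hq : IsLocalHomeomorph q) :
    LocallyPathConnectedSpace E := by
  choose e he _ using hq
  let cs : ChartedSpace X E :=
    { atlas := range e
      chartAt := e
      mem_chart_source := he
      chart_mem_atlas := fun x => ⟨x, rfl⟩ }
  exact ChartedSpace.locallyPathConnectedSpace X E

/-- Lift `q` through itself in both directions; uniqueness of lifts makes the two lifts inverse to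
each other. -/
theorem IsCoveringMap.exists_homeomorph_of_apply_eq {E X : Type*} [TopologicalSpace E]
    [TopologicalSpace X] [SimplyConnectedSpace E] [LocallyPathConnectedSpace E] {q : E → X}
    (hq : IsCoveringMap q) {a b : E} (h : q a = q b) : ∃ τ : E ≃ₜ E, q ∘ τ = q ∧ τ a = b := by
  let Q : C(E, X) := ⟨q, hq.continuous⟩
  obtain ⟨τ, ⟨h1, h2⟩, -⟩ := hq.existsUnique_continuousMap_lifts Q a b h.symm
  obtain ⟨τ', ⟨h1', h2'⟩, -⟩ := hq.existsUnique_continuousMap_lifts Q b a h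
  have h2 : q ∘ τ = q := h2
  have h2' : q ∘ τ' = q := h2'
  have e1 : τ'.comp τ = ContinuousMap.id E := (hq.existsUnique_continuousMap_lifts Q a a rfl).unique
    ⟨by simp [h1, h1'], by rw [ContinuousMap.coe_comp, ← Function.comp_assoc, h2', h2]; rfl⟩
    ⟨rfl, rfl⟩
  have e2 : τ.comp τ' = ContinuousMap.id E := (hq.existsUnique_continuousMap_lifts Q b b rfl).unique
    ⟨by simp [h1, h1'], by rw [ContinuousMap.coe_comp, ← Function.comp_assoc, h2, h2']; rfl⟩
    ⟨rfl, rfl⟩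
  exact ⟨⟨⟨τ, τ', DFunLike.congr_fun e1, DFunLike.congr_fun e2⟩, τ.continuous, τ'.continuous⟩,
    h2, h1⟩

namespace EquivariantPair

variable {Γ : Subgroup PSL2R} [ProperlyDiscontinuousSMul Γ ℍ] [IsCancelSMul Γ ℍ]
  (D : EquivariantPair Γ)

instance : LocallyPathConnectedSpace D.MStar :=
  D.isClosed_LQuot.isOpen_compl.locallyPathConnectedSpace

/-- If a lift of `q : E → M^{f,h}_*` to `AdS^{f,h}` sends `e₀` to `x`, it sends the end point of the
lift of a loop to the image of `x` under the corresponding element of `Γ`. -/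
theorem exists_factoredHolonomy_eq {E : Type} [TopologicalSpace E] {q : E → D.MStar}
    (hq : IsCoveringMap q) (x : D.AdSStar) (e₀ : q ⁻¹' {D.projStar x}) {Q : E → D.AdS}
    (hQ : Continuous Q) (hQq : ∀ e, (⟦Q e⟧ : D.M) = (q e).1) (hQ0 : Q e₀ = x.1)
    (c : FundamentalGroup D.MStar (D.projStar x)) :
    ∃ γ : Γ, (D.factoredHolonomy x c).unop = (D.j γ, D.ρ γ) ∧
      Q (hq.monodromy (FundamentalGroup.toPath c) e₀) = γ • x.1 := by
  induction c using Quotient.inductionOn with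
  | h c =>
  let hp := isQuotientCoveringMap_quotientMk_of_properlyDiscontinuousSMul (G := Γ) (E := ℍ)
  let c' : Path (⟦D.fib x.1⟧ : HypSurface Γ) ⟦D.fib x.1⟧ :=
    (c.map D.baseStar.continuous).map D.surfaceIncl.continuous
  let γ : Γ := (deckEquiv Γ (D.fib x.1) (FundamentalGroup.fromPath ⟦c'⟧)).unop
  have h0 : c 0 = q e₀ := c.source.trans e₀.2.symm
  let Λ := hq.liftPath c e₀ h0
  have hΛ : q ∘ Λ = c := hq.liftPath_lifts c e₀ h0
  have hΛ0 : Λ 0 = e₀ := hq.liftPath_zero c e₀ h0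
  have hγ : γ • D.fib x.1 = D.fib (Q (Λ 1)) := by
    have h1 := hp.unop_fundamentalGroupToMulOpposite_smul (e := ⟨D.fib x.1, rfl⟩)
      (γ := FundamentalGroup.fromPath ⟦c'⟧)
    refine h1.trans ?_
    -- The lifted loop, sent to AdS^{f,h} and projected to ℍ, lifts the image loop in Σ; its end
    -- point is therefore the one that defines γ.
    let G : C(unitInterval, ℍ) := ⟨fun t => D.fib (Q (Λ t)),
      D.continuous_fib.comp (hQ.comp Λ.continuous)⟩
    have h2 := (hp.isCoveringMap.eq_liftPath_iff' (γ := (c' : C(unitInterval, HypSurface Γ)))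
      (e := D.fib x.1) c'.source (Γ := G)).mpr ⟨?_, ?_⟩
    · exact (DFunLike.congr_fun h2 1).symm
    · funext t
      have h3 : D.base ⟦Q (Λ t)⟧ = D.base (c t).1 := by
        rw [hQq, ← congrFun hΛ t]
        rfl
      exact h3
    · change D.fib (Q (Λ 0)) = _
      rw [hΛ0, hQ0]
  refine ⟨γ, rfl, ?_⟩
  have h4 : (⟦x.1⟧ : D.M) = ⟦Q (Λ 1)⟧ := by
    have h5 : q (Λ 1) = D.projStar x := (congrFun hΛ 1).trans c.target
    rw [hQq, h5]
    rfl
  obtain ⟨δ, hδ⟩ := MulAction.orbitRel_apply.mp (Quotient.exact h4.symm)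
  have hδ : δ • x.1 = Q (Λ 1) := hδ
  -- The end point in AdS^{f,h} is some translate δ·x; freeness of the action on ℍ identifies δ with
  -- γ.
  have h6 : δ = γ := IsCancelSMul.right_cancel δ γ (D.fib x.1) (by rw [hγ, ← hδ, fib_smul])
  rw [← h6, hδ]
  rfl

/-- The developing map is the inclusion composed with a lift Q of the universal covering to
AdS^{f,h}, so its equivariance reduces to that of Q under Γ. -/
theorem exists_isHolonomy {S : AdSStructure D.MStar}
    (hS : IsDevelopingMap S D.projStar D.inclStar) {E : Type} [TopologicalSpace E]
    [SimplyConnectedSpace E] {q : E → D.MStar} (hq : IsCoveringMap q) (x : D.AdSStar)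
    (e₀ : q ⁻¹' {D.projStar x}) :
    ∃ dev : E → PSL2R, IsDevelopingMap S q dev ∧ IsHolonomy hq e₀ dev (D.factoredHolonomy x) := by
  have := hq.isLocalHomeomorph.locallyPathConnectedSpace
  have hp := D.isQuotientCoveringMap_mk.isCoveringMap
  let qv : C(E, D.M) := ⟨fun e => (q e).1, continuous_subtype_val.comp hq.continuous⟩
  have h0 : (⟦x.1⟧ : D.M) = qv e₀ := (congrArg Subtype.val e₀.2).symm
  obtain ⟨Q, ⟨hQ0, hQ⟩, -⟩ := hp.existsUnique_continuousMap_lifts qv e₀ x.1 h0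
  have hQq : ∀ e, (⟦Q e⟧ : D.M) = (q e).1 := congrFun hQ
  let Qs : E → D.AdSStar := fun e => ⟨Q e, fun hL => (q e).2 (by
    rw [← hQq]
    exact (D.mk_mem_LQuot_iff _).mpr hL)⟩
  have hQs : Continuous Qs := Q.continuous.subtype_mk _
  have hproj : D.projStar ∘ Qs = q := funext fun e => Subtype.ext (hQq e)
  have hdev := hS.comp hQs
  rw [hproj] at hdev
  refine ⟨_, hdev, fun c => ?_⟩
  obtain ⟨γ, hγ, hγQ⟩ := D.exists_factoredHolonomy_eq hq x e₀ Q.continuous hQq hQ0 c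
  obtain ⟨τ, hτ, hτ0⟩ := hq.exists_homeomorph_of_apply_eq
    (a := e₀.1) (b := (hq.monodromy (FundamentalGroup.toPath c) e₀).1)
    (e₀.2.trans (hq.monodromy (FundamentalGroup.toPath c) e₀).2.symm)
  refine ⟨τ, hτ, hτ0, fun y => ?_⟩
  -- Both maps lift the projection of E to M^{f,h}, and they agree at e₀ by the choice of γ.
  have h1 : Q.comp τ = (⟨fun e => γ • Q e, Q.continuous.const_smul γ⟩ : C(E, D.AdS)) := by
    refine (hp.existsUnique_continuousMap_lifts qv e₀ (γ • x.1) ?_).unique ⟨?_, ?_⟩ ⟨?_, ?_⟩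
    · rw [← h0]
      exact Quotient.sound (MulAction.orbitRel_apply.mpr ⟨γ, rfl⟩)
    · change Q (τ e₀) = _
      rw [hτ0, hγQ]
    · funext e
      change (⟦Q (τ e)⟧ : D.M) = (q e).1
      rw [hQq, ← congrFun hτ e]
      rfl
    · change γ • Q e₀ = _
      rw [hQ0]
    · funext e
      change (⟦γ • Q e⟧ : D.M) = (q e).1
      rw [← hQq]
      exact Quotient.sound (MulAction.orbitRel_apply.mpr ⟨γ, rfl⟩)
  rw [hγ]
  change D.incl (Q (τ y)) = adsIsom _ (D.incl (Q y))
  have h2 : Q (τ y) = γ • Q y := DFunLike.congr_fun h1 y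
  rw [h2, incl_smul]

end EquivariantPair

/-! ### The main theorem -/

theorem theoremB (Γ : Subgroup PSL2R) [ProperlyDiscontinuousSMul Γ ℍ] [IsCancelSMul Γ ℍ]
    (D : EquivariantPair Γ) (hbranched : IsBranchedImmersion D.h) (hlt : PullbackLT D.f D.h) :
    -- `AdS^{f,h}` is a solid torus
    Nonempty (D.AdS ≃ₜ (Metric.ball (0 : ℂ) 1) × Circle) ∧
    -- (1) the action is by homeomorphisms, free and properly discontinuous
    (ContinuousConstSMul Γ D.AdS ∧ IsCancelSMul Γ D.AdS ∧ ProperlyDiscontinuousSMul Γ D.AdS) ∧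
    -- (2) the equivariant circle fibration
    (Continuous D.fib ∧ (∀ (γ : Γ) (x : D.AdS), D.fib (γ • x) = γ • D.fib x) ∧
      ∀ p : ℍ, Nonempty (↥(D.fib ⁻¹' {p}) ≃ₜ Circle)) ∧
    -- (3) `AdS^{f,h}_*` is an anti-de Sitter manifold and a principal `S¹`-bundle over `ℍ \ C`
    -- with timelike geodesic fibers
    (∃ S : AdSStructure D.AdSStar, IsDevelopingMap S id D.inclStar ∧
      IsPrincipalCircleBundle D.fibStar ∧
      ∀ p : ↥(D.C)ᶜ, IsTimelikeGeodesicSubset S (D.fibStar ⁻¹' {p})) ∧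
    -- (4) the quotient is a branched anti-de Sitter manifold with singular locus `L / Γ`
    -- (a link with finitely many components if the surface is closed), and its holonomy factors
    ∃ S : AdSStructure D.MStar, IsDevelopingMap S D.projStar D.inclStar ∧
      IsBranchedAdS ↥D.C₀ S ∧ (CompactSpace (HypSurface Γ) → Finite ↥D.C₀) ∧
      ∀ (E : Type) [TopologicalSpace E] [SimplyConnectedSpace E] (q : E → D.MStar)
        (hq : IsCoveringMap q) (x : D.AdSStar) (e₀ : q ⁻¹' {D.projStar x}),
        ∃ (dev : E → PSL2R) (hol : FundamentalGroup D.MStar (D.projStar x) →* (PSL2R × PSL2R)ᵐᵒᵖ),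
          IsDevelopingMap S q dev ∧ IsHolonomy hq e₀ dev hol ∧ hol = D.factoredHolonomy x := by
  have hdev := (D.isAdSUniformization_projStar hlt).isDevelopingMap
  have hdev' := (D.isAdSUniformization_id hlt).isDevelopingMap
  refine ⟨D.solidTorus, ⟨inferInstance, inferInstance, inferInstance⟩,
    ⟨D.continuous_fib, D.fib_smul, D.fiber_homeo_circle⟩,
    ⟨_, hdev', isPrincipalCircleBundle_of_homeomorph D.starHomeo fun _ => rfl,
      D.isTimelikeGeodesicSubset_fiber hdev'⟩,
    _, hdev, D.isBranchedAdS hbranched hlt hdev, fun _ => D.finite_C₀ hbranched, ?_⟩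
  intro E _ _ q hq x e₀
  obtain ⟨dev, h1, h2⟩ := D.exists_isHolonomy hdev hq x e₀
  exact ⟨dev, _, h1, h2, rfl⟩

end
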